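/- Let $d\ge 1$, $m\ge 2$, $M\ge 0$ be integers; all functions, distributions and measures below are real-valued. **Spaces and operators.** Let $\mathcal S_{\mathrm{Liz}}(\mathbb R^d)$ be the space of Schwartz functions all of whose moments vanish, with the Schwartz topology, and $\mathcal S'_{\mathrm{Liz}}(\mathbb R^d)$ its continuous dual. For functions on $\mathbb R\times\mathbb S^{d-1}$, with points $z=(t,\xi)$, let $\mathcal S_{\mathrm{Liz},m}$ be the space of Schwartz functions $g$ with $g(-z)=(-1)^m g(z)$ and $\int_{\mathbb R} t^k g(t,\xi)\,\mathrm dt=0$ for all $\xi\in\mathbb S^{d-1}$, $k\in\mathbb N$, and let $\mathcal M_m$ be the space of finite signed Borel measures $\mu$ with $\mu(-A)=(-1)^m\mu(A)$. Let $\mathrm R\varphi(t,\xi)=\int_{\langle \xi,x\rangle=t}\varphi$ be the Radon transform, $\mathrm R^*g(x)=\int_{\mathbb S^{d-1}}g(\langle\xi,x\rangle,\xi)\,\mathrm d\xi$ the backprojection, $\mathrm K_{\mathrm{rad}}$ the Fourier multiplier in $t$ with symbol $|\omega|^{d-1}/(2(2\pi)^{d-1})$, $\omega$ being the angular frequency,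 and $\partial_t^{-1}g(t,\xi)=\int_t^\infty g(r,\xi)\,\mathrm dr$ on test functions. For $\mu\in\mathcal M_m$ define $\mathrm R^*\partial_t^{-m}\{\mu\}\in\mathcal S'_{\mathrm{Liz}}(\mathbb R^d)$ by $\varphi\mapsto\int \partial_t^{-m}\mathrm R\varphi\,\mathrm d\mu$, define $\mathrm R^*\partial_t^{-m}\{\delta_{z}\}$ by $\varphi\mapsto \partial_t^{-m}\mathrm R\varphi(z)$, and set $$\mathcal M_{\mathrm{Rad},m}(\mathbb R^d)=\bigl\{\mathrm R^*\partial_t^{-m}\{\mu\}:\mu\in\mathcal M_m\bigr\}.$$ For $f\in\mathcal S'_{\mathrm{Liz}}(\mathbb R^d)$ the distribution $\partial_t^m\mathrm K_{\mathrm{rad}}\mathrm Rf$ is defined by $\langle \partial_t^m\mathrm K_{\mathrm{rad}}\mathrm Rf,g\rangle=(-1)^m\langle f,\mathrm R^*\mathrm K_{\mathrm{rad}}\partial_t^m g\rangle$ for $g\in\mathcal S_{\mathrm{Liz},m}$, and $\|\partial_t^m\mathrm K_{\mathrm{rad}}\mathrm Rf\|_{\mathcal M}$ is the supremum of this pairing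 over all such $g$ with $\|g\|_\infty\le 1$. The weak* topology of $\mathcal M_{\mathrm{Rad},m}(\mathbb R^d)$ is the one given by the predual $C_{\mathrm{Rad},m}(\mathbb R^d)$, the completion of $\mathcal S_{\mathrm{Liz}}(\mathbb R^d)$ in the norm $\|\partial_t^{-m}\mathrm R\varphi\|_\infty$. **Representatives.** Let $\rho_{\mathrm{Rad},m}(u)=\max\{0,u\}^{m-1}/(m-1)!$ and $$h\bigl(x,(t,\xi)\bigr)=\rho_{\mathrm{Rad},m}(\langle\xi,x\rangle-t)-\max\{0,\min\{-t,1\}\}\frac{(\langle\xi,x\rangle-t)^{m-1}}{(m-1)!}.$$ For $f=\mathrm R^*\partial_t^{-m}\{\mu\}$, $\mu\in\mathcal M_m$ (which $f$ determines), let $\mathrm P_{\mathrm{Rad},m}\{f\}(x)=\int h(x,z)\,\mathrm d\mu(z)$. **Theorem.** Let $E\colon\mathbb R\times\mathbb R\to[0,\infty)$ be such that $E(y,\cdot)$ is strictly convex for every $y$, let $(x_i,y_i)\in\mathbb R^d\times\mathbb R$, $i=1,\dots,M$, and let $\lambda>0$. Then the solution set $$S=\operatorname*{arg\,min}_{f\in\mathcal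 M_{\mathrm{Rad},m}(\mathbb R^d)}\ \sum_{i=1}^M E\bigl(y_i,\mathrm P_{\mathrm{Rad},m}\{f\}(x_i)\bigr)+\lambda\,\|\partial_t^m\mathrm K_{\mathrm{rad}}\mathrm Rf\|_{\mathcal M}$$ is nonempty and weak* compact, and it is the weak* closure of the convex hull of its extreme points. Every extreme point $f$ of $S$ is of the form $$f=\sum_{k=1}^{K}a_k\,\mathrm R^*\partial_t^{-m}\{\delta_{(t_k,\xi_k)}\},\qquad \mathrm P_{\mathrm{Rad},m}\{f\}(x)=\sum_{k=1}^{K}a_k\bigl(\rho_{\mathrm{Rad},m}(\langle\xi_k,x\rangle-t_k)-p_{t_k,\xi_k}(x)\bigr)\quad(x\in\mathbb R^d),$$ for some $K\le M$ and $(a_k,t_k,\xi_k)\in\mathbb R\times\mathbb R\times\mathbb S^{d-1}$, where $p_{t,\xi}$ is the polynomial of degree at most $m-1$ given by $$p_{t,\xi}(x)=\frac{1-\max\{-1,\min\{t,1\}\}}{2}\cdot\frac{(\langle\xi,x\rangle-t)^{m-1}}{(m-1)!}.$$ -/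

import Mathlib

open Set Filter Topology MeasureTheory
open scoped SchwartzMap FourierTransform ENNReal RealInnerProductSpace

noncomputable section

namespace RadonSpline

/-- The Euclidean space `ℝ^d`. -/
abbrev Euc (d : ℕ) : Type := EuclideanSpace ℝ (Fin d)

/-- The unit sphere `S^{d-1}` of `ℝ^d`. -/
abbrev Sph (d : ℕ) : Type := Metric.sphere (0 : Euc d) 1

/-- The Radon domain `ℝ × S^{d-1}`, with points `z = (t, ξ)`. -/
abbrev Dom (d : ℕ) : Type := ℝ × Sph d

/-! ### Lizorkin functions and distributions on `ℝ^d` -/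

lemma integrable_monomial_mul {d : ℕ} (k : Fin d → ℕ) (φ : 𝓢(Euc d, ℝ)) :
    Integrable (fun x : Euc d => (∏ i, x i ^ k i) * φ x) := by
  refine (φ.integrable_pow_mul volume (∑ i, k i)).mono' ?_ ?_
  · have h : Continuous fun x : Euc d => (∏ i, x i ^ k i) * φ x :=
      (by fun_prop : Continuous fun x : Euc d => ∏ i, x i ^ k i).mul φ.continuous
    exact h.aestronglyMeasurable
  · refine Eventually.of_forall fun x => ?_
    rw [norm_mul, norm_prod, ← Finset.prod_pow_eq_pow_sum]
    refine mul_le_mul_of_nonneg_right ?_ (norm_nonneg _)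
    refine Finset.prod_le_prod (fun i _ => norm_nonneg _) fun i _ => ?_
    rw [norm_pow]
    exact pow_le_pow_left₀ (norm_nonneg _) (PiLp.norm_apply_le x i) _

/-- The Lizorkin space `S_Liz(ℝ^d)`: the (real-valued) Schwartz functions all of whose moments
vanish, with the topology induced from the Schwartz space. -/
def lizorkin (d : ℕ) : Submodule ℝ 𝓢(Euc d, ℝ) where
  carrier := {φ | ∀ k : Fin d → ℕ, ∫ x : Euc d, (∏ i, x i ^ k i) * φ x = 0}
  zero_mem' k := by simp
  add_mem' {φ ψ} hφ hψ k := by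
    have h := integral_add (integrable_monomial_mul k φ) (integrable_monomial_mul k ψ)
    rw [hφ k, hψ k, add_zero] at h
    rw [← h]
    exact integral_congr_ae (Eventually.of_forall fun x => by simp [mul_add])
  smul_mem' c φ hφ k := by
    have h := integral_const_mul (μ := (volume : Measure (Euc d))) c fun x => (∏ i, x i ^ k i) * φ x
    rw [hφ k, mul_zero] at h
    rw [← h]
    exact integral_congr_ae (Eventually.of_forall fun x => by simp [mul_left_comm])

/-- The Lizorkin distributions `S'_Liz(ℝ^d)`: continuous linear functionals on `S_Liz(ℝ^d)`. -/
abbrev LizorkinDist (d : ℕ) : Type := lizorkin d →L[ℝ] ℝ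

/-! ### Operators between functions on `ℝ^d` and functions on the Radon domain -/

/-- The Radon transform `R φ (t, ξ)`: the integral of `φ` over the hyperplane
`{x | ⟪ξ, x⟫ = t} = t ξ + ξ^⊥`, with respect to its `(d-1)`-dimensional Lebesgue measure (the Haar
measure that gives mass one to the unit cubes of the Euclidean space `ξ^⊥`). -/
def radon {d : ℕ} (φ : Euc d → ℝ) (z : Dom d) : ℝ :=
  ∫ y : ↥(Submodule.span ℝ {(z.2 : Euc d)})ᗮ, φ (z.1 • (z.2 : Euc d) + (y : Euc d))
    ∂(stdOrthonormalBasis ℝ ↥(Submodule.span ℝ {(z.2 : Euc d)})ᗮ).toBasis.addHaar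

/-- The backprojection `R^* g (x) = ∫_{S^{d-1}} g(⟪ξ, x⟫, ξ) dξ`, with the surface measure. -/
def backproj {d : ℕ} (g : Dom d → ℝ) (x : Euc d) : ℝ :=
  ∫ ξ : Sph d, g (⟪(ξ : Euc d), x⟫, ξ) ∂(volume : Measure (Euc d)).toSphere

/-- The filter `K_rad`, acting on the variable `t` with frequency response `c_d |ω|^{d-1}`, where
`c_d = 1 / (2 (2π)^{d-1})`. The angular frequency is `ω = 2πw`, as the Fourier transform of Mathlib
has the kernel `exp(-2πi w t)`. -/
def radialFilter {d : ℕ} (g : Dom d → ℝ) (z : Dom d) : ℝ :=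
  (𝓕⁻ (fun w : ℝ => (((2 * (2 * Real.pi) ^ (d - 1))⁻¹ * |2 * Real.pi * w| ^ (d - 1) : ℝ) : ℂ) *
    𝓕 (fun s : ℝ => ((g (s, z.2) : ℝ) : ℂ)) w) z.1).re

/-- The derivative `∂_t^m`. -/
def tDeriv {d : ℕ} (m : ℕ) (g : Dom d → ℝ) (z : Dom d) : ℝ :=
  iteratedDeriv m (fun s => g (s, z.2)) z.1

/-- The integration `∂_t^{-1} g (t, ξ) = ∫_t^∞ g(r, ξ) dr` of test functions. -/
def tInt {d : ℕ} (g : Dom d → ℝ) (z : Dom d) : ℝ :=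
  ∫ r in Ioi z.1, g (r, z.2)

/-- The function `∂_t^{-m} R φ` on the Radon domain. -/
def intRadon {d : ℕ} (m : ℕ) (φ : lizorkin d) : Dom d → ℝ :=
  tInt^[m] (radon fun x => (φ : 𝓢(Euc d, ℝ)) x)

/-! ### Test functions on the Radon domain -/

/-- `g ∈ S_{Liz,m}(ℝ × S^{d-1})`: a Schwartz function on `ℝ × S^{d-1}` (that is, the restriction
of a Schwartz function on `ℝ × ℝ^d`), which is even for even `m` and odd for odd `m`, and all of
whose moments in `t` vanish in every direction `ξ`. -/
structure IsRadonLizorkin {d : ℕ} (m : ℕ) (g : Dom d → ℝ) : Prop where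
  schwartz : ∃ G : 𝓢(ℝ × Euc d, ℝ), ∀ z : Dom d, g z = G (z.1, (z.2 : Euc d))
  parity : ∀ z, g (-z) = (-1) ^ m * g z
  moments : ∀ (ξ : Sph d) (k : ℕ), ∫ t : ℝ, t ^ k * g (t, ξ) = 0

/-- The norm `‖∂_t^m K_rad R f‖_M` of a Lizorkin distribution `f`, as an extended number.
The distribution `∂_t^m K_rad R f` on the Radon domain acts on a test function
`g ∈ S_{Liz,m}(ℝ × S^{d-1})` by `(-1)^m ⟨f, φ⟩`, with `φ = R^* K_rad ∂_t^m g ∈ S_Liz(ℝ^d)`, and its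
total variation norm is the supremum of these values over the test functions `g` with
`‖g‖_∞ ≤ 1`. -/
def radonNorm {d : ℕ} (m : ℕ) (f : LizorkinDist d) : ℝ≥0∞ :=
  ⨆ (g : Dom d → ℝ) (_ : IsRadonLizorkin m g) (_ : ∀ z, |g z| ≤ 1) (φ : lizorkin d)
    (_ : ∀ x, (φ : 𝓢(Euc d, ℝ)) x = backproj (radialFilter (tDeriv m g)) x),
    ENNReal.ofReal ((-1) ^ m * f φ)

/-! ### The space `M_{Rad,m}(ℝ^d)` and its weak* topology -/

/-- `f = R^* ∂_t^{-m} μ` with `μ ∈ M_m`, that is: `μ` is a finite signed Borel measure on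
`ℝ × S^{d-1}`, even for even `m` and odd for odd `m`, and `⟨f, φ⟩ = ∫ ∂_t^{-m} R φ dμ` for every
Lizorkin function `φ`. -/
structure IsRepresentedBy {d : ℕ} (m : ℕ) (f : LizorkinDist d) (μ : SignedMeasure (Dom d)) :
    Prop where
  parity : ∀ A : Set (Dom d), MeasurableSet A → μ (Neg.neg ⁻¹' A) = (-1) ^ m * μ A
  integrable : ∀ φ : lizorkin d, VectorMeasure.Integrable μ (intRadon m φ)
  apply_eq : ∀ φ : lizorkin d, f φ = ∫ᵛ z, intRadon m φ z ∂<•μ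

/-- `M_{Rad,m}(ℝ^d) = {R^* ∂_t^{-m} μ | μ ∈ M_m}` as a subspace of the Lizorkin distributions. -/
def radonSubmodule (d m : ℕ) : Submodule ℝ (LizorkinDist d) where
  carrier := {f | ∃ μ : SignedMeasure (Dom d), IsRepresentedBy m f μ}
  zero_mem' := ⟨0, by simp, fun _ => VectorMeasure.Integrable.zero_vectorMeasure, by simp⟩
  add_mem' := by
    rintro f g ⟨μ, hμ⟩ ⟨ν, hν⟩
    refine ⟨μ + ν, fun A hA => ?_,
      fun φ => (hμ.integrable φ).add_vectorMeasure (hν.integrable φ), fun φ => ?_⟩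
    · rw [_root_.add_apply, _root_.add_apply, hμ.parity A hA, hν.parity A hA,
        mul_add]
    · rw [VectorMeasure.integral_add_vectorMeasure (hμ.integrable φ) (hν.integrable φ),
        ← hμ.apply_eq, ← hν.apply_eq]
      rfl
  smul_mem' := by
    rintro c f ⟨μ, hμ⟩
    refine ⟨c • μ, fun A hA => ?_, fun φ => (hμ.integrable φ).smul_vectorMeasure c, fun φ => ?_⟩
    · rw [_root_.smul_apply, _root_.smul_apply, hμ.parity A hA, smul_eq_mul,
        smul_eq_mul, mul_left_comm]
    · rw [VectorMeasure.integral_smul_vectorMeasure, ← hμ.apply_eq]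
      rfl

/-- The space `M_{Rad,m}(ℝ^d)`, as a type of its own, which carries the weak* topology below. -/
def RadonSpace (d m : ℕ) : Type := ↥(radonSubmodule d m)

instance (d m : ℕ) : AddCommGroup (RadonSpace d m) :=
  inferInstanceAs (AddCommGroup ↥(radonSubmodule d m))

instance (d m : ℕ) : Module ℝ (RadonSpace d m) :=
  inferInstanceAs (Module ℝ ↥(radonSubmodule d m))

/-- The Lizorkin distribution underlying an element of `M_{Rad,m}(ℝ^d)`. -/
def RadonSpace.toDist {d m : ℕ} (f : RadonSpace d m) : LizorkinDist d := Subtype.val f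

/-- Cauchy sequences in `S_Liz(ℝ^d)` for the norm `‖∂_t^{-m} R φ‖_∞`. They represent the elements
of the completion `C_{Rad,m}(ℝ^d)` of `S_Liz(ℝ^d)` in this norm, the predual of
`M_{Rad,m}(ℝ^d)`. -/
def IsPredualCauchy {d : ℕ} (m : ℕ) (u : ℕ → lizorkin d) : Prop :=
  ∀ ε > 0, ∃ N, ∀ n ≥ N, ∀ k ≥ N, ∀ z, |intRadon m (u n - u k) z| ≤ ε

/-- The weak* topology of `M_{Rad,m}(ℝ^d)`: the coarsest topology for which all the functionals
`f ↦ ⟨f, v⟩`, `v ∈ C_{Rad,m}(ℝ^d)`, are continuous, where `⟨f, v⟩ = lim ⟨f, φ_n⟩` for any Cauchy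
sequence `φ_n ∈ S_Liz(ℝ^d)` that represents `v`. -/
instance (d m : ℕ) : TopologicalSpace (RadonSpace d m) :=
  ⨅ u : {u : ℕ → lizorkin d // IsPredualCauchy m u},
    TopologicalSpace.induced (fun f => limUnder atTop fun n => f.toDist (u.1 n)) inferInstance

/-! ### Ridges, correcting polynomials and the representation operator -/

/-- The profile `ρ_{Rad,m}(u) = max{0, u}^{m-1} / (m-1)!`. -/
def rho (m : ℕ) (u : ℝ) : ℝ := max 0 u ^ (m - 1) / (Nat.factorial (m - 1) : ℝ)

/-- The correcting polynomial
`p_{t,ξ}(x) = max{0, min{-t, 1}} (⟪ξ, x⟫ - t)^{m-1} / (m-1)!` of the kernel. -/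
def kernelPoly {d : ℕ} (m : ℕ) (z : Dom d) (x : Euc d) : ℝ :=
  max 0 (min (-z.1) 1) * (⟪(z.2 : Euc d), x⟫ - z.1) ^ (m - 1) / (Nat.factorial (m - 1) : ℝ)

/-- The kernel `h(x, z) = ρ_{Rad,m}(⟪ξ, x⟫ - t) - p_{t,ξ}(x)`, `z = (t, ξ)`. -/
def kernel {d : ℕ} (m : ℕ) (x : Euc d) (z : Dom d) : ℝ :=
  rho m (⟪(z.2 : Euc d), x⟫ - z.1) - kernelPoly m z x

/-- The measure `μ ∈ M_m` with `f = R^* ∂_t^{-m} μ` (it is unique). -/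
def RadonSpace.measure {d m : ℕ} (f : RadonSpace d m) : SignedMeasure (Dom d) :=
  Classical.choose (show ∃ μ, IsRepresentedBy m f.toDist μ from f.2)

/-- The representation operator `P_{Rad,m}`, which maps `f = R^* ∂_t^{-m} μ` to the function
`x ↦ ∫ h(x, z) dμ(z)`. -/
def RadonSpace.rep {d m : ℕ} (f : RadonSpace d m) (x : Euc d) : ℝ :=
  ∫ᵛ z, kernel m x z ∂<•f.measure

/-- The correcting polynomial that `P_{Rad,m}` subtracts from the ridge
`ρ_{Rad,m}(⟪ξ, x⟫ - t)`:
the polynomial `(1 - max{-1, min{t, 1}}) / 2 * (⟪ξ, x⟫ - t)^{m-1} / (m-1)!` in `x`.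
With this polynomial, the corrected ridge is `(h(x, z) + (-1)^m h(x, -z)) / 2`, `z = (t, ξ)`. -/
def ridgePoly {d : ℕ} (m : ℕ) (z : Dom d) : MvPolynomial (Fin d) ℝ :=
  MvPolynomial.C ((1 - max (-1) (min z.1 1)) / 2 / (Nat.factorial (m - 1) : ℝ)) *
    (∑ i, MvPolynomial.C ((z.2 : Euc d) i) * MvPolynomial.X i - MvPolynomial.C z.1) ^ (m - 1)

/-! ### The variational problem -/

/-- The functional `∑ i, E(y_i, P_{Rad,m} f (x_i)) + λ ‖∂_t^m K_rad R f‖_M`. -/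
def objective {d m M : ℕ} (E : ℝ → ℝ → ℝ) (x : Fin M → Euc d) (y : Fin M → ℝ) (lam : ℝ)
    (f : RadonSpace d m) : EReal :=
  ((∑ i, E (y i) (f.rep (x i)) : ℝ) : EReal) + (lam : EReal) * (radonNorm m f.toDist : EReal)

/-- The set of minimisers of the functional over `M_{Rad,m}(ℝ^d)`. -/
def solutionSet {d M : ℕ} (m : ℕ) (E : ℝ → ℝ → ℝ) (x : Fin M → Euc d) (y : Fin M → ℝ)
    (lam : ℝ) : Set (RadonSpace d m) :=
  {f | ∀ g : RadonSpace d m, objective E x y lam f ≤ objective E x y lam g}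

end RadonSpline

end

/-!
The operator `∂_t^{-m} R` turns a Lizorkin function `φ` into the convolution of `φ` with ridges,
`∂_t^{-m} R φ (t, ξ) = ∫ ρ(⟪ξ, x⟫ - t) φ(x) dx` (`intRadon_eq`), which is a continuous function on
the Radon domain that vanishes at infinity and has the parity `(-1)^m`. So everything takes place
in the duality between `C₀(ℝ × S^{d-1})` and the finite signed measures, once it is known that
these functions are dense in the functions of `C₀(ℝ × S^{d-1})` of the parity `(-1)^m`.

Density rests on an inversion formula: if `φ = R^* K_rad ∂_t^m g` for a test function `g`, then
`∂_t^{-m} R φ = (-1)^m g` (`intRadon_of_backproj`). It follows from the Fourier slice theorem and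
polar coordinates: the filter `K_rad` is the Jacobian of polar coordinates in frequency space, so
that the Fourier transform of `φ` at `w ξ` is the one-dimensional transform of `∂_t^m g(·, ξ)` at
`w`. Test functions `g` whose frequencies in `t` lie in an annulus are of this kind, because the
polar function is then smooth with compact support away from the origin, and they are uniformly
dense by the Weierstrass theorem and a frequency cutoff (`exists_isRadonLizorkin_near`).

Consequently `‖∂_t^m K_rad R f‖_M` is the total variation of the measure that represents `f`
(`IsRepresentedBy.radonNorm_eq`), this measure is unique, and the topology of `M_{Rad,m}(ℝ^d)` is
the weak* topology of the representing measures (`RadonSpace.topology_eq_induced`). The kernel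
`h(x, ·)` is continuous with compact support, so that `f ↦ P f (x)` is weak* continuous. Balls of
the total variation are compact by Tychonoff's theorem and the Riesz–Markov–Kakutani theorem
(`RadonSpace.isCompact_tv_le`). Existence and compactness of the solution set are then the direct
method, and the statement about the closed convex hull is the Krein–Milman theorem.

For an extreme point `f` of the solution set, the measure cannot charge `M + 1` disjoint symmetric
sets: some nontrivial rescaling of its restrictions to these sets leaves the `M` values
`P f (x_i)` unchanged, and the total variation is affine along this rescaling, so by minimality
constant; hence `f` would be a midpoint of two other solutions
(`not_exists_disjoint_of_mem_extremePoints`). So the support consists of at most `M` pairs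
`{z, -z}`, and the ridge with the correcting polynomial is the part of the kernel `h(x, z)` of the
parity `(-1)^m` in `z` (`kernel_add_kernel_neg`).
-/

open Set Filter Topology MeasureTheory
open scoped SchwartzMap FourierTransform ENNReal RealInnerProductSpace

noncomputable section

namespace RadonSpline

/-! ### Integration over slices and the formula for the integrated Radon transform -/

lemma norm_sph {d : ℕ} (ξ : Sph d) : ‖(ξ : Euc d)‖ = 1 := by simp

lemma inner_sph_self {d : ℕ} (ξ : Sph d) : ⟪(ξ : Euc d), (ξ : Euc d)⟫ = 1 := by
  rw [real_inner_self_eq_norm_sq, norm_sph, one_pow]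

lemma abs_inner_sph_le {d : ℕ} (ξ : Sph d) (x : Euc d) : |⟪(ξ : Euc d), x⟫| ≤ ‖x‖ := by
  simpa using abs_real_inner_le_norm (ξ : Euc d) x

/-- The hyperplane `ξ^⊥`. -/
abbrev Perp {d : ℕ} (ξ : Sph d) : Submodule ℝ (Euc d) := (Submodule.span ℝ {(ξ : Euc d)})ᗮ

lemma inner_perp {d : ℕ} (ξ : Sph d) (y : Perp ξ) : ⟪(ξ : Euc d), (y : Euc d)⟫ = 0 :=
  Submodule.mem_orthogonal_singleton_iff_inner_right.1 y.2

lemma inner_slice {d : ℕ} (ξ : Sph d) (t : ℝ) (y : Perp ξ) :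
    ⟪(ξ : Euc d), t • (ξ : Euc d) + (y : Euc d)⟫ = t := by
  rw [inner_add_right, inner_smul_right, inner_sph_self, inner_perp]; ring

lemma radon_eq {d : ℕ} (φ : Euc d → ℝ) (t : ℝ) (ξ : Sph d) :
    radon φ (t, ξ) = ∫ y : Perp ξ, φ (t • (ξ : Euc d) + (y : Euc d)) := by
  unfold radon
  rw [OrthonormalBasis.addHaar_eq_volume]

/-- The parametrisation `(t, y) ↦ t ξ + y` of `ℝ^d` by `ℝ × ξ^⊥`. -/
def sliceEquiv {d : ℕ} (ξ : Sph d) : ℝ × Perp ξ ≃ᵐ Euc d :=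
  ((LinearIsometryEquiv.toSpanUnitSingleton (𝕜 := ℝ) (ξ : Euc d)
      (norm_sph ξ)).toMeasurableEquiv.prodCongr (MeasurableEquiv.refl _)).trans
    ((MeasurableEquiv.toLp 2 _).trans
      (Submodule.span ℝ {(ξ : Euc d)}).orthogonalDecomposition.symm.toMeasurableEquiv)

lemma sliceEquiv_apply {d : ℕ} (ξ : Sph d) (p : ℝ × Perp ξ) :
    sliceEquiv ξ p = p.1 • (ξ : Euc d) + (p.2 : Euc d) := by
  simp [sliceEquiv, MeasurableEquiv.prodCongr]

lemma measurePreserving_sliceEquiv {d : ℕ} (ξ : Sph d) :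
    MeasurePreserving (sliceEquiv ξ) := by
  refine MeasurePreserving.trans (e := MeasurableEquiv.prodCongr _ _)
    (MeasurePreserving.prod (LinearIsometryEquiv.measurePreserving _) (MeasurePreserving.id _)) ?_
  exact MeasurePreserving.trans (e := MeasurableEquiv.toLp 2 _)
    (WithLp.volume_preserving_toLp _ _) (LinearIsometryEquiv.measurePreserving _)

/-- Fubini's theorem for the hyperplanes orthogonal to `ξ`. -/
lemma integral_integral_slice {d : ℕ} {F : Type*} [NormedAddCommGroup F] [NormedSpace ℝ F]
    (ξ : Sph d) {f : Euc d → F} (hf : Integrable f) :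
    ∫ t : ℝ, ∫ y : Perp ξ, f (t • (ξ : Euc d) + (y : Euc d)) = ∫ x, f x := by
  have h1 : Integrable (fun p : ℝ × Perp ξ => f (sliceEquiv ξ p)) :=
    (measurePreserving_sliceEquiv ξ).integrable_comp_of_integrable hf
  rw [← (measurePreserving_sliceEquiv ξ).integral_comp (sliceEquiv ξ).measurableEmbedding,
    Measure.volume_eq_prod, integral_prod _ h1]
  simp only [sliceEquiv_apply]

/-- A weight that depends on `t = ⟪ξ, x⟫` only passes from the Radon transform to the function. -/
lemma integral_mul_radon {d : ℕ} (ξ : Sph d) (w : ℝ → ℝ) (φ : Euc d → ℝ)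
    (h : Integrable fun x => w ⟪(ξ : Euc d), x⟫ * φ x) :
    ∫ t, w t * radon φ (t, ξ) = ∫ x, w ⟪(ξ : Euc d), x⟫ * φ x := by
  rw [← integral_integral_slice ξ h]
  simp only [inner_slice, radon_eq, integral_const_mul]

lemma integral_smul_radon {d : ℕ} (ξ : Sph d) (w : ℝ → ℂ) (φ : Euc d → ℝ)
    (h : Integrable fun x => w ⟪(ξ : Euc d), x⟫ * (φ x : ℂ)) :
    ∫ t, w t * (radon φ (t, ξ) : ℂ) = ∫ x, w ⟪(ξ : Euc d), x⟫ * (φ x : ℂ) := by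
  rw [← integral_integral_slice ξ h]
  simp only [inner_slice, radon_eq, integral_const_mul, integral_complex_ofReal]

lemma integrable_radon {d : ℕ} (ξ : Sph d) {φ : Euc d → ℝ} (h : Integrable φ) :
    Integrable fun t => radon φ (t, ξ) := by
  have h1 : Integrable (fun p : ℝ × Perp ξ => φ (sliceEquiv ξ p)) :=
    (measurePreserving_sliceEquiv ξ).integrable_comp_of_integrable h
  rw [Measure.volume_eq_prod] at h1
  refine h1.integral_prod_left.congr (Eventually.of_forall fun t => ?_)
  simp [radon_eq, sliceEquiv_apply]

/-- The truncated power `u ↦ u_+^k / k!`, with the value `0` at `0` also for `k = 0`: the `k`-fold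
primitive of the Heaviside function. -/
def truncPow (k : ℕ) (u : ℝ) : ℝ := if 0 < u then u ^ k / (k.factorial : ℝ) else 0

lemma truncPow_nonneg (k : ℕ) (u : ℝ) : 0 ≤ truncPow k u := by
  unfold truncPow; split_ifs <;> positivity

lemma truncPow_le (k : ℕ) (u : ℝ) : truncPow k u ≤ |u| ^ k := by
  unfold truncPow
  split_ifs with h
  · rw [abs_of_pos h]
    exact div_le_self (by positivity) (by exact_mod_cast k.factorial_pos)
  · positivity

lemma measurable_truncPow (k : ℕ) : Measurable (truncPow k) :=
  Measurable.ite measurableSet_Ioi (by fun_prop) measurable_const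

lemma rho_eq_truncPow {m : ℕ} (hm : 2 ≤ m) (u : ℝ) : rho m u = truncPow (m - 1) u := by
  unfold rho truncPow
  split_ifs with h
  · rw [max_eq_right h.le]
  · rw [max_eq_left (not_lt.1 h), zero_pow (by lia), zero_div]

lemma continuous_rho (m : ℕ) : Continuous (rho m) := by unfold rho; fun_prop

/-- The primitive of a truncated power. -/
lemma integral_Ioi_truncPow (k : ℕ) (a t : ℝ) :
    IntegrableOn (fun s => truncPow k (a - s)) (Ioi t) ∧
      ∫ s in Ioi t, truncPow k (a - s) = truncPow (k + 1) (a - t) := by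
  have hind : (fun s => truncPow k (a - s)) =
      (Iio a).indicator fun s => (a - s) ^ k / (k.factorial : ℝ) := by
    ext s
    simp [truncPow, indicator]
  have hint : ∀ p q : ℝ,
      IntegrableOn (fun s => (a - s) ^ k / (k.factorial : ℝ)) (Ioo p q) := fun p q =>
    (Continuous.integrableOn_Icc (by fun_prop)).mono_set Ioo_subset_Icc_self
  rw [hind]
  constructor
  · rw [IntegrableOn, integrable_indicator_iff measurableSet_Iio, IntegrableOn,
      Measure.restrict_restrict measurableSet_Iio, inter_comm, Ioi_inter_Iio]
    exact hint t a
  · rw [setIntegral_indicator measurableSet_Iio, Ioi_inter_Iio]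
    unfold truncPow
    split_ifs with h
    · rw [sub_pos] at h
      rw [← integral_Ioc_eq_integral_Ioo, ← intervalIntegral.integral_of_le h.le,
        intervalIntegral.integral_div, intervalIntegral.integral_comp_sub_left (fun s => s ^ k) a,
        integral_pow]
      have : (k.factorial : ℝ) ≠ 0 := by positivity
      rw [Nat.factorial_succ]
      push_cast
      field_simp
      simp
    · rw [Ioo_eq_empty_of_le (by linarith)]; simp

lemma integrable_truncPow_mul {d : ℕ} (k : ℕ) (ξ : Sph d) (t : ℝ) (φ : 𝓢(Euc d, ℝ)) :
    Integrable fun x => truncPow k (⟪(ξ : Euc d), x⟫ - t) * φ x := by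
  have h1 : Integrable fun x : Euc d => 2 ^ (k - 1) * (‖x‖ ^ k * ‖φ x‖ + |t| ^ k * ‖φ x‖) :=
    ((φ.integrable_pow_mul volume k).add (φ.integrable.norm.const_mul _)).const_mul _
  refine h1.mono' ?_ (Eventually.of_forall fun x => ?_)
  · exact ((measurable_truncPow k).comp (by fun_prop)).aestronglyMeasurable.mul
      φ.continuous.aestronglyMeasurable
  · rw [norm_mul, Real.norm_of_nonneg (truncPow_nonneg _ _), ← add_mul, ← mul_assoc]
    refine mul_le_mul_of_nonneg_right ((truncPow_le _ _).trans ?_) (norm_nonneg _)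
    refine (pow_le_pow_left₀ (abs_nonneg _) ((abs_sub _ _).trans
      (add_le_add_left (abs_inner_sph_le ξ x) _)) k).trans ?_
    exact add_pow_le (norm_nonneg _) (abs_nonneg _) k

/-- The iterated integral `∂_t^{-(k+1)} R φ` is an integral of `φ` against a ridge function. -/
lemma tInt_iterate_radon {d : ℕ} (φ : 𝓢(Euc d, ℝ)) (k : ℕ) (t : ℝ) (ξ : Sph d) :
    tInt^[k + 1] (radon φ) (t, ξ) = ∫ x, truncPow k (⟪(ξ : Euc d), x⟫ - t) * φ x := by
  induction k generalizing t ξ with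
  | zero =>
    have h := integral_mul_radon ξ (fun s => truncPow 0 (s - t)) φ
      (integrable_truncPow_mul 0 ξ t φ)
    rw [← h, zero_add, Function.iterate_one, tInt, ← integral_indicator measurableSet_Ioi]
    congr 1 with s
    simp [truncPow, indicator]
  | succ k ih =>
    rw [Function.iterate_succ_apply', tInt]
    simp only [ih]
    have hswap : Integrable (Function.uncurry fun (s : ℝ) (x : Euc d) =>
        truncPow k (⟪(ξ : Euc d), x⟫ - s) * φ x) ((volume.restrict (Ioi t)).prod volume) := by
      have hmeas : AEStronglyMeasurable (Function.uncurry fun (s : ℝ) (x : Euc d) =>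
          truncPow k (⟪(ξ : Euc d), x⟫ - s) * φ x) ((volume.restrict (Ioi t)).prod volume) := by
        have h1 : Measurable fun p : ℝ × Euc d => truncPow k (⟪(ξ : Euc d), p.2⟫ - p.1) :=
          (measurable_truncPow k).comp (by fun_prop)
        have h2 : Continuous fun p : ℝ × Euc d => φ p.2 := φ.continuous.comp continuous_snd
        exact (h1.mul h2.measurable).aestronglyMeasurable
      rw [integrable_prod_iff' hmeas]
      refine ⟨Eventually.of_forall fun x => ?_, ?_⟩
      · exact (integral_Ioi_truncPow k ⟪(ξ : Euc d), x⟫ t).1.mul_const (φ x)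
      · refine (integrable_truncPow_mul (k + 1) ξ t φ).norm.congr (Eventually.of_forall fun x => ?_)
        simp only [Function.uncurry, norm_mul, Real.norm_of_nonneg (truncPow_nonneg _ _)]
        rw [integral_mul_const, (integral_Ioi_truncPow k _ t).2]
    rw [integral_integral_swap hswap]
    congr 1 with x
    rw [integral_mul_const, (integral_Ioi_truncPow k _ t).2]

/-- `∂_t^{-m} R φ (t, ξ)` is the integral of `φ` against the ridge with profile `ρ_{Rad,m}`. -/
lemma intRadon_eq {d m : ℕ} (hm : 2 ≤ m) (φ : lizorkin d) (z : Dom d) :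
    intRadon m φ z = ∫ x, rho m (⟪(z.2 : Euc d), x⟫ - z.1) * (φ : 𝓢(Euc d, ℝ)) x := by
  obtain ⟨k, rfl⟩ : ∃ k, m = k + 1 := ⟨m - 1, by lia⟩
  have h := tInt_iterate_radon (φ : 𝓢(Euc d, ℝ)) k z.1 z.2
  simp only [rho_eq_truncPow hm]
  exact h

lemma integrable_rho_mul {d m : ℕ} (hm : 2 ≤ m) (φ : 𝓢(Euc d, ℝ)) (z : Dom d) :
    Integrable fun x => rho m (⟪(z.2 : Euc d), x⟫ - z.1) * φ x := by
  simp only [rho_eq_truncPow hm]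
  exact integrable_truncPow_mul _ _ _ φ

/-! ### Integrated Radon transforms are continuous, symmetric and vanish at infinity -/

/-- A Lizorkin function is orthogonal to all polynomials. -/
lemma integral_eval_mul {d : ℕ} (φ : lizorkin d) (p : MvPolynomial (Fin d) ℝ) :
    Integrable (fun x : Euc d => MvPolynomial.eval (fun i => x i) p * (φ : 𝓢(Euc d, ℝ)) x) ∧
      ∫ x : Euc d, MvPolynomial.eval (fun i => x i) p * (φ : 𝓢(Euc d, ℝ)) x = 0 := by
  simp only [MvPolynomial.eval_eq', Finset.sum_mul, mul_assoc]
  have h : ∀ k : Fin d →₀ ℕ, Integrable fun x : Euc d =>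
      p.coeff k * ((∏ i, x i ^ k i) * (φ : 𝓢(Euc d, ℝ)) x) := fun k =>
    (integrable_monomial_mul k (φ : 𝓢(Euc d, ℝ))).const_mul _
  refine ⟨integrable_finsetSum _ fun k _ => h k, ?_⟩
  rw [integral_finsetSum _ fun k _ => h k]
  refine Finset.sum_eq_zero fun k _ => ?_
  rw [integral_const_mul, φ.2 k, mul_zero]

lemma eval_linear_sub {d : ℕ} (z : Dom d) (x : Euc d) :
    MvPolynomial.eval (fun i => x i)
      (∑ i, MvPolynomial.C ((z.2 : Euc d) i) * MvPolynomial.X i - MvPolynomial.C z.1) =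
      ⟪(z.2 : Euc d), x⟫ - z.1 := by
  simp [PiLp.inner_apply, mul_comm]

lemma integral_inner_pow_mul {d : ℕ} (φ : lizorkin d) (z : Dom d) (k : ℕ) :
    Integrable (fun x => (⟪(z.2 : Euc d), x⟫ - z.1) ^ k * (φ : 𝓢(Euc d, ℝ)) x) ∧
      ∫ x, (⟪(z.2 : Euc d), x⟫ - z.1) ^ k * (φ : 𝓢(Euc d, ℝ)) x = 0 := by
  have h := integral_eval_mul φ
    ((∑ i, MvPolynomial.C ((z.2 : Euc d) i) * MvPolynomial.X i - MvPolynomial.C z.1) ^ k)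
  simpa only [map_pow, eval_linear_sub] using h

lemma rho_nonneg (m : ℕ) (u : ℝ) : 0 ≤ rho m u := by unfold rho; positivity

/-- Reflecting the profile changes it by a polynomial only. -/
lemma rho_neg {m : ℕ} (hm : 2 ≤ m) (u : ℝ) :
    rho m (-u) = (-1) ^ m * (rho m u - u ^ (m - 1) / ((m - 1).factorial : ℝ)) := by
  obtain ⟨k, rfl⟩ : ∃ k, m = k + 2 := ⟨m - 2, by lia⟩
  simp only [rho, show k + 2 - 1 = k + 1 by lia, ← sub_div, ← mul_div_assoc]
  congr 1
  rcases le_total u 0 with h | h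
  · rw [max_eq_right (by linarith : 0 ≤ -u), max_eq_left h, neg_pow]; ring
  · rw [max_eq_left (by linarith : -u ≤ 0), max_eq_right h]; ring

lemma coe_neg_sph {d : ℕ} (z : Dom d) : (((-z).2 : Sph d) : Euc d) = -(z.2 : Euc d) := rfl

lemma inner_neg_dom {d : ℕ} (z : Dom d) (x : Euc d) :
    ⟪((-z).2 : Euc d), x⟫ - (-z).1 = -(⟪(z.2 : Euc d), x⟫ - z.1) := by
  rw [coe_neg_sph, inner_neg_left, Prod.fst_neg]; ring

lemma intRadon_neg {d m : ℕ} (hm : 2 ≤ m) (φ : lizorkin d) (z : Dom d) :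
    intRadon m φ (-z) = (-1) ^ m * intRadon m φ z := by
  rw [intRadon_eq hm, intRadon_eq hm]
  obtain ⟨h1, h2⟩ := integral_inner_pow_mul φ z (m - 1)
  have h3 : ∀ x, rho m (⟪((-z).2 : Euc d), x⟫ - (-z).1) * (φ : 𝓢(Euc d, ℝ)) x =
      (-1) ^ m * (rho m (⟪(z.2 : Euc d), x⟫ - z.1) * (φ : 𝓢(Euc d, ℝ)) x) -
      (-1) ^ m * ((m - 1).factorial : ℝ)⁻¹ *
        ((⟪(z.2 : Euc d), x⟫ - z.1) ^ (m - 1) * (φ : 𝓢(Euc d, ℝ)) x) := fun x => by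
    rw [inner_neg_dom, rho_neg hm]; ring
  simp only [h3]
  rw [integral_sub ((integrable_rho_mul hm _ z).const_mul _) (h1.const_mul _),
    integral_const_mul, integral_const_mul, h2]
  ring

lemma rho_le {m : ℕ} {u v : ℝ} (hv : 0 ≤ v) (h : u ≤ v) : rho m u ≤ v ^ (m - 1) := by
  unfold rho
  refine (div_le_self (by positivity) (by exact_mod_cast Nat.factorial_pos _)).trans ?_
  exact pow_le_pow_left₀ (le_max_left _ _) (max_le hv h) _

lemma abs_intRadon_le {d m : ℕ} (hm : 2 ≤ m) (φ : lizorkin d) (z : Dom d) :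
    |intRadon m φ z| ≤ ∫ x, ‖x‖ ^ (m - 1) * ‖(φ : 𝓢(Euc d, ℝ)) x‖ := by
  wlog hz : 0 ≤ z.1 generalizing z
  · have h := this (-z) (by rw [Prod.fst_neg]; linarith)
    rwa [intRadon_neg hm, abs_mul, abs_pow, abs_neg, abs_one, one_pow, one_mul] at h
  rw [intRadon_eq hm, ← Real.norm_eq_abs]
  refine norm_integral_le_of_norm_le ((φ : 𝓢(Euc d, ℝ)).integrable_pow_mul volume _)
    (Eventually.of_forall fun x => ?_)
  rw [norm_mul, Real.norm_of_nonneg (rho_nonneg _ _)]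
  refine mul_le_mul_of_nonneg_right (rho_le (norm_nonneg x) ?_) (norm_nonneg _)
  linarith [abs_le.1 (abs_inner_sph_le z.2 x)]

lemma abs_mul_abs_intRadon_le {d m : ℕ} (hm : 2 ≤ m) (φ : lizorkin d) (z : Dom d) :
    |z.1| * |intRadon m φ z| ≤ ∫ x, ‖x‖ ^ m * ‖(φ : 𝓢(Euc d, ℝ)) x‖ := by
  wlog hz : 0 ≤ z.1 generalizing z
  · have h := this (-z) (by rw [Prod.fst_neg]; linarith)
    rwa [intRadon_neg hm, abs_mul, abs_pow, abs_neg, abs_one, one_pow, one_mul, Prod.fst_neg,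
      abs_neg] at h
  rw [intRadon_eq hm, ← abs_mul, ← integral_const_mul, ← Real.norm_eq_abs]
  refine norm_integral_le_of_norm_le ((φ : 𝓢(Euc d, ℝ)).integrable_pow_mul volume _)
    (Eventually.of_forall fun x => ?_)
  rw [← mul_assoc, norm_mul, Real.norm_of_nonneg (mul_nonneg hz (rho_nonneg _ _))]
  refine mul_le_mul_of_nonneg_right ?_ (norm_nonneg _)
  have h1 := (abs_le.1 (abs_inner_sph_le z.2 x)).2
  rcases le_total ⟪(z.2 : Euc d), x⟫ z.1 with h | h
  · rw [rho, max_eq_left (by linarith), zero_pow (by lia), zero_div, mul_zero]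
    positivity
  · calc z.1 * rho m (⟪(z.2 : Euc d), x⟫ - z.1) ≤ ‖x‖ * ‖x‖ ^ (m - 1) :=
        mul_le_mul (h.trans h1) (rho_le (norm_nonneg x) (by linarith)) (rho_nonneg _ _)
          (norm_nonneg _)
      _ = ‖x‖ ^ m := by rw [← pow_succ']; congr 1; lia

lemma continuous_intRadon {d m : ℕ} (hm : 2 ≤ m) (φ : lizorkin d) :
    Continuous (intRadon m φ) := by
  rw [continuous_iff_continuousAt]
  intro z₀
  simp only [funext (intRadon_eq hm φ)]
  -- near `z₀` the parameter `t` is bounded by `|t₀| + 1`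
  refine continuousAt_of_dominated (bound := fun x => 2 ^ (m - 1 - 1) *
    (‖x‖ ^ (m - 1) * ‖(φ : 𝓢(Euc d, ℝ)) x‖ + (|z₀.1| + 1) ^ (m - 1) * ‖(φ : 𝓢(Euc d, ℝ)) x‖))
    ?_ ?_ ?_ ?_
  · exact Eventually.of_forall fun z => (integrable_rho_mul hm _ z).aestronglyMeasurable
  · have : ∀ᶠ z : Dom d in 𝓝 z₀, |z.1| < |z₀.1| + 1 :=
      (continuous_fst.abs.tendsto z₀).eventually (gt_mem_nhds (lt_add_one _))
    filter_upwards [this] with z hz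
    refine Eventually.of_forall fun x => ?_
    rw [norm_mul, Real.norm_of_nonneg (rho_nonneg _ _), ← add_mul, ← mul_assoc]
    refine mul_le_mul_of_nonneg_right ?_ (norm_nonneg _)
    refine (rho_le (by positivity : 0 ≤ ‖x‖ + (|z₀.1| + 1)) ?_).trans
      (add_pow_le (norm_nonneg _) (by positivity) _)
    linarith [(abs_le.1 (abs_inner_sph_le z.2 x)).2, neg_abs_le z.1]
  · exact (((φ : 𝓢(Euc d, ℝ)).integrable_pow_mul volume _).add
      ((φ : 𝓢(Euc d, ℝ)).integrable.norm.const_mul _)).const_mul _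
  · refine Eventually.of_forall fun x => ContinuousAt.mul ?_ continuousAt_const
    exact ((continuous_rho m).comp (by fun_prop)).continuousAt

lemma tendsto_abs_fst_cocompact {d : ℕ} :
    Tendsto (fun z : Dom d => |z.1|) (cocompact (Dom d)) atTop := by
  refine tendsto_atTop.2 fun R => ?_
  have hK : IsCompact (Icc (-R) R ×ˢ (univ : Set (Sph d))) := isCompact_Icc.prod isCompact_univ
  filter_upwards [hK.compl_mem_cocompact] with z hz
  by_contra h
  exact hz ⟨abs_le.1 (not_le.1 h).le, mem_univ _⟩

lemma tendsto_zero_of_decay {d : ℕ} {v : Dom d → ℝ} {C : ℝ} (h : ∀ z, |z.1| * |v z| ≤ C) :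
    Tendsto v (cocompact (Dom d)) (𝓝 0) := by
  refine squeeze_zero_norm' (a := fun z => C / |z.1|) ?_
    (tendsto_abs_fst_cocompact.const_div_atTop C)
  filter_upwards [tendsto_abs_fst_cocompact.eventually_gt_atTop 0] with z hz
  rw [le_div_iff₀ hz, mul_comm]
  exact h z

open scoped ZeroAtInfty

lemma intRadon_add {d m : ℕ} (hm : 2 ≤ m) (φ ψ : lizorkin d) (z : Dom d) :
    intRadon m (φ + ψ) z = intRadon m φ z + intRadon m ψ z := by
  rw [intRadon_eq hm, intRadon_eq hm, intRadon_eq hm,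
    ← integral_add (integrable_rho_mul hm _ z) (integrable_rho_mul hm _ z)]
  congr 1 with x
  simp [mul_add]

lemma intRadon_smul {d m : ℕ} (hm : 2 ≤ m) (c : ℝ) (φ : lizorkin d) (z : Dom d) :
    intRadon m (c • φ) z = c * intRadon m φ z := by
  rw [intRadon_eq hm, intRadon_eq hm, ← integral_const_mul]
  congr 1 with x
  simp [mul_left_comm]

/-- The operator `∂_t^{-m} R` from the Lizorkin functions to the continuous functions on the Radon
domain that vanish at infinity. -/
def intRadonC0 {d m : ℕ} (hm : 2 ≤ m) : lizorkin d →ₗ[ℝ] C₀(Dom d, ℝ) where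
  toFun φ := ⟨⟨intRadon m φ, continuous_intRadon hm φ⟩,
    tendsto_zero_of_decay (abs_mul_abs_intRadon_le hm φ)⟩
  map_add' φ ψ := by ext z; exact intRadon_add hm φ ψ z
  map_smul' c φ := by ext z; exact intRadon_smul hm c φ z

lemma intRadonC0_apply {d m : ℕ} (hm : 2 ≤ m) (φ : lizorkin d) (z : Dom d) :
    intRadonC0 hm φ z = intRadon m φ z := rfl

/-- `∂_t^{-m} R` is continuous from the Schwartz topology to the supremum norm. -/
lemma continuous_intRadonC0 {d m : ℕ} (hm : 2 ≤ m) :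
    Continuous (intRadonC0 (d := d) hm) := by
  refine continuous_of_continuousAt_zero (intRadonC0 hm) ?_
  rw [ContinuousAt, map_zero, tendsto_zero_iff_norm_tendsto_zero]
  set p := (volume : Measure (Euc d)).integrablePower
  set I := ∫ x : Euc d, (1 + ‖x‖) ^ (-(p : ℝ))
  have hcont : ∀ k, Continuous fun φ : lizorkin d =>
      SchwartzMap.seminorm ℝ k 0 (φ : 𝓢(Euc d, ℝ)) := fun k =>
    ((schwartz_withSeminorms ℝ (Euc d) ℝ).continuous_seminorm (k, 0)).comp continuous_subtype_val
  have hlim : Tendsto (fun φ : lizorkin d => 2 ^ p * I *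
      (SchwartzMap.seminorm ℝ 0 0 (φ : 𝓢(Euc d, ℝ)) +
        SchwartzMap.seminorm ℝ (m - 1 + p) 0 (φ : 𝓢(Euc d, ℝ)))) (𝓝 0) (𝓝 0) := by
    have h : Continuous fun φ : lizorkin d => 2 ^ p * I *
      (SchwartzMap.seminorm ℝ 0 0 (φ : 𝓢(Euc d, ℝ)) +
        SchwartzMap.seminorm ℝ (m - 1 + p) 0 (φ : 𝓢(Euc d, ℝ))) :=
      ((hcont 0).add (hcont _)).const_mul _
    simpa using h.tendsto 0
  refine squeeze_zero (fun _ => norm_nonneg _) (fun φ => ?_) hlim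
  have h := (φ : 𝓢(Euc d, ℝ)).integral_pow_mul_iteratedFDeriv_le ℝ volume (m - 1) 0
  simp only [norm_iteratedFDeriv_zero] at h
  refine le_trans ?_ h
  exact (BoundedContinuousFunction.norm_le (integral_nonneg fun x => by positivity)).2
    (abs_intRadon_le hm φ)

/-! ### The Fourier transform in the variable `t` -/

/-- The derivative `∂_t K` of a Schwartz function `K` on `ℝ × ℝ^d`. -/
def dt {d : ℕ} (K : 𝓢(ℝ × Euc d, ℝ)) : 𝓢(ℝ × Euc d, ℝ) :=
  LineDeriv.lineDerivOp ((1, 0) : ℝ × Euc d) K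

lemma hasDerivAt_slice {d : ℕ} (K : 𝓢(ℝ × Euc d, ℝ)) (y : Euc d) (s : ℝ) :
    HasDerivAt (fun s => K (s, y)) (dt K (s, y)) s := by
  have h1 : HasDerivAt (fun s : ℝ => (s, y)) ((1, 0) : ℝ × Euc d) s :=
    (hasDerivAt_id s).prodMk (hasDerivAt_const s y)
  have h2 := (K.hasFDerivAt (s, y)).comp_hasDerivAt s h1
  rwa [dt, SchwartzMap.lineDerivOp_apply_eq_fderiv]

lemma iteratedDeriv_slice {d : ℕ} (K : 𝓢(ℝ × Euc d, ℝ)) (y : Euc d) (n : ℕ) (s : ℝ) :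
    iteratedDeriv n (fun s => K (s, y)) s = (dt^[n] K) (s, y) := by
  induction n generalizing s with
  | zero => simp
  | succ n ih =>
    rw [iteratedDeriv_succ, funext ih, Function.iterate_succ_apply']
    exact (hasDerivAt_slice _ y s).deriv

/-- Slices of a Schwartz function decay in `t`, uniformly in the direction. -/
lemma exists_slice_bound {d : ℕ} (K : 𝓢(ℝ × Euc d, ℝ)) :
    ∃ C : ℝ, 0 ≤ C ∧ ∀ (s : ℝ) (y : Euc d), |K (s, y)| ≤ C * (1 + s ^ 2)⁻¹ := by
  refine ⟨SchwartzMap.seminorm ℝ 0 0 K + SchwartzMap.seminorm ℝ 2 0 K, by positivity,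
    fun s y => ?_⟩
  rw [← div_eq_mul_inv, le_div_iff₀ (by positivity)]
  have h0 := K.norm_le_seminorm ℝ (s, y)
  have h2 := K.norm_pow_mul_le_seminorm ℝ 2 (s, y)
  have h3 : s ^ 2 ≤ ‖((s, y) : ℝ × Euc d)‖ ^ 2 := by
    rw [← sq_abs]
    exact pow_le_pow_left₀ (abs_nonneg _) (norm_fst_le ((s, y) : ℝ × Euc d)) 2
  have h4 := mul_le_mul_of_nonneg_right h3 (norm_nonneg (K (s, y)))
  rw [Real.norm_eq_abs] at *
  linarith

lemma continuous_slice {d : ℕ} (K : 𝓢(ℝ × Euc d, ℝ)) (y : Euc d) :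
    Continuous fun s : ℝ => K (s, y) :=
  K.continuous.comp (by fun_prop)

lemma integrable_slice {d : ℕ} (K : 𝓢(ℝ × Euc d, ℝ)) (y : Euc d) :
    Integrable fun s : ℝ => K (s, y) := by
  obtain ⟨C, -, hC⟩ := exists_slice_bound K
  exact (integrable_inv_one_add_sq.const_mul C).mono' (continuous_slice K y).aestronglyMeasurable
    (Eventually.of_forall fun s => hC s y)

/-- The Fourier transform of a Schwartz function on `ℝ × ℝ^d` in its first variable. -/
def ft {d : ℕ} (K : 𝓢(ℝ × Euc d, ℝ)) (w : ℝ) (y : Euc d) : ℂ :=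
  𝓕 (fun s : ℝ => ((K (s, y) : ℝ) : ℂ)) w

lemma ft_eq {d : ℕ} (K : 𝓢(ℝ × Euc d, ℝ)) (w : ℝ) (y : Euc d) :
    ft K w y = ∫ s : ℝ, Complex.exp (↑(-2 * Real.pi * s * w) * Complex.I) * (K (s, y) : ℂ) := by
  rw [ft, Real.fourier_real_eq_integral_exp_smul]
  simp only [smul_eq_mul]

lemma exists_ft_bound {d : ℕ} (K : 𝓢(ℝ × Euc d, ℝ)) :
    ∃ C : ℝ, 0 ≤ C ∧ ∀ (w : ℝ) (y : Euc d), ‖ft K w y‖ ≤ C := by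
  obtain ⟨C, hC0, hC⟩ := exists_slice_bound K
  refine ⟨∫ s : ℝ, C * (1 + s ^ 2)⁻¹, integral_nonneg fun s => by positivity, fun w y => ?_⟩
  rw [ft_eq]
  refine norm_integral_le_of_norm_le (integrable_inv_one_add_sq.const_mul C)
    (Eventually.of_forall fun s => ?_)
  rw [norm_mul, Complex.norm_exp_ofReal_mul_I, one_mul, Complex.norm_real]
  exact hC s y

lemma continuous_ft {d : ℕ} (K : 𝓢(ℝ × Euc d, ℝ)) :
    Continuous fun p : ℝ × Euc d => ft K p.1 p.2 := by
  simp only [ft_eq]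
  obtain ⟨C, hC0, hC⟩ := exists_slice_bound K
  refine continuous_of_dominated (bound := fun s => C * (1 + s ^ 2)⁻¹) (fun p => ?_) (fun p => ?_)
    (integrable_inv_one_add_sq.const_mul C) (Eventually.of_forall fun s => ?_)
  · have := continuous_slice K p.2
    exact Continuous.aestronglyMeasurable (by fun_prop)
  · refine Eventually.of_forall fun s => ?_
    rw [norm_mul, Complex.norm_exp_ofReal_mul_I, one_mul, Complex.norm_real]
    exact hC s p.2
  · have : Continuous fun p : ℝ × Euc d => K (s, p.2) := K.continuous.comp (by fun_prop)
    fun_prop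

lemma ft_dt {d : ℕ} (K : 𝓢(ℝ × Euc d, ℝ)) (w : ℝ) (y : Euc d) :
    ft (dt K) w y = (2 * Real.pi * Complex.I * w) * ft K w y := by
  have hd : ∀ s, HasDerivAt (fun s : ℝ => ((K (s, y) : ℝ) : ℂ)) ((dt K (s, y) : ℝ) : ℂ) s :=
    fun s => (hasDerivAt_slice K y s).ofReal_comp
  have hderiv : deriv (fun s : ℝ => ((K (s, y) : ℝ) : ℂ)) = fun s => ((dt K (s, y) : ℝ) : ℂ) :=
    funext fun s => (hd s).deriv
  have h := Real.fourier_deriv (f := fun s : ℝ => ((K (s, y) : ℝ) : ℂ))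
    (integrable_slice K y).ofReal (fun s => (hd s).differentiableAt)
    (by rw [hderiv]; exact (integrable_slice (dt K) y).ofReal)
  rw [hderiv] at h
  exact congrFun h w

lemma ft_dt_iterate {d : ℕ} (K : 𝓢(ℝ × Euc d, ℝ)) (n : ℕ) (w : ℝ) (y : Euc d) :
    ft (dt^[n] K) w y = (2 * Real.pi * Complex.I * w) ^ n * ft K w y := by
  induction n with
  | zero => simp
  | succ n ih => rw [Function.iterate_succ_apply', ft_dt, ih, pow_succ']; ring

lemma ft_neg_left {d : ℕ} (K : 𝓢(ℝ × Euc d, ℝ)) (w : ℝ) (y : Euc d) :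
    ft K (-w) y = starRingEnd ℂ (ft K w y) := by
  rw [ft_eq, ft_eq, ← integral_conj]
  congr 1 with s
  rw [map_mul, ← Complex.exp_conj, map_mul, Complex.conj_ofReal, Complex.conj_ofReal,
    Complex.conj_I]
  congr 2
  push_cast
  ring

lemma ft_neg_neg {d : ℕ} {K : 𝓢(ℝ × Euc d, ℝ)} {y : Euc d} (hK : ∀ s, K (-s, -y) = K (s, y))
    (w : ℝ) : ft K (-w) (-y) = ft K w y := by
  rw [ft_eq, ft_eq, ← integral_neg_eq_self]
  congr 1 with s
  rw [hK]
  congr 3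
  push_cast
  ring

/-- A decay bound of every order for the Fourier transform in `t`, uniform in the direction. -/
lemma exists_pow_mul_ft_bound {d : ℕ} (K : 𝓢(ℝ × Euc d, ℝ)) (n : ℕ) :
    ∃ C : ℝ, 0 ≤ C ∧ ∀ (w : ℝ) (y : Euc d), |w| ^ n * ‖ft K w y‖ ≤ C := by
  obtain ⟨C, hC0, hC⟩ := exists_ft_bound (dt^[n] K)
  refine ⟨C, hC0, fun w y => ?_⟩
  have h := hC w y
  rw [ft_dt_iterate, norm_mul, norm_pow, norm_mul, norm_mul, norm_mul, Complex.norm_I, mul_one,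
    Complex.norm_ofNat, Complex.norm_real, Complex.norm_real, Real.norm_of_nonneg Real.pi_pos.le,
    Real.norm_eq_abs] at h
  refine (mul_le_mul_of_nonneg_right (pow_le_pow_left₀ (abs_nonneg _) ?_ n)
    (norm_nonneg _)).trans h
  nlinarith [Real.pi_gt_three, abs_nonneg w]

/-! ### The frequency profile of a filtered backprojection -/

/-- The function on the frequency space `ℝ^d` that in polar coordinates `x = r ξ` is the Fourier
transform in `t` of `K(·, ξ)` at the frequency `r`. -/
def polarFt {d : ℕ} (K : 𝓢(ℝ × Euc d, ℝ)) (x : Euc d) : ℂ := ft K ‖x‖ (‖x‖⁻¹ • x)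

lemma polarFt_smul {d : ℕ} (K : 𝓢(ℝ × Euc d, ℝ)) {r : ℝ} (hr : 0 < r) (ξ : Sph d) :
    polarFt K (r • (ξ : Euc d)) = ft K r ξ := by
  rw [polarFt, norm_smul, norm_sph, mul_one, Real.norm_of_nonneg hr.le, smul_smul,
    inv_mul_cancel₀ hr.ne', one_smul]

lemma polarFt_dt_iterate {d : ℕ} (G : 𝓢(ℝ × Euc d, ℝ)) (m : ℕ) (x : Euc d) :
    polarFt (dt^[m] G) x = (2 * Real.pi * Complex.I * ‖x‖) ^ m * polarFt G x :=
  ft_dt_iterate G m _ _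

lemma continuous_polarFt {d : ℕ} (G : 𝓢(ℝ × Euc d, ℝ)) {m : ℕ} (hm : m ≠ 0) :
    Continuous (polarFt (dt^[m] G)) := by
  rw [continuous_iff_continuousAt]
  intro x
  rcases eq_or_ne x 0 with rfl | hx
  · obtain ⟨C, hC0, hC⟩ := exists_ft_bound G
    have h0 : polarFt (dt^[m] G) 0 = 0 := by simp [polarFt_dt_iterate, hm]
    rw [ContinuousAt, h0]
    have hb : Continuous fun x : Euc d => ‖(2 * Real.pi * Complex.I * ‖x‖ : ℂ) ^ m‖ * C := by
      fun_prop
    have hlim : Tendsto (fun x : Euc d => ‖(2 * Real.pi * Complex.I * ‖x‖ : ℂ) ^ m‖ * C)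
        (𝓝 0) (𝓝 0) := by simpa [hm] using hb.tendsto 0
    refine squeeze_zero_norm (fun x => ?_) hlim
    rw [polarFt_dt_iterate, norm_mul]
    exact mul_le_mul_of_nonneg_left (hC _ _) (norm_nonneg _)
  · have h0 : ‖x‖ ≠ 0 := norm_ne_zero_iff.2 hx
    have h1 : ContinuousAt (fun x : Euc d => ((‖x‖, ‖x‖⁻¹ • x) : ℝ × Euc d)) x :=
      continuous_norm.continuousAt.prodMk
        ((continuous_norm.continuousAt.inv₀ h0).smul continuousAt_id)
    have h2 := continuous_ft (dt^[m] G)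
    generalize dt^[m] G = K at h2
    have h3 : ContinuousAt ((fun p : ℝ × Euc d => ft K p.1 p.2) ∘
      fun x : Euc d => ((‖x‖, ‖x‖⁻¹ • x) : ℝ × Euc d)) x := h2.continuousAt.comp h1
    exact h3

lemma integrable_polarFt {d : ℕ} (G : 𝓢(ℝ × Euc d, ℝ)) {m : ℕ} (hm : m ≠ 0) :
    Integrable (polarFt (dt^[m] G)) := by
  obtain ⟨C₁, -, h1⟩ := exists_ft_bound (dt^[m] G)
  obtain ⟨C₂, -, h2⟩ := exists_pow_mul_ft_bound (dt^[m] G)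
    (0 + (volume : Measure (Euc d)).integrablePower)
  have hmeas := (continuous_polarFt G hm).aestronglyMeasurable (μ := volume)
  have h := integrable_of_le_of_pow_mul_le (μ := volume) (f := polarFt (dt^[m] G))
    (k := 0) (C₁ := C₁) (C₂ := C₂) (fun x => h1 _ _) (fun x => by
      have := h2 ‖x‖ (‖x‖⁻¹ • x)
      rwa [abs_norm] at this) hmeas
  simp only [pow_zero, one_mul] at h
  exact (integrable_norm_iff hmeas).1 h

/-- Integration in polar coordinates. -/
lemma integral_polar {d : ℕ} (hd : 1 ≤ d) {f : Euc d → ℝ} (hf : Integrable f) :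
    ∫ ξ : Sph d, (∫ r in Ioi (0 : ℝ), r ^ (d - 1) * f (r • (ξ : Euc d)))
      ∂(volume : Measure (Euc d)).toSphere = ∫ x, f x := by
  have : NeZero d := ⟨by lia⟩
  have hmp := (volume : Measure (Euc d)).measurePreserving_homeomorphUnitSphereProd
  rw [finrank_euclideanSpace_fin] at hmp
  have hemb := (homeomorphUnitSphereProd (Euc d)).measurableEmbedding
  set G : Sph d × Ioi (0 : ℝ) → ℝ := fun p => f ((p.2 : ℝ) • (p.1 : Euc d)) with hG
  have hcomp : ∀ x : ({0}ᶜ : Set (Euc d)), G (homeomorphUnitSphereProd (Euc d) x) = f x := by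
    intro x
    have : ‖(x : Euc d)‖ ≠ 0 := norm_ne_zero_iff.2 x.2
    simp [hG, smul_smul, this]
  have hint : Integrable G ((volume : Measure (Euc d)).toSphere.prod
      (Measure.volumeIoiPow (d - 1))) := by
    rw [← hmp.integrable_comp_emb hemb]
    refine Integrable.congr (f := fun x : ({0}ᶜ : Set (Euc d)) => f x) ?_
      (Eventually.of_forall fun x => (hcomp x).symm)
    exact (integrableOn_iff_comap_subtypeVal (measurableSet_singleton _).compl).1 hf.integrableOn
  have h1 := integral_prod _ hint
  rw [← hmp.integral_comp hemb] at h1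
  simp only [hcomp] at h1
  rw [integral_subtype_comap (measurableSet_singleton _).compl fun x => f x,
    restrict_compl_singleton] at h1
  rw [h1]
  congr 1 with ξ
  simp only [Measure.volumeIoiPow, ENNReal.ofReal]
  rw [integral_withDensity_eq_integral_smul (by fun_prop),
    integral_subtype_comap measurableSet_Ioi fun r => Real.toNNReal (r ^ (d - 1)) •
      f (r • (ξ : Euc d))]
  refine setIntegral_congr_fun measurableSet_Ioi fun r hr => ?_
  have hr' : (0 : ℝ) ≤ r ^ (d - 1) := pow_nonneg (le_of_lt hr) _
  simp [NNReal.smul_def, Real.coe_toNNReal _ hr']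

/-! ### The inversion formula -/

lemma tDeriv_eq {d m : ℕ} {g : Dom d → ℝ} {G : 𝓢(ℝ × Euc d, ℝ)}
    (hG : ∀ z : Dom d, g z = G (z.1, (z.2 : Euc d))) (z : Dom d) :
    tDeriv m g z = (dt^[m] G) (z.1, (z.2 : Euc d)) := by
  rw [tDeriv, ← iteratedDeriv_slice]
  congr 1
  ext s
  exact hG (s, z.2)

lemma dt_iterate_neg {d m : ℕ} {g : Dom d → ℝ} {G : 𝓢(ℝ × Euc d, ℝ)}
    (hG : ∀ z : Dom d, g z = G (z.1, (z.2 : Euc d))) (hg : ∀ z, g (-z) = (-1) ^ m * g z)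
    (s : ℝ) (ξ : Sph d) :
    (dt^[m] G) (-s, -(ξ : Euc d)) = (dt^[m] G) (s, (ξ : Euc d)) := by
  rw [← iteratedDeriv_slice, ← iteratedDeriv_slice]
  have h : (fun s => G (s, -(ξ : Euc d))) = fun s => (-1) ^ m * G (-s, (ξ : Euc d)) := by
    ext s
    have h1 := hg (-s, ξ)
    rw [hG, hG] at h1
    simpa using h1
  have h2 := iteratedDeriv_comp_neg m (fun s => G (s, (ξ : Euc d))) (-s)
  rw [h, iteratedDeriv_const_mul_field, h2, neg_neg, smul_eq_mul, ← mul_assoc,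
    ← mul_pow, neg_one_mul, neg_neg, one_pow, one_mul]

/-- The filter acts on a direction `ξ` by integration over positive frequencies only: the frequency
response is even and the Fourier transform of a real function is Hermitian. -/
lemma radialFilter_eq {d m : ℕ} {g : Dom d → ℝ} {G : 𝓢(ℝ × Euc d, ℝ)}
    (hG : ∀ z : Dom d, g z = G (z.1, (z.2 : Euc d))) (t : ℝ) (ξ : Sph d) :
    radialFilter (tDeriv m g) (t, ξ) = ∫ r in Ioi (0 : ℝ), r ^ (d - 1) *
      (Complex.exp (↑(2 * Real.pi * (r * t)) * Complex.I) * ft (dt^[m] G) r ξ).re := by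
  have hft : ∀ w : ℝ, 𝓕 (fun s : ℝ => ((tDeriv m g (s, ξ) : ℝ) : ℂ)) w =
      ft (dt^[m] G) w ξ := fun w => by
    simp only [tDeriv_eq hG]
    rfl
  unfold radialFilter
  simp only [hft]
  generalize hK : dt^[m] G = K
  have hcont : Continuous fun w : ℝ => ft K w ξ :=
    (continuous_ft K).comp (by fun_prop : Continuous fun w : ℝ => ((w, (ξ : Euc d)) : ℝ × Euc d))
  obtain ⟨C, -, hC⟩ := exists_ft_bound K
  obtain ⟨C₂, -, hC₂⟩ := exists_pow_mul_ft_bound K (d - 1 + (volume : Measure ℝ).integrablePower)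
  have hint : Integrable fun w : ℝ => |w| ^ (d - 1) * ‖ft K w ξ‖ :=
    integrable_of_le_of_pow_mul_le (fun w => hC w ξ) (fun w => hC₂ w ξ) hcont.aestronglyMeasurable
  set u : ℝ → ℂ := fun w => Complex.exp (↑(2 * Real.pi * (w * t)) * Complex.I) *
    ((((2 * (2 * Real.pi) ^ (d - 1))⁻¹ * |2 * Real.pi * w| ^ (d - 1) : ℝ) : ℂ) * ft K w ξ) with hu
  have hc : ∀ w : ℝ, (2 * (2 * Real.pi) ^ (d - 1))⁻¹ * |2 * Real.pi * w| ^ (d - 1) =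
      2⁻¹ * |w| ^ (d - 1) := fun w => by
    rw [abs_mul, abs_of_pos Real.two_pi_pos, mul_pow (2 * Real.pi) |w|]
    have : (2 * Real.pi) ^ (d - 1) ≠ 0 := by positivity
    field_simp
  have huint : Integrable u := by
    refine (hint.const_mul 2⁻¹).mono' ?_ (Eventually.of_forall fun w => ?_)
    · exact Continuous.aestronglyMeasurable (by fun_prop)
    · rw [hu]
      simp only [norm_mul, Complex.norm_exp_ofReal_mul_I, one_mul, Complex.norm_real, hc,
        Real.norm_eq_abs, abs_pow, abs_abs]
      rw [abs_of_pos (by norm_num : (0 : ℝ) < 2⁻¹), mul_assoc]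
  have hInv : 𝓕⁻ (fun w : ℝ => (((2 * (2 * Real.pi) ^ (d - 1))⁻¹ *
      |2 * Real.pi * w| ^ (d - 1) : ℝ) : ℂ) * ft K w ξ) t = ∫ w, u w := by
    rw [Real.fourierInv_eq']
    simp [hu, mul_comm]
  have heven : ∀ w, (u w).re = (u |w|).re := fun w => by
    rcases abs_choice w with h | h
    · rw [h]
    · rw [h, hu]
      simp only [ft_neg_left, hc, abs_neg]
      rw [← Complex.conj_re]
      congr 1
      simp only [map_mul, ← Complex.exp_conj, Complex.conj_ofReal, Complex.conj_I]
      congr 2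
      push_cast
      ring
  rw [hInv, ← RCLike.re_eq_complex_re, ← integral_re huint]
  simp only [RCLike.re_eq_complex_re]
  rw [funext heven, integral_comp_abs (f := fun w => (u w).re), ← integral_const_mul]
  refine setIntegral_congr_fun measurableSet_Ioi fun r hr => ?_
  simp only [hu, hc, abs_of_pos (mem_Ioi.1 hr)]
  rw [mul_left_comm, Complex.re_ofReal_mul]
  ring

/-- The filtered backprojection is an inverse Fourier transform on `ℝ^d`. -/
lemma backproj_radialFilter {d m : ℕ} (hd : 1 ≤ d) (hm : m ≠ 0) {g : Dom d → ℝ}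
    {G : 𝓢(ℝ × Euc d, ℝ)} (hG : ∀ z : Dom d, g z = G (z.1, (z.2 : Euc d))) (x : Euc d) :
    backproj (radialFilter (tDeriv m g)) x = (𝓕⁻ (polarFt (dt^[m] G)) x).re := by
  have hint : Integrable fun y : Euc d =>
      Complex.exp (↑(2 * Real.pi * ⟪y, x⟫) * Complex.I) * polarFt (dt^[m] G) y := by
    refine (integrable_polarFt G hm).bdd_mul (c := 1) ?_ (Eventually.of_forall fun y => ?_)
    · exact Continuous.aestronglyMeasurable (by fun_prop)
    · rw [Complex.norm_exp_ofReal_mul_I]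
  rw [Real.fourierInv_eq', ← RCLike.re_eq_complex_re]
  simp only [smul_eq_mul]
  rw [← integral_re hint]
  simp only [RCLike.re_eq_complex_re]
  have hre : Integrable fun y : Euc d =>
      (Complex.exp (↑(2 * Real.pi * ⟪y, x⟫) * Complex.I) * polarFt (dt^[m] G) y).re := hint.re
  rw [← integral_polar hd hre]
  unfold backproj
  congr 1 with ξ
  rw [radialFilter_eq hG]
  refine setIntegral_congr_fun measurableSet_Ioi fun r hr => ?_
  simp only [polarFt_smul _ (mem_Ioi.1 hr), inner_smul_left,
    conj_trivial]

lemma polarFt_neg {d m : ℕ} (hm : m ≠ 0) {g : Dom d → ℝ} {G : 𝓢(ℝ × Euc d, ℝ)}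
    (hG : ∀ z : Dom d, g z = G (z.1, (z.2 : Euc d))) (hg : ∀ z, g (-z) = (-1) ^ m * g z)
    (x : Euc d) :
    polarFt (dt^[m] G) (-x) = starRingEnd ℂ (polarFt (dt^[m] G) x) := by
  rcases eq_or_ne x 0 with rfl | hx
  · simp [polarFt_dt_iterate, hm]
  · have hx' : ‖x‖ ≠ 0 := norm_ne_zero_iff.2 hx
    set ξ : Sph d := ⟨‖x‖⁻¹ • x, by simp [norm_smul, hx']⟩ with hξ
    rw [polarFt, polarFt, norm_neg, smul_neg, ← ft_neg_left,
      ← ft_neg_neg (K := dt^[m] G) (y := ‖x‖⁻¹ • x) (dt_iterate_neg hG hg · ξ) (-‖x‖), neg_neg]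

lemma im_fourierInv_polarFt {d m : ℕ} (hm : m ≠ 0) {g : Dom d → ℝ} {G : 𝓢(ℝ × Euc d, ℝ)}
    (hG : ∀ z : Dom d, g z = G (z.1, (z.2 : Euc d))) (hg : ∀ z, g (-z) = (-1) ^ m * g z)
    (x : Euc d) : (𝓕⁻ (polarFt (dt^[m] G)) x).im = 0 := by
  rw [← Complex.conj_eq_iff_im, Real.fourierInv_eq', ← integral_conj, ← integral_neg_eq_self]
  congr 1 with y
  rw [smul_eq_mul, smul_eq_mul, map_mul, polarFt_neg hm hG hg, Complex.conj_conj,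
    ← Complex.exp_conj, map_mul, Complex.conj_ofReal, Complex.conj_I, inner_neg_left]
  congr 2
  push_cast
  ring

/-- The Fourier slice theorem. -/
lemma fourier_radon {d : ℕ} {φ : Euc d → ℝ} (hφ : Integrable φ) (ξ : Sph d) (w : ℝ) :
    𝓕 (fun t : ℝ => ((radon φ (t, ξ) : ℝ) : ℂ)) w =
      𝓕 (fun x : Euc d => ((φ x : ℝ) : ℂ)) (w • (ξ : Euc d)) := by
  rw [Real.fourier_real_eq_integral_exp_smul, Real.fourier_eq']
  simp only [smul_eq_mul]
  rw [integral_smul_radon ξ (fun t => Complex.exp (↑(-2 * Real.pi * t * w) * Complex.I))]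
  · congr 1 with x
    rw [inner_smul_right, real_inner_comm]
    congr 3
    push_cast
    ring
  · refine hφ.ofReal.bdd_mul (c := 1) ?_ (Eventually.of_forall fun y => ?_)
    · exact Continuous.aestronglyMeasurable (by fun_prop)
    · rw [Complex.norm_exp_ofReal_mul_I]

lemma continuous_radon {d : ℕ} (φ : 𝓢(Euc d, ℝ)) (ξ : Sph d) :
    Continuous fun t : ℝ => radon φ (t, ξ) := by
  simp only [radon_eq]
  set p := (volume : Measure (Perp ξ)).integrablePower
  set C₁ := SchwartzMap.seminorm ℝ 0 0 φ
  set C₂ := SchwartzMap.seminorm ℝ p 0 φ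
  refine continuous_of_dominated (bound := fun y => 2 ^ p * (C₁ + C₂) * (1 + ‖y‖) ^ (-(p : ℝ)))
    (fun t => ?_) (fun t => Eventually.of_forall fun y => ?_) ?_ (Eventually.of_forall fun y => ?_)
  · exact (φ.continuous.comp (by fun_prop)).aestronglyMeasurable
  · have hle : ‖y‖ ≤ ‖t • (ξ : Euc d) + (y : Euc d)‖ := by
      have h := norm_add_sq_real (t • (ξ : Euc d)) (y : Euc d)
      rw [inner_smul_left, inner_perp, mul_zero, mul_zero, add_zero] at h
      change ‖(y : Euc d)‖ ≤ _
      refine abs_le_of_sq_le_sq' ?_ (norm_nonneg _) |>.2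
      nlinarith [sq_nonneg ‖t • (ξ : Euc d)‖]
    have h := pow_mul_le_of_le_of_pow_mul_le (k := 0) (l := p) (norm_nonneg y)
      (norm_nonneg (φ (t • (ξ : Euc d) + (y : Euc d)))) (φ.norm_le_seminorm ℝ _)
      ((mul_le_mul_of_nonneg_right (pow_le_pow_left₀ (norm_nonneg _) hle _)
        (norm_nonneg _)).trans (by simpa using φ.norm_pow_mul_le_seminorm ℝ p _))
    simpa using h
  · exact (Measure.integrable_pow_neg_integrablePower _).const_mul _
  · exact φ.continuous.comp (by fun_prop)

/-- The inversion formula `R R^* K_rad h = h` for the even function `h = ∂_t^m g`. -/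
lemma radon_of_backproj {d m : ℕ} (hd : 1 ≤ d) (hm : m ≠ 0) {g : Dom d → ℝ}
    {G : 𝓢(ℝ × Euc d, ℝ)} (hG : ∀ z : Dom d, g z = G (z.1, (z.2 : Euc d)))
    (hg : ∀ z, g (-z) = (-1) ^ m * g z) {φ : 𝓢(Euc d, ℝ)}
    (hφ : ∀ x, φ x = backproj (radialFilter (tDeriv m g)) x) (t : ℝ) (ξ : Sph d) :
    radon φ (t, ξ) = (dt^[m] G) (t, (ξ : Euc d)) := by
  have h1 : (fun x => ((φ x : ℝ) : ℂ)) = 𝓕⁻ (polarFt (dt^[m] G)) := by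
    ext x
    rw [hφ, backproj_radialFilter hd hm hG]
    exact Complex.ext (by simp) (by simp [im_fourierInv_polarFt hm hG hg])
  have h2 : 𝓕 (fun x => ((φ x : ℝ) : ℂ)) = polarFt (dt^[m] G) := by
    rw [h1]
    refine (continuous_polarFt G hm).fourier_fourierInv_eq (integrable_polarFt G hm) ?_
    have h3 : Integrable fun x => 𝓕⁻ (polarFt (dt^[m] G)) (-x) := by
      rw [← h1]
      have h4 : Integrable fun x => ((φ x : ℝ) : ℂ) := φ.integrable.ofReal
      exact h4.comp_neg
    simpa only [Real.fourierInv_eq_fourier_neg, neg_neg] using h3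
  have h3 : 𝓕 (fun t : ℝ => ((radon φ (t, ξ) : ℝ) : ℂ)) =
      𝓕 (fun t : ℝ => (((dt^[m] G) (t, (ξ : Euc d)) : ℝ) : ℂ)) := by
    ext w
    rw [fourier_radon φ.integrable, h2]
    change _ = ft (dt^[m] G) w ξ
    rcases lt_trichotomy w 0 with hw | rfl | hw
    · have h4 := polarFt_smul (dt^[m] G) (neg_pos.2 hw) (-ξ)
      rw [show ((-ξ : Sph d) : Euc d) = -(ξ : Euc d) from rfl, smul_neg, neg_smul, neg_neg] at h4
      rw [h4, ft_neg_neg (dt_iterate_neg hG hg · ξ)]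
    · rw [zero_smul, polarFt_dt_iterate, ft_dt_iterate]
      simp [hm]
    · exact polarFt_smul _ hw ξ
  have hF : Integrable (𝓕 (fun t : ℝ => (((dt^[m] G) (t, (ξ : Euc d)) : ℝ) : ℂ))) := by
    obtain ⟨C, -, hC⟩ := exists_ft_bound (dt^[m] G)
    obtain ⟨C₂, -, hC₂⟩ := exists_pow_mul_ft_bound (dt^[m] G)
      (0 + (volume : Measure ℝ).integrablePower)
    have hcont : Continuous fun w : ℝ => ft (dt^[m] G) w ξ := by
      have := continuous_ft (dt^[m] G)
      exact this.comp (by fun_prop : Continuous fun w : ℝ => (w, (ξ : Euc d)))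
    have h := integrable_of_le_of_pow_mul_le (μ := volume) (k := 0) (fun w => hC w ξ)
      (fun w => hC₂ w ξ) hcont.aestronglyMeasurable
    simp only [pow_zero, one_mul] at h
    exact (integrable_norm_iff hcont.aestronglyMeasurable).1 h
  have hr := (Complex.continuous_ofReal.comp (continuous_radon φ ξ)).fourierInv_fourier_eq
    (integrable_radon ξ φ.integrable).ofReal (by
      change Integrable (𝓕 (fun t : ℝ => ((radon φ (t, ξ) : ℝ) : ℂ)))
      rw [h3]; exact hF)
  have hl := (Complex.continuous_ofReal.comp (continuous_slice (dt^[m] G) ξ)).fourierInv_fourier_eq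
    (integrable_slice (dt^[m] G) ξ).ofReal hF
  have h5 := congrFun (hr.symm.trans ((congrArg 𝓕⁻ h3).trans hl)) t
  exact Complex.ofReal_injective h5

lemma tInt_dt {d : ℕ} (K : 𝓢(ℝ × Euc d, ℝ)) (c : ℝ) :
    tInt (fun z : Dom d => c * (dt K) (z.1, (z.2 : Euc d))) =
      fun z => -c * K (z.1, (z.2 : Euc d)) := by
  ext z
  rw [tInt, integral_const_mul]
  have hlim : Tendsto (fun s : ℝ => K (s, (z.2 : Euc d))) atTop (𝓝 0) := by
    obtain ⟨C, -, hC⟩ := exists_slice_bound K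
    refine squeeze_zero_norm (fun s => hC s z.2) ?_
    have : Tendsto (fun s : ℝ => 1 + s ^ 2) atTop atTop :=
      tendsto_atTop_add_const_left _ _ (tendsto_pow_atTop two_ne_zero)
    simpa using this.inv_tendsto_atTop.const_mul C
  rw [integral_Ioi_of_hasDerivAt_of_tendsto' (fun s _ => hasDerivAt_slice K z.2 s)
    (integrable_slice (dt K) z.2).integrableOn hlim]
  ring

lemma tInt_iterate_dt {d : ℕ} (m : ℕ) (K : 𝓢(ℝ × Euc d, ℝ)) (c : ℝ) :
    tInt^[m] (fun z : Dom d => c * (dt^[m] K) (z.1, (z.2 : Euc d))) =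
      fun z => (-1) ^ m * c * K (z.1, (z.2 : Euc d)) := by
  induction m generalizing c with
  | zero => simp
  | succ m ih =>
    rw [Function.iterate_succ_apply, Function.iterate_succ_apply', tInt_dt, ih]
    ext z
    ring

/-- A Lizorkin function of the form `φ = R^* K_rad ∂_t^m g` satisfies
`∂_t^{-m} R φ = (-1)^m g`. -/
lemma intRadon_of_backproj {d m : ℕ} (hd : 1 ≤ d) (hm : m ≠ 0) {g : Dom d → ℝ}
    (hg : IsRadonLizorkin m g) {φ : lizorkin d}
    (hφ : ∀ x, (φ : 𝓢(Euc d, ℝ)) x = backproj (radialFilter (tDeriv m g)) x) (z : Dom d) :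
    intRadon m φ z = (-1) ^ m * g z := by
  obtain ⟨G, hG⟩ := hg.schwartz
  have h1 : radon (fun x => (φ : 𝓢(Euc d, ℝ)) x) =
      fun z => 1 * (dt^[m] G) (z.1, (z.2 : Euc d)) := by
    ext z
    rw [one_mul]
    exact radon_of_backproj hd hm hG hg.parity hφ z.1 z.2
  rw [intRadon, h1, tInt_iterate_dt, hG, mul_one]

/-! ### Band-limited test functions -/

lemma norm_iteratedFDeriv_comp_le {V W : Type*} [NormedAddCommGroup V] [NormedSpace ℝ V]
    [NormedAddCommGroup W] [NormedSpace ℝ W] (f : 𝓢(W, ℝ)) (L : V →L[ℝ] W) (hL : ‖L‖ ≤ 1)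
    (n : ℕ) (x : V) :
    ‖iteratedFDeriv ℝ n (fun x => f (L x)) x‖ ≤ ‖iteratedFDeriv ℝ n f (L x)‖ := by
  have h := L.iteratedFDeriv_comp_right (f := f) (f.smooth ⊤) x
    (i := n) (by exact_mod_cast le_top)
  rw [show (fun x => f (L x)) = f ∘ L from rfl, h]
  refine (ContinuousMultilinearMap.norm_compContinuousLinearMap_le _ _).trans ?_
  refine mul_le_of_le_one_right (norm_nonneg _) ?_
  exact Finset.prod_le_one (fun _ _ => norm_nonneg _) fun _ _ => hL

/-- The tensor product `(s, y) ↦ α(s) P(y)` of two Schwartz functions. -/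
def tensor {d : ℕ} (α : 𝓢(ℝ, ℝ)) (P : 𝓢(Euc d, ℝ)) : 𝓢(ℝ × Euc d, ℝ) where
  toFun p := α p.1 * P p.2
  smooth' := ((α.smooth ⊤).comp contDiff_fst).mul ((P.smooth ⊤).comp contDiff_snd)
  decay' k n := by
    refine ⟨∑ i ∈ Finset.range (n + 1), (n.choose i : ℝ) *
      (SchwartzMap.seminorm ℝ k i α * SchwartzMap.seminorm ℝ 0 (n - i) P +
        SchwartzMap.seminorm ℝ 0 i α * SchwartzMap.seminorm ℝ k (n - i) P), fun p => ?_⟩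
    have h1 := norm_iteratedFDeriv_mul_le (𝕜 := ℝ) (N := ((⊤ : ℕ∞) : WithTop ℕ∞))
      ((α.smooth ⊤).comp (contDiff_fst (E := ℝ) (F := Euc d)))
      ((P.smooth ⊤).comp (contDiff_snd (E := ℝ) (F := Euc d))) p (n := n)
      (by exact_mod_cast le_top)
    have hp : ‖p‖ ^ k ≤ ‖p.1‖ ^ k + ‖p.2‖ ^ k := by
      rcases max_choice ‖p.1‖ ‖p.2‖ with h | h
      · rw [Prod.norm_def, h]; exact le_add_of_nonneg_right (by positivity)
      · rw [Prod.norm_def, h]; exact le_add_of_nonneg_left (by positivity)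
    refine (mul_le_mul_of_nonneg_left h1 (by positivity)).trans ?_
    rw [Finset.mul_sum]
    refine Finset.sum_le_sum fun i _ => ?_
    have hα : ‖iteratedFDeriv ℝ i (fun p : ℝ × Euc d => α p.1) p‖ ≤ ‖iteratedFDeriv ℝ i α p.1‖ :=
      norm_iteratedFDeriv_comp_le α (ContinuousLinearMap.fst ℝ ℝ (Euc d))
        (ContinuousLinearMap.norm_fst_le ℝ ℝ (Euc d)) i p
    have hP : ‖iteratedFDeriv ℝ (n - i) (fun p : ℝ × Euc d => P p.2) p‖ ≤
        ‖iteratedFDeriv ℝ (n - i) P p.2‖ :=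
      norm_iteratedFDeriv_comp_le P (ContinuousLinearMap.snd ℝ ℝ (Euc d))
        (ContinuousLinearMap.norm_snd_le ℝ ℝ (Euc d)) (n - i) p
    have ha := α.le_seminorm ℝ k i p.1
    have ha0 := α.norm_iteratedFDeriv_le_seminorm ℝ i p.1
    have hb := P.le_seminorm ℝ k (n - i) p.2
    have hb0 := P.norm_iteratedFDeriv_le_seminorm ℝ (n - i) p.2
    calc ‖p‖ ^ k * ((n.choose i : ℝ) * ‖iteratedFDeriv ℝ i (fun p : ℝ × Euc d => α p.1) p‖ *
          ‖iteratedFDeriv ℝ (n - i) (fun p : ℝ × Euc d => P p.2) p‖)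
        ≤ (‖p.1‖ ^ k + ‖p.2‖ ^ k) * ((n.choose i : ℝ) * ‖iteratedFDeriv ℝ i α p.1‖ *
          ‖iteratedFDeriv ℝ (n - i) P p.2‖) := by gcongr
      _ = (n.choose i : ℝ) * ((‖p.1‖ ^ k * ‖iteratedFDeriv ℝ i α p.1‖) *
          ‖iteratedFDeriv ℝ (n - i) P p.2‖ + ‖iteratedFDeriv ℝ i α p.1‖ *
          (‖p.2‖ ^ k * ‖iteratedFDeriv ℝ (n - i) P p.2‖)) := by ring
      _ ≤ _ := by gcongr

lemma tensor_apply {d : ℕ} (α : 𝓢(ℝ, ℝ)) (P : 𝓢(Euc d, ℝ)) (p : ℝ × Euc d) :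
    tensor α P p = α p.1 * P p.2 := rfl

lemma ft_tensor {d : ℕ} (α : 𝓢(ℝ, ℝ)) (P : 𝓢(Euc d, ℝ)) (w : ℝ) (y : Euc d) :
    ft (tensor α P) w y = 𝓕 (fun s : ℝ => ((α s : ℝ) : ℂ)) w * (P y : ℂ) := by
  rw [ft_eq, Real.fourier_real_eq_integral_exp_smul, ← integral_mul_const]
  congr 1 with s
  rw [tensor_apply]
  push_cast
  rw [smul_eq_mul]
  ring

/-- Schwartz functions on `ℝ × ℝ^d` whose Fourier transform in `t` is smooth and lives on
frequencies `δ ≤ |w| ≤ R` with `δ > 0`. -/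
structure IsBandLimited {d : ℕ} (K : 𝓢(ℝ × Euc d, ℝ)) : Prop where
  contDiff : ContDiff ℝ ((⊤ : ℕ∞) : WithTop ℕ∞) fun p : ℝ × Euc d => ft K p.1 p.2
  eq_zero : ∃ δ > 0, ∃ R, ∀ w y, (|w| < δ ∨ R < |w|) → ft K w y = 0

lemma fourier_slice {d : ℕ} (K : 𝓢(ℝ × Euc d, ℝ)) (w : ℝ) (y : Euc d) :
    𝓕 (fun s : ℝ => ((K (s, y) : ℝ) : ℂ)) w = ft K w y := rfl

-- Otherwise unification of compositions with `ft` unfolds the Fourier integral.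
attribute [local irreducible] ft

lemma integrable_exp_mul_slice {d : ℕ} (K : 𝓢(ℝ × Euc d, ℝ)) (w : ℝ) (y : Euc d) :
    Integrable fun s : ℝ =>
      Complex.exp (↑(-2 * Real.pi * s * w) * Complex.I) * ((K (s, y) : ℝ) : ℂ) := by
  refine (integrable_slice K y).ofReal.bdd_mul (c := 1) ?_ (Eventually.of_forall fun s => ?_)
  · exact Continuous.aestronglyMeasurable (by fun_prop)
  · rw [Complex.norm_exp_ofReal_mul_I]

lemma IsBandLimited.add {d : ℕ} {K L : 𝓢(ℝ × Euc d, ℝ)} (hK : IsBandLimited K)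
    (hL : IsBandLimited L) : IsBandLimited (K + L) := by
  have h : ∀ w y, ft (K + L) w y = ft K w y + ft L w y := fun w y => by
    rw [ft_eq, ft_eq, ft_eq, ← integral_add (integrable_exp_mul_slice K w y)
      (integrable_exp_mul_slice L w y)]
    congr 1 with s
    rw [add_apply]
    push_cast
    ring
  refine ⟨by simpa only [h] using hK.contDiff.add hL.contDiff, ?_⟩
  obtain ⟨δ, hδ, R, h1⟩ := hK.eq_zero
  obtain ⟨δ', hδ', R', h2⟩ := hL.eq_zero
  refine ⟨min δ δ', lt_min hδ hδ', max R R', fun w y hw => ?_⟩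
  rw [h, h1 w y (hw.imp (fun h => h.trans_le (min_le_left _ _)) ((le_max_left _ _).trans_lt)),
    h2 w y (hw.imp (fun h => h.trans_le (min_le_right _ _)) ((le_max_right _ _).trans_lt)),
    add_zero]

lemma IsBandLimited.smul {d : ℕ} {K : 𝓢(ℝ × Euc d, ℝ)} (hK : IsBandLimited K) (c : ℝ) :
    IsBandLimited (c • K) := by
  have h : ∀ w y, ft (c • K) w y = c * ft K w y := fun w y => by
    rw [ft_eq, ft_eq, ← integral_const_mul]
    congr 1 with s
    simp only [smul_apply, smul_eq_mul]
    push_cast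
    ring
  refine ⟨by simpa only [h] using contDiff_const.mul hK.contDiff, ?_⟩
  obtain ⟨δ, hδ, R, h1⟩ := hK.eq_zero
  exact ⟨δ, hδ, R, fun w y hw => by rw [h, h1 w y hw, mul_zero]⟩

/-- The reflection `p ↦ K(-p)`. -/
def reflect {d : ℕ} (K : 𝓢(ℝ × Euc d, ℝ)) : 𝓢(ℝ × Euc d, ℝ) :=
  SchwartzMap.compCLMOfContinuousLinearEquiv ℝ (ContinuousLinearEquiv.neg ℝ) K

lemma reflect_apply {d : ℕ} (K : 𝓢(ℝ × Euc d, ℝ)) (p : ℝ × Euc d) : reflect K p = K (-p) := rfl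

lemma isBandLimited_reflect {d : ℕ} {K : 𝓢(ℝ × Euc d, ℝ)} (hK : IsBandLimited K) :
    IsBandLimited (reflect K) := by
  have h : ∀ w y, ft (reflect K) w y = ft K (-w) (-y) := fun w y => by
    rw [ft_eq, ft_eq, ← integral_neg_eq_self]
    congr 1 with s
    rw [reflect_apply, Prod.neg_mk, neg_neg]
    congr 3
    push_cast
    ring
  refine ⟨?_, ?_⟩
  · simp only [h]
    obtain ⟨Q, hQ⟩ : ∃ Q : ℝ × Euc d → ℂ, ∀ p, ft K p.1 p.2 = Q p := ⟨_, fun p => rfl⟩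
    have h1 : ContDiff ℝ ((⊤ : ℕ∞) : WithTop ℕ∞) Q := by simpa only [hQ] using hK.contDiff
    have h2 : (fun p : ℝ × Euc d => ft K (-p.1) (-p.2)) = Q ∘ Neg.neg :=
      funext fun p => hQ (-p)
    rw [h2]
    exact h1.comp contDiff_neg
  · obtain ⟨δ, hδ, R, h1⟩ := hK.eq_zero
    exact ⟨δ, hδ, R, fun w y hw => by rw [h, h1 _ _ (by rwa [abs_neg])]⟩

lemma integrable_pow_mul_slice {d : ℕ} (K : 𝓢(ℝ × Euc d, ℝ)) (k : ℕ) (y : Euc d) :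
    Integrable fun s : ℝ => s ^ k * K (s, y) := by
  have h : ∀ j, ∀ s : ℝ, ‖s‖ ^ j * ‖K (s, y)‖ ≤ SchwartzMap.seminorm ℝ j 0 K := fun j s =>
    (mul_le_mul_of_nonneg_right (pow_le_pow_left₀ (norm_nonneg _)
      (norm_fst_le ((s, y) : ℝ × Euc d)) j) (norm_nonneg _)).trans
      (K.norm_pow_mul_le_seminorm ℝ j (s, y))
  have h1 := integrable_of_le_of_pow_mul_le (μ := volume) (f := fun s : ℝ => K (s, y)) (k := k)
    (fun s => by simpa using h 0 s) (fun s => h _ s) (continuous_slice K y).aestronglyMeasurable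
  refine h1.mono' ((by fun_prop : Continuous fun s : ℝ => s ^ k).mul
    (continuous_slice K y)).aestronglyMeasurable (Eventually.of_forall fun s => ?_)
  rw [norm_mul, norm_pow]

/-- The moments in `t` of a band-limited function are derivatives of its Fourier transform at the
frequency zero, and vanish. -/
lemma IsBandLimited.moments {d : ℕ} {K : 𝓢(ℝ × Euc d, ℝ)} (hK : IsBandLimited K) (y : Euc d)
    (k : ℕ) : ∫ s : ℝ, s ^ k * K (s, y) = 0 := by
  have hint : ∀ n : ℕ, Integrable fun s : ℝ => s ^ n • ((K (s, y) : ℝ) : ℂ) := fun n => by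
    have h := (integrable_pow_mul_slice K n y).ofReal (𝕜 := ℂ)
    refine h.congr (Eventually.of_forall fun s => ?_)
    simp
  have h := congrFun (Real.iteratedDeriv_fourier (N := ⊤) (n := k) (fun n _ => hint n) le_top) 0
  obtain ⟨δ, hδ, R, h1⟩ := hK.eq_zero
  have hz : 𝓕 (fun s : ℝ => ((K (s, y) : ℝ) : ℂ)) =ᶠ[𝓝 0] fun _ => 0 := by
    filter_upwards [Metric.ball_mem_nhds (0 : ℝ) hδ] with w hw
    exact (fourier_slice K w y).trans (h1 w y (Or.inl (by simpa using hw)))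
  rw [hz.iteratedDeriv_eq, Real.fourier_real_eq_integral_exp_smul] at h
  have h2 : ∫ s : ℝ, ((s ^ k * K (s, y) : ℝ) : ℂ) = 0 := by
    have h3 : (-2 * Real.pi * Complex.I) ^ k * ∫ s : ℝ, ((s ^ k * K (s, y) : ℝ) : ℂ) = 0 := by
      rw [← integral_const_mul]
      have h4 : iteratedDeriv k (fun _ : ℝ => (0 : ℂ)) 0 = 0 := by simp
      rw [h4] at h
      rw [h]
      congr 1 with s
      simp only [mul_zero, Complex.ofReal_zero, zero_mul, Complex.exp_zero, smul_eq_mul,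
        mul_pow]
      push_cast
      ring
    refine (mul_eq_zero.1 h3).resolve_left (pow_ne_zero _ ?_)
    simp [Real.pi_ne_zero]
  rw [integral_complex_ofReal] at h2
  exact_mod_cast h2

/-- A Schwartz function on `ℝ^d` whose Fourier transform vanishes near the frequency zero has
vanishing moments. -/
lemma integral_monomial_eq_zero {d : ℕ} (f : 𝓢(Euc d, ℂ)) (hf : 𝓕 (f : Euc d → ℂ) =ᶠ[𝓝 0] 0)
    (k : Fin d → ℕ) : ∫ x : Euc d, ((∏ i, x i ^ k i : ℝ) : ℂ) * f x = 0 := by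
  set n := Fintype.card (Σ i, Fin (k i)) with hn
  have e : (Σ i, Fin (k i)) ≃ Fin n := Fintype.equivFin _
  set v : Fin n → Euc d := fun j => EuclideanSpace.single (e.symm j).1 (1 : ℝ) with hv
  have hprod : ∀ x : Euc d, ∏ j, ⟪x, v j⟫ = ∏ i, x i ^ k i := fun x => by
    rw [← e.prod_comp]
    simp only [hv, Equiv.symm_apply_apply]
    rw [Fintype.prod_sigma]
    simp [EuclideanSpace.inner_single_right]
  have hint : ∀ m : ℕ, Integrable fun x : Euc d => ‖x‖ ^ m * ‖f x‖ := fun m =>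
    f.integrable_pow_mul volume m
  have h := Real.iteratedFDeriv_fourier (N := ⊤) (f := (f : Euc d → ℂ)) (n := n)
    (fun m _ => hint m) f.continuous.aestronglyMeasurable le_top
  have h0 : iteratedFDeriv ℝ n (𝓕 (f : Euc d → ℂ)) 0 = 0 := by
    rw [(hf.iteratedFDeriv ℝ n).eq_of_nhds]
    simp
  have h1 := congrArg (fun T => T v) (congrFun h 0)
  simp only [h0] at h1
  rw [Real.fourier_continuousMultilinearMap_apply
    (VectorFourier.integrable_fourierPowSMulRight _ (hint n) f.continuous.aestronglyMeasurable),
    Real.fourier_eq'] at h1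
  have h2 : (-(2 * Real.pi * Complex.I)) ^ n *
      ∫ x : Euc d, ((∏ i, x i ^ k i : ℝ) : ℂ) * f x = 0 := by
    rw [← integral_const_mul, ← show (0 : ContinuousMultilinearMap ℝ (fun _ : Fin n => Euc d) ℂ) v
      = 0 from rfl, h1]
    congr 1 with x
    simp only [inner_zero_right, mul_zero, Complex.ofReal_zero, zero_mul, Complex.exp_zero,
      VectorFourier.fourierPowSMulRight_apply, smul_eq_mul, Complex.real_smul]
    rw [one_mul, ← hprod]
    rfl
  refine (mul_eq_zero.1 h2).resolve_left (pow_ne_zero _ ?_)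
  simp [Real.pi_ne_zero]

/-- For a band-limited function `G`, the filtered backprojection of `∂_t^m G` is a Lizorkin
function: its Fourier transform is smooth and compactly supported away from the origin. -/
lemma IsBandLimited.exists_lizorkin {d m : ℕ} (hd : 1 ≤ d) (hm : m ≠ 0) {g : Dom d → ℝ}
    {G : 𝓢(ℝ × Euc d, ℝ)} (hG : ∀ z : Dom d, g z = G (z.1, (z.2 : Euc d)))
    (hB : IsBandLimited G) :
    ∃ φ : lizorkin d, ∀ x, (φ : 𝓢(Euc d, ℝ)) x = backproj (radialFilter (tDeriv m g)) x := by
  obtain ⟨δ, hδ, R, h1⟩ := hB.eq_zero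
  have hzero : ∀ x : Euc d, (‖x‖ < δ ∨ R < ‖x‖) → polarFt (dt^[m] G) x = 0 := fun x hx => by
    rw [polarFt_dt_iterate, polarFt, h1 _ _ (by rwa [abs_norm]), mul_zero]
  have hnhds : polarFt (dt^[m] G) =ᶠ[𝓝 0] 0 := by
    filter_upwards [Metric.ball_mem_nhds (0 : Euc d) hδ] with x hx
    exact hzero x (Or.inl (by simpa using hx))
  have hsupp : HasCompactSupport (polarFt (dt^[m] G)) := by
    refine HasCompactSupport.intro (isCompact_closedBall (0 : Euc d) R) fun x hx => ?_
    exact hzero x (Or.inr (by simpa using hx))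
  have hsmooth : ContDiff ℝ ((⊤ : ℕ∞) : WithTop ℕ∞) (polarFt (dt^[m] G)) := by
    rw [contDiff_iff_contDiffAt]
    intro x
    rcases eq_or_ne x 0 with rfl | hx
    · exact (contDiffAt_const (c := (0 : ℂ))).congr_of_eventuallyEq hnhds
    · have hn : ContDiffAt ℝ ((⊤ : ℕ∞) : WithTop ℕ∞) (fun x : Euc d => ‖x‖) x :=
        contDiffAt_norm ℝ hx
      have hp : ContDiffAt ℝ ((⊤ : ℕ∞) : WithTop ℕ∞)
          (fun x : Euc d => ((‖x‖, ‖x‖⁻¹ • x) : ℝ × Euc d)) x :=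
        hn.prodMk ((hn.inv (norm_ne_zero_iff.2 hx)).smul contDiffAt_id)
      have h2 : ContDiffAt ℝ ((⊤ : ℕ∞) : WithTop ℕ∞) (polarFt G) x := by
        obtain ⟨Q, hQ⟩ : ∃ Q : ℝ × Euc d → ℂ, ∀ p, ft G p.1 p.2 = Q p := ⟨_, fun p => rfl⟩
        have h1 : ContDiff ℝ ((⊤ : ℕ∞) : WithTop ℕ∞) Q := by simpa only [hQ] using hB.contDiff
        have h3 : polarFt G = Q ∘ fun x : Euc d => ((‖x‖, ‖x‖⁻¹ • x) : ℝ × Euc d) :=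
          funext fun x => hQ (‖x‖, ‖x‖⁻¹ • x)
        rw [h3]
        exact h1.contDiffAt.comp x hp
      have h3 : polarFt (dt^[m] G) = fun x =>
          (2 * Real.pi * Complex.I * ‖x‖) ^ m * polarFt G x := funext (polarFt_dt_iterate G m)
      rw [h3]
      have h4 : ContDiffAt ℝ ((⊤ : ℕ∞) : WithTop ℕ∞) (fun x : Euc d => ((‖x‖ : ℝ) : ℂ)) x :=
        Complex.ofRealCLM.contDiff.contDiffAt.comp x hn
      exact ((contDiffAt_const.mul h4).pow m).mul h2
  set F : 𝓢(Euc d, ℂ) := hsupp.toSchwartzMap hsmooth with hF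
  have hFcoe : (F : Euc d → ℂ) = polarFt (dt^[m] G) := rfl
  set Φ : 𝓢(Euc d, ℂ) := 𝓕⁻ F with hΦ
  have hΦcoe : (Φ : Euc d → ℂ) = 𝓕⁻ (polarFt (dt^[m] G)) := by
    rw [hΦ, SchwartzMap.fourierInv_coe, hFcoe]
  have hFΦ : 𝓕 (Φ : Euc d → ℂ) = polarFt (dt^[m] G) := by
    rw [← SchwartzMap.fourier_coe, hΦ, FourierTransform.fourier_fourierInv_eq, hFcoe]
  refine ⟨⟨Φ.postcompCLM Complex.reCLM, fun k => ?_⟩, fun x => ?_⟩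
  · have h := integral_monomial_eq_zero Φ (by rw [hFΦ]; exact hnhds) k
    have hint : Integrable fun x : Euc d => ((∏ i, x i ^ k i : ℝ) : ℂ) * Φ x := by
      refine (Φ.integrable_pow_mul volume (∑ i, k i)).mono' ?_ (Eventually.of_forall fun x => ?_)
      · have := Φ.continuous
        have h5 : Continuous fun x : Euc d => ((∏ i, x i ^ k i : ℝ) : ℂ) :=
          Complex.continuous_ofReal.comp (by fun_prop)
        exact (h5.mul this).aestronglyMeasurable
      · rw [norm_mul, Complex.norm_real, norm_prod, ← Finset.prod_pow_eq_pow_sum]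
        refine mul_le_mul_of_nonneg_right ?_ (norm_nonneg _)
        refine Finset.prod_le_prod (fun i _ => norm_nonneg _) fun i _ => ?_
        rw [norm_pow]
        exact pow_le_pow_left₀ (norm_nonneg _) (PiLp.norm_apply_le x i) _
    have h6 := congrArg Complex.re h
    rw [← RCLike.re_eq_complex_re, ← integral_re hint, RCLike.re_eq_complex_re,
      Complex.zero_re] at h6
    rw [← h6]
    congr 1 with x
    simp only [SchwartzMap.postcompCLM_apply, Complex.reCLM_apply]
    exact (Complex.re_ofReal_mul _ _).symm
  · rw [backproj_radialFilter hd hm hG, ← hΦcoe]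
    rfl

/-- The part of the parity `(-1)^m` of a band-limited function is an admissible test function. -/
lemma IsBandLimited.isRadonLizorkin {d m : ℕ} {K : 𝓢(ℝ × Euc d, ℝ)} (hK : IsBandLimited K) :
    ∃ G : 𝓢(ℝ × Euc d, ℝ), IsBandLimited G ∧
      (∀ p, G p = 2⁻¹ * (K p + (-1) ^ m * K (-p))) ∧
      IsRadonLizorkin m fun z : Dom d => G (z.1, (z.2 : Euc d)) := by
  set G := (2⁻¹ : ℝ) • (K + ((-1 : ℝ) ^ m) • reflect K) with hG
  have hB : IsBandLimited G := (hK.add ((isBandLimited_reflect hK).smul _)).smul _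
  have hGp : ∀ p, G p = 2⁻¹ * (K p + (-1) ^ m * K (-p)) := fun p => by
    simp [hG, reflect_apply, mul_add]
  refine ⟨G, hB, hGp, ⟨G, fun z => rfl⟩, fun z => ?_, fun ξ k => hB.moments ξ k⟩
  have h1 : (((-z).1, (((-z).2 : Sph d) : Euc d)) : ℝ × Euc d) = -(z.1, (z.2 : Euc d)) := rfl
  have h2 : ((-1 : ℝ) ^ m) * (-1) ^ m = 1 := by rw [← mul_pow]; simp
  rw [h1, hGp, hGp, neg_neg]
  linear_combination (2⁻¹ * K (-(z.1, (z.2 : Euc d)))) * (-h2)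

/-! ### Density of the band-limited functions -/

lemma fourier_re {f : ℝ → ℂ} (hf : Integrable f) (w : ℝ) :
    𝓕 (fun s : ℝ => (((f s).re : ℝ) : ℂ)) w =
      2⁻¹ * (𝓕 f w + starRingEnd ℂ (𝓕 f (-w))) := by
  have hint : ∀ g : ℝ → ℂ, Integrable g → Integrable fun s : ℝ =>
      Complex.exp (↑(-2 * Real.pi * s * w) * Complex.I) * g s := fun g hg => by
    refine hg.bdd_mul (c := 1) ?_ (Eventually.of_forall fun s => ?_)
    · exact Continuous.aestronglyMeasurable (by fun_prop)
    · rw [Complex.norm_exp_ofReal_mul_I]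
  have hconj : Integrable fun s => starRingEnd ℂ (f s) :=
    (LinearIsometryEquiv.integrable_comp_iff Complex.conjLIE).2 hf
  simp only [Real.fourier_real_eq_integral_exp_smul, smul_eq_mul]
  rw [← integral_conj]
  have h1 : ∀ s : ℝ, starRingEnd ℂ (Complex.exp (↑(-2 * Real.pi * s * -w) * Complex.I) * f s) =
      Complex.exp (↑(-2 * Real.pi * s * w) * Complex.I) * starRingEnd ℂ (f s) := fun s => by
    rw [map_mul, ← Complex.exp_conj, map_mul, Complex.conj_ofReal, Complex.conj_I]
    congr 2
    push_cast
    ring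
  simp only [h1]
  rw [← integral_add (hint f hf) (hint _ hconj), ← integral_const_mul]
  congr 1 with s
  rw [Complex.re_eq_add_conj]
  ring

/-- Schwartz functions on the line can be approximated uniformly by functions with frequencies in
an annulus: cutting their Fourier transform off near zero and infinity changes its `L¹` norm
little. -/
lemma exists_bandLimited_near (β : 𝓢(ℝ, ℝ)) {ε : ℝ} (hε : 0 < ε) :
    ∃ α : 𝓢(ℝ, ℝ), (∀ s, |α s - β s| ≤ ε) ∧ ∃ δ > 0, ∃ R, ∀ w : ℝ, (|w| < δ ∨ R < |w|) →
      𝓕 (fun s : ℝ => ((α s : ℝ) : ℂ)) w = 0 := by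
  set b : 𝓢(ℝ, ℂ) := β.postcompCLM Complex.ofRealCLM with hb
  have hbβ : ∀ s, b s = ((β s : ℝ) : ℂ) := fun s => rfl
  set B : 𝓢(ℝ, ℂ) := 𝓕 b with hB
  set χ : ContDiffBump (0 : ℝ) := ⟨1, 2, one_pos, one_lt_two⟩ with hχ
  have hχ0 : ∀ w, 0 ≤ χ w := fun w => χ.nonneg
  have hχ1 : ∀ w, χ w ≤ 1 := fun w => χ.le_one
  have hχin : ∀ w : ℝ, |w| ≤ 1 → χ w = 1 := fun w hw =>
    χ.one_of_mem_closedBall (by simpa [hχ] using hw)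
  have hχout : ∀ w : ℝ, 2 ≤ |w| → χ w = 0 := fun w hw => χ.zero_of_le_dist (by simpa [hχ] using hw)
  set θ : ℕ → ℝ → ℝ := fun n w => χ (w / (n + 1)) - χ ((n + 1) * w) with hθ
  have hθ1 : ∀ n w, |1 - θ n w| ≤ 2 := fun n w => by
    rw [abs_le]
    constructor <;> simp only [hθ] <;>
      linarith [hχ0 (w / (n + 1)), hχ1 (w / (n + 1)), hχ0 ((n + 1) * w), hχ1 ((n + 1) * w)]
  have hθsmooth : ∀ n, ContDiff ℝ ((⊤ : ℕ∞) : WithTop ℕ∞) (θ n) := fun n =>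
    (χ.contDiff.comp (contDiff_id.div_const _)).sub (χ.contDiff.comp (contDiff_const.mul contDiff_id))
  have hn : ∀ n : ℕ, (0 : ℝ) < n + 1 := fun n => by positivity
  -- the cutoff vanishes for `|w| < 1 / (n + 1)` and for `|w| > 2 (n + 1)`
  have hθ0 : ∀ (n : ℕ) (w : ℝ), (|w| < 1 / ((n : ℝ) + 1) ∨ 2 * ((n : ℝ) + 1) < |w|) →
      θ n w = 0 := by
    intro n w hw
    have h1 : (1 : ℝ) ≤ n + 1 := by linarith [n.cast_nonneg (α := ℝ)]
    simp only [hθ]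
    rcases hw with hw | hw
    · rw [lt_div_iff₀ (hn n)] at hw
      rw [hχin, hχin, sub_self]
      · rw [abs_mul, abs_of_pos (hn n)]; linarith
      · rw [abs_div, abs_of_pos (hn n), div_le_one (hn n)]
        nlinarith [abs_nonneg w]
    · rw [hχout, hχout, sub_self]
      · rw [abs_mul, abs_of_pos (hn n)]; nlinarith
      · rw [abs_div, abs_of_pos (hn n), le_div_iff₀ (hn n)]; exact hw.le
  have hlim : Tendsto (fun n => ∫ w, ‖((1 - θ n w : ℝ) : ℂ) * B w‖) atTop (𝓝 0) := by
    rw [show (0 : ℝ) = ∫ _ : ℝ, (0 : ℝ) by simp]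
    refine tendsto_integral_of_dominated_convergence (fun w => 2 * ‖B w‖) (fun n => ?_)
      (B.integrable.norm.const_mul 2) (fun n => Eventually.of_forall fun w => ?_) ?_
    · have h1 := (hθsmooth n).continuous
      have h2 := B.continuous
      exact Continuous.aestronglyMeasurable (by fun_prop)
    · rw [norm_norm, norm_mul, Complex.norm_real]
      exact mul_le_mul_of_nonneg_right (hθ1 n w) (norm_nonneg _)
    · have hne : ∀ᵐ w : ℝ, w ≠ 0 := by simp [ae_iff]
      filter_upwards [hne] with w hw
      refine tendsto_const_nhds.congr' ?_
      have hw' : 0 < |w| := abs_pos.2 hw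
      filter_upwards [eventually_ge_atTop ⌈|w| + 2 / |w|⌉₊] with n hnw
      have h1 : |w| + 2 / |w| ≤ n := (Nat.le_ceil _).trans (by exact_mod_cast hnw)
      have h2 : 0 < 2 / |w| := by positivity
      have h3 : 2 / |w| * |w| = 2 := by field_simp
      have h4 : θ n w = 1 := by
        simp only [hθ]
        rw [hχin, hχout, sub_zero]
        · rw [abs_mul, abs_of_pos (hn n)]; nlinarith
        · rw [abs_div, abs_of_pos (hn n), div_le_one (hn n)]; linarith
      simp [h4]
  obtain ⟨n, hnε⟩ := ((tendsto_order.1 hlim).2 ε hε).exists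
  have hsupp : HasCompactSupport fun w => ((θ n w : ℝ) : ℂ) * B w := by
    refine HasCompactSupport.intro (isCompact_closedBall (0 : ℝ) (2 * ((n : ℝ) + 1))) fun w hw => ?_
    rw [hθ0 n w (Or.inr (by simpa using hw)), Complex.ofReal_zero, zero_mul]
  have hsmooth : ContDiff ℝ ((⊤ : ℕ∞) : WithTop ℕ∞) fun w => ((θ n w : ℝ) : ℂ) * B w :=
    (Complex.ofRealCLM.contDiff.comp (hθsmooth n)).mul (B.smooth ⊤)
  set A : 𝓢(ℝ, ℂ) := hsupp.toSchwartzMap hsmooth with hA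
  have hAw : ∀ w, A w = ((θ n w : ℝ) : ℂ) * B w := fun w => rfl
  set a : 𝓢(ℝ, ℂ) := 𝓕⁻ A with ha
  refine ⟨a.postcompCLM Complex.reCLM, fun s => ?_, 1 / ((n : ℝ) + 1), by positivity,
    2 * ((n : ℝ) + 1),
    fun w hw => ?_⟩
  · have h1 : (a.postcompCLM Complex.reCLM) s - β s = (a s - b s).re := by
      rw [hbβ, Complex.sub_re, Complex.ofReal_re]; rfl
    have h2 : b = 𝓕⁻ B := by rw [hB, FourierTransform.fourierInv_fourier_eq]
    have h3 : ∀ f : 𝓢(ℝ, ℂ), (𝓕⁻ f : 𝓢(ℝ, ℂ)) s = ∫ w, 𝐞 ⟪w, s⟫ • f w := fun f => by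
      rw [show (𝓕⁻ f : 𝓢(ℝ, ℂ)) s = 𝓕⁻ (f : ℝ → ℂ) s from congrFun (SchwartzMap.fourierInv_coe f) s,
        Real.fourierInv_eq]
    have h4 : ∀ f : 𝓢(ℝ, ℂ), Integrable fun w : ℝ => 𝐞 ⟪w, s⟫ • f w := fun f => by
      simp only [Circle.smul_def, smul_eq_mul]
      refine f.integrable.bdd_mul (c := 1) ?_ (Eventually.of_forall fun w => ?_)
      · exact Continuous.aestronglyMeasurable (by fun_prop)
      · exact (Circle.norm_coe _).le
    rw [h1, h2, ha, h3, h3, ← integral_sub (h4 A) (h4 B)]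
    refine (Complex.abs_re_le_norm _).trans ((norm_integral_le_integral_norm _).trans ?_)
    refine le_trans (le_of_eq ?_) hnε.le
    congr 1 with w
    rw [← smul_sub, Circle.norm_smul, hAw, ← norm_neg]
    congr 1
    push_cast
    ring
  · have h1 : 𝓕 (a : ℝ → ℂ) = A := by
      rw [← SchwartzMap.fourier_coe, ha, FourierTransform.fourier_fourierInv_eq]
    have h2 := fourier_re a.integrable w
    rw [h1, hAw, hAw, hθ0 n w hw, hθ0 n (-w) (by rwa [abs_neg])] at h2
    simp only [Complex.ofReal_zero, zero_mul, map_zero, add_zero, mul_zero] at h2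
    exact h2

lemma isBandLimited_tensor {d : ℕ} {α : 𝓢(ℝ, ℝ)} (P : 𝓢(Euc d, ℝ))
    (hα : ∃ δ > 0, ∃ R, ∀ w : ℝ, (|w| < δ ∨ R < |w|) →
      𝓕 (fun s : ℝ => ((α s : ℝ) : ℂ)) w = 0) : IsBandLimited (tensor α P) := by
  obtain ⟨δ, hδ, R, h⟩ := hα
  refine ⟨?_, δ, hδ, R, fun w y hw => by rw [ft_tensor, h w hw, zero_mul]⟩
  simp only [ft_tensor]
  have h1 : ContDiff ℝ ((⊤ : ℕ∞) : WithTop ℕ∞) (𝓕 (fun s : ℝ => ((α s : ℝ) : ℂ))) :=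
    (𝓕 (α.postcompCLM Complex.ofRealCLM) : 𝓢(ℝ, ℂ)).smooth ⊤
  exact (h1.comp contDiff_fst).mul
    (Complex.ofRealCLM.contDiff.comp ((P.smooth ⊤).comp contDiff_snd))

/-- Functions on the Radon domain that are uniform limits of band-limited functions. -/
def IsApprox {d : ℕ} (v : Dom d → ℝ) : Prop :=
  ∀ ε > 0, ∃ K : 𝓢(ℝ × Euc d, ℝ), IsBandLimited K ∧
    ∀ z : Dom d, |K (z.1, (z.2 : Euc d)) - v z| ≤ ε

lemma IsApprox.add {d : ℕ} {u v : Dom d → ℝ} (hu : IsApprox u) (hv : IsApprox v) :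
    IsApprox fun z => u z + v z := by
  intro ε hε
  obtain ⟨K, hK, h1⟩ := hu (ε / 2) (by positivity)
  obtain ⟨L, hL, h2⟩ := hv (ε / 2) (by positivity)
  refine ⟨K + L, hK.add hL, fun z => ?_⟩
  rw [add_apply, add_sub_add_comm]
  exact (abs_add_le _ _).trans (by linarith [h1 z, h2 z])

lemma IsApprox.of_near {d : ℕ} {v : Dom d → ℝ}
    (h : ∀ ε > 0, ∃ u : Dom d → ℝ, IsApprox u ∧ ∀ z, |u z - v z| ≤ ε) : IsApprox v := by
  intro ε hε
  obtain ⟨u, hu, h1⟩ := h (ε / 2) (by positivity)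
  obtain ⟨K, hK, h2⟩ := hu (ε / 2) (by positivity)
  refine ⟨K, hK, fun z => ?_⟩
  have h3 := abs_sub_le (K (z.1, (z.2 : Euc d))) (u z) (v z)
  linarith [h1 z, h2 z]

lemma isApprox_mul {d : ℕ} {β : ℝ → ℝ} (hβ : HasCompactSupport β)
    (hβ' : ContDiff ℝ ((⊤ : ℕ∞) : WithTop ℕ∞) β) {P : Euc d → ℝ}
    (hP : ContDiff ℝ ((⊤ : ℕ∞) : WithTop ℕ∞) P) :
    IsApprox fun z : Dom d => β z.1 * P z.2 := by
  intro ε hε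
  obtain ⟨C, hC⟩ := (isCompact_sphere (0 : Euc d) 1).exists_bound_of_continuousOn
    hP.continuous.continuousOn
  set C' := max C 1 with hC'
  have hC'0 : 0 < C' := lt_max_of_lt_right one_pos
  obtain ⟨α, hα, hα'⟩ := exists_bandLimited_near (hβ.toSchwartzMap hβ') (div_pos hε hC'0)
  -- a cutoff that is one on the unit sphere turns `P` into a Schwartz function
  set χ : ContDiffBump (0 : Euc d) := ⟨1, 2, one_pos, one_lt_two⟩ with hχ
  have hsupp : HasCompactSupport fun y => χ y * P y := χ.hasCompactSupport.mul_right
  set Q : 𝓢(Euc d, ℝ) := hsupp.toSchwartzMap (χ.contDiff.mul hP)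
  refine ⟨tensor α Q, isBandLimited_tensor Q hα', fun z => ?_⟩
  have hQ : Q (z.2 : Euc d) = P z.2 := by
    change χ (z.2 : Euc d) * P z.2 = P z.2
    rw [χ.one_of_mem_closedBall (by simp [hχ]), one_mul]
  rw [tensor_apply, hQ, ← sub_mul, abs_mul]
  calc |α z.1 - β z.1| * |P z.2| ≤ ε / C' * C' :=
        mul_le_mul (hα z.1) ((hC _ z.2.2).trans (le_max_left _ _)) (abs_nonneg _) (by positivity)
    _ = ε := div_mul_cancel₀ _ hC'0.ne'

/-- The coordinates of the Radon domain: `t` and the components of `ξ`. -/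
def coord {d : ℕ} (o : Option (Fin d)) (p : ℝ × Euc d) : ℝ := o.elim p.1 fun i => p.2 i

lemma isApprox_mul_polynomial {d : ℕ} (Q : MvPolynomial (Option (Fin d)) ℝ) {β : ℝ → ℝ}
    (hβ : HasCompactSupport β) (hβ' : ContDiff ℝ ((⊤ : ℕ∞) : WithTop ℕ∞) β) {P : Euc d → ℝ}
    (hP : ContDiff ℝ ((⊤ : ℕ∞) : WithTop ℕ∞) P) :
    IsApprox fun z : Dom d => β z.1 * P z.2 *
      MvPolynomial.eval (fun o => coord o (z.1, (z.2 : Euc d))) Q := by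
  induction Q using MvPolynomial.induction_on generalizing β P with
  | C a =>
    simp only [MvPolynomial.eval_C, mul_assoc]
    exact isApprox_mul hβ hβ' (hP.mul contDiff_const)
  | add p q hp hq =>
    simp only [map_add, mul_add]
    exact (hp hβ hβ' hP).add (hq hβ hβ' hP)
  | mul_X p o hp =>
    cases o with
    | none =>
      have h := hp (β := fun t => β t * t) hβ.mul_right (hβ'.mul contDiff_id) hP
      convert h using 2 with z
      simp only [map_mul, MvPolynomial.eval_X, coord, Option.elim_none]
      ring
    | some i =>
      have h := hp hβ hβ' (P := fun y => P y * y i)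
        (hP.mul (EuclideanSpace.proj (𝕜 := ℝ) i).contDiff)
      convert h using 2 with z
      simp only [map_mul, MvPolynomial.eval_X, coord, Option.elim_some]
      ring

/-- The Weierstrass approximation theorem on a compact part of the Radon domain. -/
lemma exists_polynomial_near {d : ℕ} {v : Dom d → ℝ} (hv : Continuous v) (L : ℝ) {ε : ℝ}
    (hε : 0 < ε) : ∃ Q : MvPolynomial (Option (Fin d)) ℝ, ∀ z : Dom d, |z.1| ≤ L →
      |MvPolynomial.eval (fun o => coord o (z.1, (z.2 : Euc d))) Q - v z| ≤ ε := by
  set S : Set (Dom d) := Icc (-L) L ×ˢ univ with hS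
  have : CompactSpace S := isCompact_iff_compactSpace.1 (isCompact_Icc.prod isCompact_univ)
  have hcoord : ∀ o : Option (Fin d),
      Continuous fun z : S => coord o ((z : Dom d).1, ((z : Dom d).2 : Euc d)) := by
    rintro (_ | i)
    · change Continuous fun z : S => (z : Dom d).1
      exact continuous_fst.comp continuous_subtype_val
    · change Continuous fun z : S => ((z : Dom d).2 : Euc d) i
      exact (EuclideanSpace.proj (𝕜 := ℝ) i).continuous.comp
        (continuous_subtype_val.comp (continuous_snd.comp continuous_subtype_val))
  have heval : ∀ (Q : MvPolynomial (Option (Fin d)) ℝ) (z : S),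
      (MvPolynomial.aeval (R := ℝ) (fun o : Option (Fin d) => (⟨_, hcoord o⟩ : C(S, ℝ))) Q) z =
        MvPolynomial.eval (fun o => coord o ((z : Dom d).1, ((z : Dom d).2 : Euc d))) Q := by
    intro Q z
    induction Q using MvPolynomial.induction_on with
    | C a => simp
    | add p q hp hq => rw [map_add, map_add, ContinuousMap.add_apply, hp, hq]
    | mul_X p o hp =>
      rw [map_mul, map_mul, ContinuousMap.mul_apply, hp, MvPolynomial.aeval_X,
        MvPolynomial.eval_X]
      rfl
  set A : Subalgebra ℝ C(S, ℝ) := (MvPolynomial.aeval (R := ℝ) fun o : Option (Fin d) =>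
    (⟨_, hcoord o⟩ : C(S, ℝ))).range with hA
  have hsep : A.SeparatesPoints := by
    intro z z' hne
    by_contra hcon
    refine hne ?_
    have h : ∀ o, coord o ((z : Dom d).1, ((z : Dom d).2 : Euc d)) =
        coord o ((z' : Dom d).1, ((z' : Dom d).2 : Euc d)) := fun o => by
      by_contra h
      refine hcon ⟨_, ⟨⟨_, hcoord o⟩, ⟨MvPolynomial.X o, by simp⟩, rfl⟩, h⟩
    refine Subtype.ext (Prod.ext (h none) (Subtype.ext ?_))
    ext i
    exact h (some i)
  obtain ⟨⟨f, Q, rfl⟩, hf⟩ := ContinuousMap.exists_mem_subalgebra_near_continuousMap_of_separatesPoints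
    A hsep ⟨fun z : S => v z, hv.comp continuous_subtype_val⟩ ε hε
  refine ⟨Q, fun z hz => ?_⟩
  have hzS : z ∈ S := ⟨abs_le.1 hz, mem_univ _⟩
  have h1 := (ContinuousMap.norm_coe_le_norm _ (⟨z, hzS⟩ : S)).trans hf.le
  rw [← heval Q ⟨z, hzS⟩]
  exact h1

open scoped ZeroAtInfty

/-- Band-limited functions are dense in the continuous functions that vanish at infinity. -/
lemma isApprox_of_zeroAtInfty {d : ℕ} (v : C₀(Dom d, ℝ)) : IsApprox (v : Dom d → ℝ) := by
  refine IsApprox.of_near fun ε hε => ?_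
  have h0 : ∀ᶠ z in cocompact (Dom d), |v z| < ε / 2 := by
    have := v.zero_at_infty'.eventually (Metric.ball_mem_nhds (0 : ℝ) (half_pos hε))
    simpa using this
  obtain ⟨S, hS, hSv⟩ := mem_cocompact.1 h0
  obtain ⟨L, hL⟩ := hS.exists_bound_of_continuousOn continuous_fst.continuousOn
  set χ : ContDiffBump (0 : ℝ) := ⟨max L 1, max L 1 + 1, lt_max_of_lt_right one_pos,
    lt_add_one _⟩ with hχ
  obtain ⟨Q, hQ⟩ := exists_polynomial_near v.continuous (max L 1 + 1) (half_pos hε)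
  refine ⟨_, isApprox_mul_polynomial Q χ.hasCompactSupport χ.contDiff
    (P := fun _ => 1) contDiff_const, fun z => ?_⟩
  rw [mul_one]
  have hχ0 : 0 ≤ χ z.1 := χ.nonneg
  have hχ1 : χ z.1 ≤ 1 := χ.le_one
  set q := MvPolynomial.eval (fun o => coord o (z.1, (z.2 : Euc d))) Q
  have h1 : |χ z.1 * (q - v z)| ≤ ε / 2 := by
    rw [abs_mul, abs_of_nonneg hχ0]
    by_cases hz : |z.1| ≤ max L 1 + 1
    · exact (mul_le_of_le_one_left (abs_nonneg _) hχ1).trans (hQ z hz)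
    · rw [χ.zero_of_le_dist (by simpa [hχ] using (not_le.1 hz).le), zero_mul]
      positivity
  have h2 : |(1 - χ z.1) * v z| ≤ ε / 2 := by
    rw [abs_mul, abs_of_nonneg (sub_nonneg.2 hχ1)]
    by_cases hz : z ∈ S
    · rw [χ.one_of_mem_closedBall (by simpa [hχ] using Or.inl (hL z hz)), sub_self, zero_mul]
      positivity
    · exact (mul_le_of_le_one_left (abs_nonneg _) (by linarith)).trans (hSv hz).le
  have h3 : χ z.1 * q - v z = χ z.1 * (q - v z) - (1 - χ z.1) * v z := by ring
  rw [h3]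
  exact (abs_sub _ _).trans (by linarith)

/-- The test functions that come with a Lizorkin function are dense in the continuous functions of
the parity `(-1)^m` that vanish at infinity. -/
lemma exists_isRadonLizorkin_near {d m : ℕ} (hd : 1 ≤ d) (hm : m ≠ 0) (v : C₀(Dom d, ℝ))
    (hv : ∀ z, v (-z) = (-1) ^ m * v z) {ε : ℝ} (hε : 0 < ε) :
    ∃ g : Dom d → ℝ, IsRadonLizorkin m g ∧ (∃ φ : lizorkin d,
      ∀ x, (φ : 𝓢(Euc d, ℝ)) x = backproj (radialFilter (tDeriv m g)) x) ∧
      ∀ z, |g z - v z| ≤ ε := by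
  obtain ⟨K, hK, hKv⟩ := isApprox_of_zeroAtInfty v ε hε
  obtain ⟨G, hG, hGp, hGm⟩ := hK.isRadonLizorkin (m := m)
  refine ⟨_, hGm, hG.exists_lizorkin hd hm fun z => rfl, fun z => ?_⟩
  have h1 : ((-1 : ℝ) ^ m) * (-1) ^ m = 1 := by rw [← mul_pow]; simp
  have h2 : G (z.1, (z.2 : Euc d)) - v z = 2⁻¹ * ((K (z.1, (z.2 : Euc d)) - v z) +
      (-1) ^ m * (K ((-z).1, (((-z).2 : Sph d) : Euc d)) - v (-z))) := by
    have h3 : (((-z).1, (((-z).2 : Sph d) : Euc d)) : ℝ × Euc d) = -(z.1, (z.2 : Euc d)) := rfl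
    rw [hGp, hv, h3]
    linear_combination (2⁻¹ * v z) * h1
  rw [h2, abs_mul, abs_of_pos (by norm_num : (0 : ℝ) < 2⁻¹)]
  have h4 := abs_add_le (K (z.1, (z.2 : Euc d)) - v z)
    ((-1) ^ m * (K ((-z).1, (((-z).2 : Sph d) : Euc d)) - v (-z)))
  rw [abs_mul, abs_pow, abs_neg, abs_one, one_pow, one_mul] at h4
  linarith [hKv z, hKv (-z)]

/-! ### Integration against finite signed measures -/

section SignedMeasure

variable {X : Type*} [MeasurableSpace X]

/-- The total variation measure of a signed measure is finite. -/
instance isFiniteMeasure_variation (μ : SignedMeasure X) : IsFiniteMeasure μ.variation := by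
  rw [← SignedMeasure.totalVariation_eq_variation, SignedMeasure.totalVariation]
  infer_instance

/-- The integral `∫ g dμ` of a real function against a signed measure. -/
abbrev pairing (μ : SignedMeasure X) (g : X → ℝ) : ℝ := ∫ᵛ z, g z ∂<•μ

lemma norm_lsmul_flip_le : ‖(ContinuousLinearMap.lsmul ℝ ℝ (E := ℝ)).flip‖ ≤ 1 := by
  rw [ContinuousLinearMap.opNorm_flip]
  exact ContinuousLinearMap.opNorm_lsmul_le

lemma abs_pairing_le_integral (μ : SignedMeasure X) (g : X → ℝ) :
    |pairing μ g| ≤ ∫ z, |g z| ∂μ.variation := by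
  have h := VectorMeasure.norm_integral_le_integral_norm (μ := μ) (f := g)
    (B := (ContinuousLinearMap.lsmul ℝ ℝ).flip)
  exact h.trans (mul_le_of_le_one_left (integral_nonneg fun _ => norm_nonneg _)
    norm_lsmul_flip_le)

lemma abs_pairing_le (μ : SignedMeasure X) {g : X → ℝ} {C : ℝ} (hg : ∀ z, |g z| ≤ C) :
    |pairing μ g| ≤ C * μ.variation.real univ := by
  refine (abs_pairing_le_integral μ g).trans ?_
  refine (integral_mono_of_nonneg (Eventually.of_forall fun _ => abs_nonneg _)
    (integrable_const C) (Eventually.of_forall hg)).trans ?_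
  rw [integral_const, smul_eq_mul, mul_comm]

lemma pairing_toSignedMeasure_sub (μ ν : Measure X) [IsFiniteMeasure μ] [IsFiniteMeasure ν]
    {g : X → ℝ} (hμ : Integrable g μ) (hν : Integrable g ν) :
    pairing (μ.toSignedMeasure - ν.toSignedMeasure) g = ∫ z, g z ∂μ - ∫ z, g z ∂ν := by
  have hμ' : VectorMeasure.Integrable μ.toSignedMeasure g := by
    simpa [VectorMeasure.Integrable] using hμ
  have hν' : VectorMeasure.Integrable ν.toSignedMeasure g := by
    simpa [VectorMeasure.Integrable] using hν
  rw [pairing, VectorMeasure.integral_sub_vectorMeasure hμ' hν',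
    VectorMeasure.integral_toSignedMeasure, VectorMeasure.integral_toSignedMeasure]

/-- The sign function of a Hahn decomposition attains the total variation. -/
lemma exists_sign (μ : SignedMeasure X) : ∃ s : X → ℝ, Measurable s ∧ (∀ z, |s z| ≤ 1) ∧
    pairing μ s = μ.variation.real univ := by
  obtain ⟨S, hS, hp, hn⟩ := μ.toJordanDecomposition.mutuallySingular
  refine ⟨fun z => Sᶜ.indicator (fun _ => (1 : ℝ)) z - S.indicator (fun _ => (1 : ℝ)) z,
    (measurable_const.indicator hS.compl).sub (measurable_const.indicator hS), fun z => ?_, ?_⟩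
  · by_cases hz : z ∈ S <;> simp [hz]
  · have hint : ∀ A, MeasurableSet A → VectorMeasure.Integrable μ (A.indicator fun _ => (1 : ℝ)) :=
      fun A hA => (integrable_const (1 : ℝ)).indicator hA
    rw [pairing, VectorMeasure.integral_fun_sub (hint _ hS.compl) (hint _ hS),
      VectorMeasure.integral_indicator_const _ hS.compl, VectorMeasure.integral_indicator_const _ hS]
    simp only [ContinuousLinearMap.flip_apply, ContinuousLinearMap.lsmul_apply, smul_eq_mul, mul_one]
    rw [μ.apply_eq_posPart_real_sub_negPart_real hS,
      μ.apply_eq_posPart_real_sub_negPart_real hS.compl,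
      ← SignedMeasure.totalVariation_eq_variation, SignedMeasure.totalVariation,
      measureReal_add_apply, ← measureReal_add_measureReal_compl hS,
      ← measureReal_add_measureReal_compl (μ := μ.toJordanDecomposition.negPart) hS,
      measureReal_def _ S, hp, measureReal_def μ.toJordanDecomposition.negPart Sᶜ, hn]
    simp only [ENNReal.toReal_zero]
    ring

end SignedMeasure

section Parity

variable {d m : ℕ}

open scoped ZeroAtInfty

lemma integrable_of_zeroAtInfty (μ : SignedMeasure (Dom d)) (v : C₀(Dom d, ℝ)) :
    VectorMeasure.Integrable μ (v : Dom d → ℝ) := by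
  refine (integrable_const ‖v‖).mono' v.continuous.aestronglyMeasurable
    (Eventually.of_forall fun z => ?_)
  exact v.toBCF.norm_coe_le_norm z

/-- Measures on the Radon domain of the parity `(-1)^m`. -/
def HasParity (m : ℕ) (μ : SignedMeasure (Dom d)) : Prop :=
  ∀ A : Set (Dom d), MeasurableSet A → μ (Neg.neg ⁻¹' A) = (-1) ^ m * μ A

lemma HasParity.map_neg {μ : SignedMeasure (Dom d)} (hμ : HasParity m μ) :
    μ.map (Homeomorph.neg (Dom d)).toMeasurableEquiv = ((-1 : ℝ) ^ m) • μ := by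
  ext A hA
  rw [VectorMeasure.map_apply _ (Homeomorph.neg (Dom d)).toMeasurableEquiv.measurable hA]
  exact hμ A hA

lemma HasParity.pairing_neg {μ : SignedMeasure (Dom d)} (hμ : HasParity m μ) (g : Dom d → ℝ) :
    pairing μ (fun z => g (-z)) = (-1) ^ m * pairing μ g := by
  have h := VectorMeasure.integral_map_equiv (μ := μ)
    (B := (ContinuousLinearMap.lsmul ℝ ℝ (E := ℝ)).flip)
    (Homeomorph.neg (Dom d)).toMeasurableEquiv g
  rw [hμ.map_neg, VectorMeasure.integral_smul_vectorMeasure] at h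
  exact h.symm

lemma neg_one_pow_mul_self (m : ℕ) : ((-1 : ℝ) ^ m) * (-1) ^ m = 1 := by
  rw [← mul_pow]; simp

/-- The function `z ↦ v (-z)`. -/
def reflectC0 (v : C₀(Dom d, ℝ)) : C₀(Dom d, ℝ) :=
  ⟨⟨fun z => v (-z), by fun_prop⟩,
    v.zero_at_infty'.comp (Homeomorph.neg (Dom d)).isClosedEmbedding.tendsto_cocompact⟩

/-- The part of a continuous function with the parity `(-1)^m`. -/
def parityPart (m : ℕ) (v : C₀(Dom d, ℝ)) : C₀(Dom d, ℝ) :=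
  (2⁻¹ : ℝ) • (v + ((-1 : ℝ) ^ m) • reflectC0 v)

lemma parityPart_apply (v : C₀(Dom d, ℝ)) (z : Dom d) :
    parityPart m v z = 2⁻¹ * (v z + (-1) ^ m * v (-z)) := rfl

lemma parityPart_neg (v : C₀(Dom d, ℝ)) (z : Dom d) : parityPart m v (-z) = (-1) ^ m * parityPart m v z := by
  rw [parityPart_apply, parityPart_apply, neg_neg]
  linear_combination -(2⁻¹ * v (-z)) * neg_one_pow_mul_self m

lemma HasParity.pairing_parityPart {μ : SignedMeasure (Dom d)} (hμ : HasParity m μ)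
    (v : C₀(Dom d, ℝ)) : pairing μ (parityPart m v) = pairing μ v := by
  have hn : VectorMeasure.Integrable μ fun z => v (-z) := integrable_of_zeroAtInfty μ (reflectC0 v)
  have hn' : VectorMeasure.Integrable μ fun z => ((-1 : ℝ) ^ m) • v (-z) := hn.smul ((-1 : ℝ) ^ m)
  have h1 : (parityPart m v : Dom d → ℝ) = fun z => (2⁻¹ : ℝ) • (v z + ((-1 : ℝ) ^ m) • v (-z)) := rfl
  rw [pairing, h1, VectorMeasure.integral_fun_smul, VectorMeasure.integral_fun_add
    (integrable_of_zeroAtInfty μ v) hn', VectorMeasure.integral_fun_smul]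
  have h2 := hμ.pairing_neg v
  rw [pairing] at h2
  rw [h2, smul_eq_mul, smul_eq_mul, ← mul_assoc, neg_one_pow_mul_self]
  ring

lemma abs_parityPart_le {v : C₀(Dom d, ℝ)} {C : ℝ} (h : ∀ z, |v z| ≤ C) (z : Dom d) :
    |parityPart m v z| ≤ C := by
  rw [parityPart_apply, abs_mul, abs_of_pos (by norm_num : (0 : ℝ) < 2⁻¹)]
  have h4 := abs_add_le (v z) ((-1) ^ m * v (-z))
  rw [abs_mul, abs_pow, abs_neg, abs_one, one_pow, one_mul] at h4
  linarith [h z, h (-z)]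

lemma IsRepresentedBy.hasParity {f : LizorkinDist d} {μ : SignedMeasure (Dom d)}
    (h : IsRepresentedBy m f μ) : HasParity m μ := h.parity

/-- A continuous function of norm at most one nearly attains the total variation. -/
lemma exists_zeroAtInfty_near_variation (μ : SignedMeasure (Dom d)) {ε : ℝ} (hε : 0 < ε) :
    ∃ v : C₀(Dom d, ℝ), (∀ z, |v z| ≤ 1) ∧ μ.variation.real univ - ε ≤ pairing μ v := by
  obtain ⟨s, hs, hs1, hsμ⟩ := exists_sign μ
  have hsint : Integrable s μ.variation := (integrable_const (1 : ℝ)).mono'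
    hs.aestronglyMeasurable (Eventually.of_forall hs1)
  obtain ⟨c, hc, hcε, hcc, hci⟩ := hsint.exists_hasCompactSupport_integral_sub_le hε
  set v : C₀(Dom d, ℝ) := ⟨⟨fun z => max (-1) (min (c z) 1), by fun_prop⟩,
    (hc.comp_left (g := fun u : ℝ => max (-1) (min u 1)) (by norm_num)).is_zero_at_infty⟩ with hv
  have hvz : ∀ z, v z = max (-1) (min (c z) 1) := fun z => rfl
  refine ⟨v, fun z => ?_, ?_⟩
  · rw [hvz, abs_le]
    exact ⟨le_max_left _ _, max_le (by norm_num) (min_le_right _ _)⟩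
  · have hvint := integrable_of_zeroAtInfty μ v
    have h1 : pairing μ s - pairing μ v = pairing μ fun z => s z - v z :=
      (VectorMeasure.integral_fun_sub hsint hvint).symm
    have h2 : |pairing μ fun z => s z - v z| ≤ ε := by
      refine (abs_pairing_le_integral μ _).trans (le_trans ?_ hcε)
      refine integral_mono_of_nonneg (Eventually.of_forall fun _ => abs_nonneg _) ?_
        (Eventually.of_forall fun z => ?_)
      · exact (hsint.sub hci).norm
      · have h3 := abs_le.1 (hs1 z)
        simp only [Real.norm_eq_abs, hvz]
        rcases le_total (c z) 1 with h4 | h4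
        · rw [min_eq_left h4]
          rcases le_total (-1) (c z) with h5 | h5
          · rw [max_eq_right h5]
          · rw [max_eq_left h5, abs_of_nonneg (by linarith), abs_of_nonneg (by linarith)]
            linarith
        · rw [min_eq_right h4, max_eq_right (by norm_num), abs_of_nonpos (by linarith),
            abs_of_nonpos (by linarith)]
          linarith
    have h6 := abs_le.1 h2
    linarith [h6.2]

end Parity

/-! ### The norm of a represented distribution -/

section Norm

variable {d m : ℕ}

open scoped ZeroAtInfty

/-- The functions `∂_t^{-m} R φ` are dense in the continuous functions of the parity `(-1)^m` that
vanish at infinity. -/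
lemma exists_intRadon_near (hd : 1 ≤ d) (hm : 2 ≤ m) (v : C₀(Dom d, ℝ))
    (hv : ∀ z, v (-z) = (-1) ^ m * v z) {ε : ℝ} (hε : 0 < ε) :
    ∃ φ : lizorkin d, ∀ z, |intRadon m φ z - v z| ≤ ε := by
  have hm0 : m ≠ 0 := by omega
  obtain ⟨g, hg, ⟨φ, hφ⟩, hgv⟩ := exists_isRadonLizorkin_near hd hm0 (((-1 : ℝ) ^ m) • v)
    (fun z => by
      change (-1) ^ m * v (-z) = (-1) ^ m * ((-1) ^ m * v z)
      rw [hv]) hε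
  refine ⟨φ, fun z => ?_⟩
  have h1 : (((-1 : ℝ) ^ m) • v) z = (-1) ^ m * v z := rfl
  have h2 := hgv z
  rw [h1] at h2
  have h3 : intRadon m φ z - v z = (-1) ^ m * (g z - (-1) ^ m * v z) := by
    rw [intRadon_of_backproj hd hm0 hg hφ z]
    linear_combination (v z) * neg_one_pow_mul_self m
  rw [h3, abs_mul, abs_pow, abs_neg, abs_one, one_pow, one_mul]
  exact h2

lemma IsRepresentedBy.radonNorm_le (hd : 1 ≤ d) (hm : 2 ≤ m) {f : LizorkinDist d}
    {μ : SignedMeasure (Dom d)} (h : IsRepresentedBy m f μ) :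
    radonNorm m f ≤ ENNReal.ofReal (μ.variation.real univ) := by
  have hm0 : m ≠ 0 := by omega
  refine iSup_le fun g => iSup_le fun hg => iSup_le fun hg1 => iSup_le fun φ => iSup_le fun hφ => ?_
  refine ENNReal.ofReal_le_ofReal ?_
  rw [h.apply_eq]
  have h1 : ∀ z, |intRadon m φ z| ≤ 1 := fun z => by
    rw [intRadon_of_backproj hd hm0 hg hφ z, abs_mul, abs_pow, abs_neg, abs_one, one_pow, one_mul]
    exact hg1 z
  have h2 := abs_pairing_le μ h1
  rw [one_mul] at h2
  refine (le_abs_self _).trans ?_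
  rw [abs_mul, abs_pow, abs_neg, abs_one, one_pow, one_mul]
  exact h2

lemma IsRepresentedBy.le_radonNorm (hd : 1 ≤ d) (hm : 2 ≤ m) {f : LizorkinDist d}
    {μ : SignedMeasure (Dom d)} (h : IsRepresentedBy m f μ) :
    ENNReal.ofReal (μ.variation.real univ) ≤ radonNorm m f := by
  have hm0 : m ≠ 0 := by omega
  set V := μ.variation.real univ with hV
  have key : ∀ ε ∈ Ioo (0 : ℝ) 1,
      ENNReal.ofReal ((1 - ε) * (V - ε) - ε * V) ≤ radonNorm m f := by
    intro ε hε
    obtain ⟨w, hw1, hwμ⟩ := exists_zeroAtInfty_near_variation μ hε.1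
    -- the factor `1 - ε` leaves room for the approximation to stay in the unit ball
    have hv1 : ∀ z, |((1 - ε) • parityPart m w : C₀(Dom d, ℝ)) z| ≤ 1 - ε := fun z => by
      change |(1 - ε) * parityPart m w z| ≤ 1 - ε
      rw [abs_mul, abs_of_pos (sub_pos.2 hε.2)]
      exact mul_le_of_le_one_right (sub_pos.2 hε.2).le (abs_parityPart_le hw1 z)
    have hvμ : pairing μ ((1 - ε) • parityPart m w : C₀(Dom d, ℝ)) = (1 - ε) * pairing μ w := by
      rw [← h.hasParity.pairing_parityPart w]
      exact VectorMeasure.integral_fun_smul (μ := μ)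
        (B := (ContinuousLinearMap.lsmul ℝ ℝ (E := ℝ)).flip) (f := parityPart m w) (1 - ε)
    set v : C₀(Dom d, ℝ) := (1 - ε) • parityPart m w with hv
    obtain ⟨g, hg, ⟨φ, hφ⟩, hgv⟩ := exists_isRadonLizorkin_near hd hm0 v (fun z => by
      change (1 - ε) * parityPart m w (-z) = (-1) ^ m * ((1 - ε) * parityPart m w z)
      rw [parityPart_neg]; ring) hε.1
    have hg1 : ∀ z, |g z| ≤ 1 := fun z => by
      have h1 := abs_add_le (g z - v z) (v z)
      rw [sub_add_cancel] at h1
      linarith [hgv z, hv1 z]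
    have hφg : ∀ z, intRadon m φ z = (-1) ^ m * g z := intRadon_of_backproj hd hm0 hg hφ
    have hgφ : ∀ z, g z = (-1) ^ m * intRadon m φ z := fun z => by
      rw [hφg]; linear_combination -(g z) * neg_one_pow_mul_self m
    have h2 : (-1) ^ m * f φ = pairing μ g := by
      rw [h.apply_eq, ← smul_eq_mul, ← VectorMeasure.integral_fun_smul]
      exact congrArg (pairing μ) (funext fun z => (hgφ z).symm)
    have hgint : VectorMeasure.Integrable μ g := by
      have := (h.integrable φ).const_mul ((-1) ^ m)
      exact this.congr (Eventually.of_forall fun z => (hgφ z).symm)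
    have h3 : |pairing μ g - pairing μ v| ≤ ε * V := by
      rw [pairing, pairing, ← VectorMeasure.integral_fun_sub hgint (integrable_of_zeroAtInfty μ v)]
      exact abs_pairing_le μ hgv
    refine le_trans (ENNReal.ofReal_le_ofReal ?_) (le_iSup_of_le g (le_iSup_of_le hg
      (le_iSup_of_le hg1 (le_iSup_of_le φ (le_iSup_of_le hφ le_rfl)))))
    rw [h2]
    have h4 := (abs_le.1 h3).1
    rw [hvμ] at h4
    nlinarith [mul_le_mul_of_nonneg_left hwμ (sub_pos.2 hε.2).le]
  have hlim : Tendsto (fun ε : ℝ => ENNReal.ofReal ((1 - ε) * (V - ε) - ε * V)) (𝓝[>] 0)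
      (𝓝 (ENNReal.ofReal V)) := by
    have h1 : Continuous fun ε : ℝ => ENNReal.ofReal ((1 - ε) * (V - ε) - ε * V) :=
      ENNReal.continuous_ofReal.comp (by fun_prop)
    have h2 := h1.tendsto 0
    simp only [sub_zero, one_mul, zero_mul] at h2
    exact h2.mono_left nhdsWithin_le_nhds
  refine le_of_tendsto hlim ?_
  filter_upwards [Ioo_mem_nhdsGT one_pos] with ε hε using key ε hε

/-- The norm `‖∂_t^m K_rad R f‖_M` is the total variation of the measure that represents `f`. -/
lemma IsRepresentedBy.radonNorm_eq (hd : 1 ≤ d) (hm : 2 ≤ m) {f : LizorkinDist d}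
    {μ : SignedMeasure (Dom d)} (h : IsRepresentedBy m f μ) :
    radonNorm m f = ENNReal.ofReal (μ.variation.real univ) :=
  le_antisymm (h.radonNorm_le hd hm) (h.le_radonNorm hd hm)

lemma IsRepresentedBy.sub {f g : LizorkinDist d} {μ ν : SignedMeasure (Dom d)}
    (hf : IsRepresentedBy m f μ) (hg : IsRepresentedBy m g ν) :
    IsRepresentedBy m (f - g) (μ - ν) := by
  refine ⟨fun A hA => ?_, fun φ => (hf.integrable φ).sub_vectorMeasure (hg.integrable φ),
    fun φ => ?_⟩
  · rw [_root_.sub_apply, _root_.sub_apply, hf.parity A hA, hg.parity A hA, mul_sub]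
  · rw [VectorMeasure.integral_sub_vectorMeasure (hf.integrable φ) (hg.integrable φ),
      ← hf.apply_eq, ← hg.apply_eq]
    rfl

/-- The measure that represents a distribution is unique, as the total variation of the difference
of two such measures is a norm of the zero distribution. -/
lemma IsRepresentedBy.unique (hd : 1 ≤ d) (hm : 2 ≤ m) {f : LizorkinDist d}
    {μ ν : SignedMeasure (Dom d)} (hμ : IsRepresentedBy m f μ) (hν : IsRepresentedBy m f ν) :
    μ = ν := by
  have h := (hμ.sub hν).radonNorm_eq hd hm
  have h0 : radonNorm m (f - f) = 0 := by simp [radonNorm]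
  rw [h0, eq_comm, ENNReal.ofReal_eq_zero] at h
  have h1 : (μ - ν).variation.real univ = 0 := le_antisymm h measureReal_nonneg
  rw [measureReal_eq_zero_iff, Measure.measure_univ_eq_zero, VectorMeasure.variation_eq_zero] at h1
  exact sub_eq_zero.1 h1

end Norm

/-! ### The weak* topology of the space of represented distributions -/

section RadonSpace

variable {d m : ℕ}

open scoped ZeroAtInfty

namespace RadonSpace

@[ext] lemma ext_toDist {f g : RadonSpace d m} (h : f.toDist = g.toDist) : f = g := Subtype.ext h

lemma isRepresentedBy_measure (f : RadonSpace d m) : IsRepresentedBy m f.toDist f.measure :=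
  Classical.choose_spec (show ∃ μ, IsRepresentedBy m f.toDist μ from f.2)

lemma measure_eq (hd : 1 ≤ d) (hm : 2 ≤ m) {f : RadonSpace d m} {μ : SignedMeasure (Dom d)}
    (h : IsRepresentedBy m f.toDist μ) : f.measure = μ :=
  f.isRepresentedBy_measure.unique hd hm h

lemma measure_add (hd : 1 ≤ d) (hm : 2 ≤ m) (f g : RadonSpace d m) :
    (f + g).measure = f.measure + g.measure := by
  refine measure_eq hd hm ?_
  have hf := f.isRepresentedBy_measure
  have hg := g.isRepresentedBy_measure
  refine ⟨fun A hA => ?_, fun φ => (hf.integrable φ).add_vectorMeasure (hg.integrable φ),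
    fun φ => ?_⟩
  · rw [_root_.add_apply, _root_.add_apply, hf.parity A hA, hg.parity A hA, mul_add]
  · rw [VectorMeasure.integral_add_vectorMeasure (hf.integrable φ) (hg.integrable φ),
      ← hf.apply_eq, ← hg.apply_eq]
    rfl

lemma measure_smul (hd : 1 ≤ d) (hm : 2 ≤ m) (c : ℝ) (f : RadonSpace d m) :
    (c • f).measure = c • f.measure := by
  refine measure_eq hd hm ?_
  have hf := f.isRepresentedBy_measure
  refine ⟨fun A hA => ?_, fun φ => (hf.integrable φ).smul_vectorMeasure c, fun φ => ?_⟩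
  · rw [_root_.smul_apply, _root_.smul_apply, hf.parity A hA, smul_eq_mul, smul_eq_mul,
      mul_left_comm]
  · rw [VectorMeasure.integral_smul_vectorMeasure, ← hf.apply_eq]
    rfl

lemma eq_of_measure_eq {f g : RadonSpace d m} (h : f.measure = g.measure) : f = g := by
  ext φ
  rw [f.isRepresentedBy_measure.apply_eq, h, g.isRepresentedBy_measure.apply_eq]

/-- The element `R^* ∂_t^{-m} μ` of `M_{Rad,m}(ℝ^d)`. -/
def ofMeasure (hm : 2 ≤ m) (μ : SignedMeasure (Dom d)) (hμ : HasParity m μ) : RadonSpace d m :=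
  let hint : ∀ φ : lizorkin d, VectorMeasure.Integrable μ (intRadon m φ) := fun φ =>
    integrable_of_zeroAtInfty μ (intRadonC0 hm φ)
  let T : lizorkin d →ₗ[ℝ] ℝ :=
    { toFun := fun φ => pairing μ (intRadon m φ)
      map_add' := fun φ ψ => by
        rw [pairing, ← VectorMeasure.integral_fun_add (hint φ) (hint ψ)]
        exact congrArg (pairing μ) (funext (intRadon_add hm φ ψ))
      map_smul' := fun c φ => by
        rw [RingHom.id_apply, ← VectorMeasure.integral_fun_smul]
        exact congrArg (pairing μ) (funext (intRadon_smul hm c φ)) }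
  ⟨⟨T, by
    have hT : ∀ φ, |T φ| ≤ ‖intRadonC0 hm φ‖ * μ.variation.real univ := fun φ =>
      abs_pairing_le μ fun z => (intRadonC0 hm φ).toBCF.norm_coe_le_norm z
    refine continuous_of_continuousAt_zero T ?_
    rw [ContinuousAt, map_zero]
    refine squeeze_zero_norm hT ?_
    have h : Continuous fun φ : lizorkin d => ‖intRadonC0 hm φ‖ * μ.variation.real univ :=
      (continuous_intRadonC0 hm).norm.mul_const _
    simpa using h.tendsto 0⟩, μ, ⟨hμ, hint, fun _ => rfl⟩⟩

lemma measure_ofMeasure (hd : 1 ≤ d) (hm : 2 ≤ m) {μ : SignedMeasure (Dom d)}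
    (hμ : HasParity m μ) : (ofMeasure hm μ hμ).measure = μ :=
  measure_eq hd hm ⟨hμ, fun φ => integrable_of_zeroAtInfty μ (intRadonC0 hm φ), fun _ => rfl⟩

/-- The linear map that sends `f = R^* ∂_t^{-m} μ` to the functional `v ↦ ∫ v dμ` on the continuous
functions that vanish at infinity. -/
def toFunctional (hd : 1 ≤ d) (hm : 2 ≤ m) : RadonSpace d m →ₗ[ℝ] (C₀(Dom d, ℝ) → ℝ) where
  toFun f v := pairing f.measure v
  map_add' f g := by
    ext v
    rw [measure_add hd hm]
    exact VectorMeasure.integral_add_vectorMeasure (integrable_of_zeroAtInfty _ v)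
      (integrable_of_zeroAtInfty _ v)
  map_smul' c f := by
    ext v
    rw [measure_smul hd hm]
    exact VectorMeasure.integral_smul_vectorMeasure _ _

lemma tendsto_toDist (hm : 2 ≤ m) {u : ℕ → lizorkin d} {v : C₀(Dom d, ℝ)}
    (h : Tendsto (fun n => intRadonC0 hm (u n)) atTop (𝓝 v)) (f : RadonSpace d m) :
    Tendsto (fun n => f.toDist (u n)) atTop (𝓝 (pairing f.measure v)) := by
  rw [tendsto_iff_norm_sub_tendsto_zero] at h ⊢
  refine squeeze_zero (fun _ => norm_nonneg _) (fun n => ?_)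
    (by simpa using h.mul_const (f.measure.variation.real univ))
  rw [f.isRepresentedBy_measure.apply_eq, pairing, ← VectorMeasure.integral_fun_sub
    (f.isRepresentedBy_measure.integrable _) (integrable_of_zeroAtInfty _ v)]
  exact abs_pairing_le f.measure fun z => (intRadonC0 hm (u n) - v).toBCF.norm_coe_le_norm z

/-- The topology of `M_{Rad,m}(ℝ^d)` is the weak* topology of the measures that represent its
elements. -/
lemma topology_eq_induced (hd : 1 ≤ d) (hm : 2 ≤ m) :
    (inferInstance : TopologicalSpace (RadonSpace d m)) =
      TopologicalSpace.induced (toFunctional hd hm) Pi.topologicalSpace := by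
  rw [induced_to_pi]
  refine le_antisymm (le_iInf fun v => ?_) (le_iInf fun u => ?_)
  · -- a sequence of Lizorkin functions that represents the part of `v` of the right parity
    have hn : ∀ n : ℕ, (0 : ℝ) < 1 / ((n : ℝ) + 1) := fun n => by positivity
    choose u hu using fun n => exists_intRadon_near hd hm (parityPart m v) (parityPart_neg v) (hn n)
    have hlim : Tendsto (fun n => intRadonC0 hm (u n)) atTop (𝓝 (parityPart m v)) := by
      rw [tendsto_iff_norm_sub_tendsto_zero]
      refine squeeze_zero (fun _ => norm_nonneg _) (fun n => ?_)
        (tendsto_one_div_add_atTop_nhds_zero_nat (𝕜 := ℝ))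
      exact (BoundedContinuousFunction.norm_le (hn n).le).2 (hu n)
    have hcauchy : IsPredualCauchy m u := by
      intro ε hε
      obtain ⟨N, hN⟩ := Metric.cauchySeq_iff.1 hlim.cauchySeq ε hε
      refine ⟨N, fun n hn k hk z => ?_⟩
      have h := hN n hn k hk
      rw [dist_eq_norm, ← map_sub] at h
      exact ((intRadonC0 hm (u n - u k)).toBCF.norm_coe_le_norm z).trans h.le
    refine (iInf_le _ ⟨u, hcauchy⟩).trans (le_of_eq ?_)
    congr 1
    ext f
    rw [(tendsto_toDist hm hlim f).limUnder_eq]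
    exact f.isRepresentedBy_measure.hasParity.pairing_parityPart v
  · have hcauchy : CauchySeq fun n => intRadonC0 hm (u.1 n) := by
      rw [Metric.cauchySeq_iff]
      intro ε hε
      obtain ⟨N, hN⟩ := u.2 (ε / 2) (half_pos hε)
      refine ⟨N, fun n hn k hk => ?_⟩
      rw [dist_eq_norm, ← map_sub]
      exact ((BoundedContinuousFunction.norm_le (half_pos hε).le).2 (hN n hn k hk)).trans_lt
        (half_lt_self hε)
    obtain ⟨v, hv⟩ := cauchySeq_tendsto_of_complete hcauchy
    refine (iInf_le _ v).trans (le_of_eq ?_)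
    congr 1
    ext f
    exact (tendsto_toDist hm hv f).limUnder_eq.symm

lemma isInducing_toFunctional (hd : 1 ≤ d) (hm : 2 ≤ m) :
    IsInducing (toFunctional (m := m) hd hm) := ⟨topology_eq_induced hd hm⟩

lemma continuous_pairing (hd : 1 ≤ d) (hm : 2 ≤ m) (v : C₀(Dom d, ℝ)) :
    Continuous fun f : RadonSpace d m => pairing f.measure v :=
  (continuous_apply v).comp (isInducing_toFunctional hd hm).continuous

lemma isTopologicalAddGroup (hd : 1 ≤ d) (hm : 2 ≤ m) : IsTopologicalAddGroup (RadonSpace d m) := by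
  have h := topologicalAddGroup_induced (toFunctional (m := m) hd hm)
  rwa [← topology_eq_induced hd hm] at h

lemma continuousSMul (hd : 1 ≤ d) (hm : 2 ≤ m) : ContinuousSMul ℝ (RadonSpace d m) := by
  have h := continuousSMul_induced (toFunctional (m := m) hd hm)
  rwa [← topology_eq_induced hd hm] at h

lemma locallyConvexSpace (hd : 1 ≤ d) (hm : 2 ≤ m) : LocallyConvexSpace ℝ (RadonSpace d m) := by
  have h := LocallyConvexSpace.induced (𝕜 := ℝ) (toFunctional (m := m) hd hm)
  rwa [← topology_eq_induced hd hm] at h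

lemma t2Space (hd : 1 ≤ d) (hm : 2 ≤ m) : T2Space (RadonSpace d m) := by
  refine T2Space.of_injective_continuous (f := toFunctional hd hm) (fun f g h => ?_)
    (isInducing_toFunctional hd hm).continuous
  ext φ
  rw [f.isRepresentedBy_measure.apply_eq, g.isRepresentedBy_measure.apply_eq]
  exact congrFun h (intRadonC0 hm φ)

/-- The total variation of the measure that represents `f`. -/
def tv (f : RadonSpace d m) : ℝ := f.measure.variation.real univ

lemma tv_nonneg (f : RadonSpace d m) : 0 ≤ f.tv := measureReal_nonneg

lemma radonNorm_eq (hd : 1 ≤ d) (hm : 2 ≤ m) (f : RadonSpace d m) :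
    radonNorm m f.toDist = ENNReal.ofReal f.tv :=
  f.isRepresentedBy_measure.radonNorm_eq hd hm

lemma tv_add_le (hd : 1 ≤ d) (hm : 2 ≤ m) (f g : RadonSpace d m) : (f + g).tv ≤ f.tv + g.tv := by
  rw [tv, tv, tv, measure_add hd hm, ← measureReal_add_apply]
  refine ENNReal.toReal_mono (measure_ne_top _ _) ?_
  exact VectorMeasure.variation_add_le univ

lemma tv_smul (hd : 1 ≤ d) (hm : 2 ≤ m) (c : ℝ) (f : RadonSpace d m) :
    (c • f).tv = |c| * f.tv := by
  rw [tv, tv, measure_smul hd hm, VectorMeasure.variation_smul, measureReal_def, measureReal_def]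
  simp [ENNReal.toReal_mul]

lemma tv_sum_le (hd : 1 ≤ d) (hm : 2 ≤ m) {ι : Type*} (s : Finset ι) (f : ι → RadonSpace d m) :
    (∑ i ∈ s, f i).tv ≤ ∑ i ∈ s, (f i).tv := by
  classical
  induction s using Finset.induction_on with
  | empty =>
    have h := tv_smul hd hm 0 (0 : RadonSpace d m)
    rw [zero_smul, abs_zero, zero_mul] at h
    simp [h]
  | insert i s hi ih =>
    rw [Finset.sum_insert hi, Finset.sum_insert hi]
    exact (tv_add_le hd hm _ _).trans (by linarith)

/-- The total variation is the supremum of the continuous functionals `f ↦ ∫ v dμ`, `‖v‖ ≤ 1`. -/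
lemma tv_le_iff (f : RadonSpace d m) (C : ℝ) :
    f.tv ≤ C ↔ ∀ v : C₀(Dom d, ℝ), (∀ z, |v z| ≤ 1) → pairing f.measure v ≤ C := by
  refine ⟨fun h v hv => ?_, fun h => le_of_forall_pos_le_add fun ε hε => ?_⟩
  · have h1 := abs_pairing_le f.measure hv
    rw [one_mul] at h1
    exact (le_abs_self _).trans (h1.trans h)
  · obtain ⟨v, hv, hvε⟩ := exists_zeroAtInfty_near_variation f.measure hε
    have := h v hv
    rw [tv]
    linarith

lemma isClosed_tv_le (hd : 1 ≤ d) (hm : 2 ≤ m) (C : ℝ) :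
    IsClosed {f : RadonSpace d m | f.tv ≤ C} := by
  simp only [tv_le_iff, ofPred_forall]
  exact isClosed_iInter fun v => isClosed_iInter fun _ =>
    isClosed_le (continuous_pairing hd hm v) continuous_const

lemma lowerSemicontinuous_tv (hd : 1 ≤ d) (hm : 2 ≤ m) :
    LowerSemicontinuous (tv : RadonSpace d m → ℝ) :=
  lowerSemicontinuous_iff_isClosed_preimage.2 fun C => isClosed_tv_le hd hm C

end RadonSpace

lemma continuous_kernel (x : Euc d) : Continuous (kernel m x) := by
  have h := continuous_rho m
  unfold kernel kernelPoly
  fun_prop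

/-- The cutoff in the kernel cancels the ridge far out, so the kernel has compact support in
`z`. -/
lemma kernel_eq_zero (hm : 2 ≤ m) (x : Euc d) {z : Dom d} (hz : ‖x‖ + 1 < |z.1|) :
    kernel m x z = 0 := by
  have h1 := abs_le.1 (abs_inner_sph_le z.2 x)
  have hm1 : m - 1 ≠ 0 := by omega
  rw [kernel, kernelPoly]
  rcases le_total 0 z.1 with h | h
  · rw [abs_of_nonneg h] at hz
    rw [rho, max_eq_left (by linarith), zero_pow hm1, min_eq_left (by linarith),
      max_eq_left (by linarith)]
    simp
  · rw [abs_of_nonpos h] at hz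
    rw [rho, max_eq_right (by linarith), min_eq_right (by linarith [norm_nonneg x]),
      max_eq_right zero_le_one, one_mul, sub_self]

/-- The kernel `h(x, ·)` as a continuous function that vanishes at infinity. -/
def kernelC0 (hm : 2 ≤ m) (x : Euc d) : C₀(Dom d, ℝ) :=
  ⟨⟨kernel m x, continuous_kernel x⟩, by
    refine tendsto_const_nhds.congr' ?_
    filter_upwards [tendsto_abs_fst_cocompact.eventually_gt_atTop (‖x‖ + 1)] with z hz
    exact (kernel_eq_zero hm x hz).symm⟩

lemma RadonSpace.rep_eq_toFunctional (hd : 1 ≤ d) (hm : 2 ≤ m) (f : RadonSpace d m) (x : Euc d) :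
    f.rep x = toFunctional hd hm f (kernelC0 hm x) := rfl

lemma RadonSpace.continuous_rep (hd : 1 ≤ d) (hm : 2 ≤ m) (x : Euc d) :
    Continuous fun f : RadonSpace d m => f.rep x :=
  continuous_pairing hd hm (kernelC0 hm x)

end RadonSpace

/-! ### Compactness of the balls -/

section Riesz

variable {X : Type*} [TopologicalSpace X]

open scoped ZeroAtInfty CompactlySupported

/-- The positive linear functionals on `C₀(X)` of norm at most `C`, as a subset of a product of
lines. -/
def positiveFunctionals (X : Type*) [TopologicalSpace X] (C : ℝ) : Set (C₀(X, ℝ) → ℝ) :=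
  {p | (∀ u v, p (u + v) = p u + p v) ∧ (∀ (c : ℝ) v, p (c • v) = c * p v) ∧
    (∀ v, (∀ x, 0 ≤ v x) → 0 ≤ p v) ∧ ∀ v, |p v| ≤ C * ‖v‖}

lemma isCompact_positiveFunctionals (C : ℝ) : IsCompact (positiveFunctionals X C) := by
  have h : IsCompact (univ.pi fun v : C₀(X, ℝ) => Icc (-(C * ‖v‖)) (C * ‖v‖)) :=
    isCompact_univ_pi fun _ => isCompact_Icc
  refine h.of_isClosed_subset ?_ fun p hp v _ => abs_le.1 (hp.2.2.2 v)
  simp only [positiveFunctionals, ofPred_and, ofPred_forall]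
  refine IsClosed.inter (isClosed_iInter fun u => isClosed_iInter fun v => ?_)
    (IsClosed.inter (isClosed_iInter fun c => isClosed_iInter fun v => ?_)
      (IsClosed.inter (isClosed_iInter fun v => isClosed_iInter fun _ => ?_)
        (isClosed_iInter fun v => ?_)))
  · exact isClosed_eq (continuous_apply _) ((continuous_apply u).add (continuous_apply v))
  · exact isClosed_eq (continuous_apply _) (continuous_const.mul (continuous_apply v))
  · exact isClosed_le continuous_const (continuous_apply v)
  · exact isClosed_le (continuous_apply v).abs continuous_const

/-- Functions of compact support are dense in `C₀(X)`: subtract from `v` its truncation at the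
height `ε`. -/
lemma exists_compactlySupported_near [R1Space X] (v : C₀(X, ℝ)) {ε : ℝ} (hε : 0 < ε) :
    ∃ c : C_c(X, ℝ), ∀ x, |c x - v x| ≤ ε := by
  have h0 : ∀ᶠ z in cocompact X, |v z| < ε := by
    have := v.zero_at_infty'.eventually (Metric.ball_mem_nhds (0 : ℝ) hε)
    simpa using this
  obtain ⟨S, hS, hSv⟩ := mem_cocompact.1 h0
  have hcont : Continuous fun x => v x - max (-ε) (min (v x) ε) := by
    have := v.continuous
    fun_prop
  -- the function is supported in the closed set `ε ≤ |v|`, which is a subset of `S`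
  have hsupp : HasCompactSupport fun x => v x - max (-ε) (min (v x) ε) := by
    have hclosed : IsClosed {x | ε ≤ |v x|} := isClosed_le continuous_const v.continuous.abs
    have hsub : {x | ε ≤ |v x|} ⊆ S := fun x hx => by
      by_contra hxS
      have h1 : |v x| < ε := hSv hxS
      exact absurd hx (not_le.2 h1)
    refine HasCompactSupport.of_support_subset_isCompact
      (hS.of_isClosed_subset hclosed hsub) fun x hx => ?_
    by_contra hcon
    refine hx ?_
    have h1 := abs_lt.1 (not_le.1 (show ¬ε ≤ |v x| from hcon))
    change v x - max (-ε) (min (v x) ε) = 0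
    rw [min_eq_left h1.2.le, max_eq_right h1.1.le, sub_self]
  refine ⟨⟨⟨_, hcont⟩, hsupp⟩, fun x => ?_⟩
  change |v x - max (-ε) (min (v x) ε) - v x| ≤ ε
  rw [sub_sub_cancel_left, abs_neg, abs_le]
  exact ⟨le_max_left _ _, max_le (by linarith) (min_le_right _ _)⟩

/-- A positive bounded functional on `C₀(X)` is the integral against a finite measure. -/
lemma exists_measure_of_positive [T2Space X] [LocallyCompactSpace X] [MeasurableSpace X]
    [BorelSpace X] {C : ℝ} {p : C₀(X, ℝ) → ℝ} (hp : p ∈ positiveFunctionals X C) :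
    ∃ ν : Measure X, IsFiniteMeasure ν ∧ ∀ v : C₀(X, ℝ), ∫ x, v x ∂ν = p v := by
  obtain ⟨hadd, hsmul, hpos, hbd⟩ := hp
  set ι : C_c(X, ℝ) → C₀(X, ℝ) := fun c => ⟨c.toContinuousMap, c.hasCompactSupport.is_zero_at_infty⟩
  have hιc : ∀ c x, ι c x = c x := fun c x => rfl
  have hsub : ∀ u v, p (u - v) = p u - p v := fun u v => by
    rw [sub_eq_add_neg, hadd, ← neg_one_smul ℝ v, hsmul]; ring
  set Λ : C_c(X, ℝ) →ₚ[ℝ] ℝ :=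
    { toFun := fun c => p (ι c)
      map_add' := fun c c' => hadd (ι c) (ι c')
      map_smul' := fun a c => hsmul a (ι c)
      monotone' := fun c c' h => by
        have h1 := hpos (ι c' - ι c) fun x => sub_nonneg.2 (h x)
        rw [hsub] at h1
        exact sub_nonneg.1 h1 }
  have hΛ : ∀ c, Λ c = p (ι c) := fun c => rfl
  set ν := RealRMK.rieszMeasure Λ with hν
  have hle : ν univ ≤ ENNReal.ofReal |C| := by
    rw [isOpen_univ.measure_eq_iSup_isCompact]
    refine iSup_le fun K => iSup_le fun _ => iSup_le fun hK => ?_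
    obtain ⟨f, hf1, -, hf2, hf3⟩ := exists_continuous_one_zero_of_isCompact hK isClosed_empty
      (disjoint_empty K)
    refine (RealRMK.rieszMeasure_le_of_eq_one Λ (f := ⟨f, hf2⟩) (fun x => (hf3 x).1) hK
      (fun x hx => hf1 hx)).trans (ENNReal.ofReal_le_ofReal ?_)
    have h1 : ‖ι ⟨f, hf2⟩‖ ≤ 1 := by
      refine (BoundedContinuousFunction.norm_le zero_le_one).2 fun x => ?_
      change |f x| ≤ 1
      rw [abs_of_nonneg (hf3 x).1]
      exact (hf3 x).2
    calc Λ ⟨f, hf2⟩ ≤ C * ‖ι ⟨f, hf2⟩‖ := (le_abs_self _).trans (hbd _)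
      _ ≤ |C| * ‖ι ⟨f, hf2⟩‖ := by gcongr; exact le_abs_self C
      _ ≤ |C| := mul_le_of_le_one_right (abs_nonneg C) h1
  have hfin : IsFiniteMeasure ν := ⟨hle.trans_lt ENNReal.ofReal_lt_top⟩
  refine ⟨ν, hfin, fun v => ?_⟩
  have key : ∀ ε > 0, |∫ x, v x ∂ν - p v| ≤ ε * (ν.real univ + |C|) := by
    intro ε hε
    obtain ⟨c, hc⟩ := exists_compactlySupported_near v hε
    have h1 : ∫ x, c x ∂ν = p (ι c) := RealRMK.integral_rieszMeasure Λ c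
    have hvint : Integrable (fun x => v x) ν := v.toBCF.integrable ν
    have hcint : Integrable (fun x => c x) ν := (ι c).toBCF.integrable ν
    have h2 : |∫ x, v x ∂ν - ∫ x, c x ∂ν| ≤ ε * ν.real univ := by
      rw [← integral_sub hvint hcint, ← Real.norm_eq_abs]
      refine norm_integral_le_of_norm_le_const (μ := ν) (Eventually.of_forall fun x => ?_)
      rw [Real.norm_eq_abs, abs_sub_comm]
      exact hc x
    have h3 : |p (ι c) - p v| ≤ ε * |C| := by
      rw [← hsub]
      have h4 : ‖ι c - v‖ ≤ ε := (BoundedContinuousFunction.norm_le hε.le).2 hc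
      calc |p (ι c - v)| ≤ C * ‖ι c - v‖ := hbd _
        _ ≤ |C| * ‖ι c - v‖ := by gcongr; exact le_abs_self C
        _ ≤ |C| * ε := by gcongr
        _ = ε * |C| := mul_comm _ _
    rw [h1] at h2
    have h5 := abs_sub_le (∫ x, v x ∂ν) (p (ι c)) (p v)
    linarith
  have hlim : Tendsto (fun ε : ℝ => ε * (ν.real univ + |C|)) (𝓝[>] 0) (𝓝 0) := by
    have h1 : Continuous fun ε : ℝ => ε * (ν.real univ + |C|) := by fun_prop
    have h2 := h1.tendsto 0
    rw [zero_mul] at h2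
    exact h2.mono_left nhdsWithin_le_nhds
  have h0 : |∫ x, v x ∂ν - p v| ≤ 0 :=
    ge_of_tendsto hlim (eventually_mem_nhdsWithin.mono fun ε hε => key ε hε)
  exact sub_eq_zero.1 (abs_nonpos_iff.1 h0)

lemma integral_mem_positiveFunctionals [MeasurableSpace X] [OpensMeasurableSpace X] (ν : Measure X)
    [IsFiniteMeasure ν] {C : ℝ} (hC : ν.real univ ≤ C) :
    (fun v : C₀(X, ℝ) => ∫ x, v x ∂ν) ∈ positiveFunctionals X C := by
  have hint : ∀ v : C₀(X, ℝ), Integrable (fun x => v x) ν := fun v => v.toBCF.integrable ν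
  refine ⟨fun u v => integral_add (hint u) (hint v), fun c v => integral_const_mul c _,
    fun v hv => integral_nonneg hv, fun v => ?_⟩
  refine (norm_integral_le_of_norm_le_const (Eventually.of_forall
    fun x => v.toBCF.norm_coe_le_norm x)).trans ?_
  rw [mul_comm]
  exact mul_le_mul_of_nonneg_right hC (norm_nonneg _)

end Riesz

section Balls

variable {d m : ℕ}

open scoped ZeroAtInfty

/-- The part of a signed measure with the parity `(-1)^m`. -/
lemma exists_parityMeasure (m : ℕ) (μ : SignedMeasure (Dom d)) :
    ∃ ν : SignedMeasure (Dom d), HasParity m ν ∧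
      ∀ v : C₀(Dom d, ℝ), pairing ν v = pairing μ (parityPart m v) := by
  set e := (Homeomorph.neg (Dom d)).toMeasurableEquiv
  refine ⟨(2⁻¹ : ℝ) • (μ + ((-1 : ℝ) ^ m) • μ.map e), fun A hA => ?_, fun v => ?_⟩
  · have hA' : MeasurableSet (Neg.neg ⁻¹' A) := e.measurable hA
    have h1 : ∀ B, MeasurableSet B → μ.map e B = μ (Neg.neg ⁻¹' B) := fun B hB =>
      VectorMeasure.map_apply _ e.measurable hB
    simp only [_root_.smul_apply, _root_.add_apply, smul_eq_mul, h1 A hA, h1 _ hA']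
    rw [← preimage_comp, neg_comp_neg, preimage_id]
    linear_combination -(2⁻¹ * μ (Neg.neg ⁻¹' A)) * neg_one_pow_mul_self m
  · have hv := integrable_of_zeroAtInfty μ v
    have hr := integrable_of_zeroAtInfty μ (reflectC0 v)
    have hr' : VectorMeasure.Integrable μ fun z => ((-1 : ℝ) ^ m) • reflectC0 v z :=
      hr.smul ((-1 : ℝ) ^ m)
    have h1 : (parityPart m v : Dom d → ℝ) =
        fun z => (2⁻¹ : ℝ) • (v z + ((-1 : ℝ) ^ m) • reflectC0 v z) := rfl
    have h2 : ∫ᵛ z, v z ∂<•(μ.map e) = ∫ᵛ z, reflectC0 v z ∂<•μ :=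
      VectorMeasure.integral_map_equiv e v
    rw [pairing, VectorMeasure.integral_smul_vectorMeasure,
      VectorMeasure.integral_add_vectorMeasure hv
        ((integrable_of_zeroAtInfty (μ.map e) v).smul_vectorMeasure _),
      VectorMeasure.integral_smul_vectorMeasure, h2, pairing, h1, VectorMeasure.integral_fun_smul,
      VectorMeasure.integral_fun_add hv hr', VectorMeasure.integral_fun_smul]

lemma pairing_sub_zeroAtInfty (ν₁ ν₂ : Measure (Dom d)) [IsFiniteMeasure ν₁] [IsFiniteMeasure ν₂]
    (v : C₀(Dom d, ℝ)) :
    pairing (ν₁.toSignedMeasure - ν₂.toSignedMeasure) v = ∫ z, v z ∂ν₁ - ∫ z, v z ∂ν₂ :=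
  pairing_toSignedMeasure_sub ν₁ ν₂ (v.toBCF.integrable ν₁) (v.toBCF.integrable ν₂)

/-- The balls of the total variation norm are weak* compact: they are closed subsets of the
continuous image of the pairs of bounded positive functionals. -/
lemma RadonSpace.isCompact_tv_le (hd : 1 ≤ d) (hm : 2 ≤ m) (C : ℝ) :
    IsCompact {f : RadonSpace d m | f.tv ≤ C} := by
  set K := positiveFunctionals (Dom d) C with hK
  have hKc : CompactSpace (K ×ˢ K : Set _) := isCompact_iff_compactSpace.1
    ((isCompact_positiveFunctionals C).prod (isCompact_positiveFunctionals C))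
  have hex : ∀ q : (K ×ˢ K : Set _), ∃ f : RadonSpace d m, ∀ v : C₀(Dom d, ℝ),
      pairing f.measure v = q.1.1 (parityPart m v) - q.1.2 (parityPart m v) := by
    intro q
    obtain ⟨ν₁, _, h1⟩ := exists_measure_of_positive q.2.1
    obtain ⟨ν₂, _, h2⟩ := exists_measure_of_positive q.2.2
    obtain ⟨ν, hν, hνv⟩ := exists_parityMeasure m (ν₁.toSignedMeasure - ν₂.toSignedMeasure)
    refine ⟨ofMeasure hm ν hν, fun v => ?_⟩
    rw [measure_ofMeasure hd hm, hνv, pairing_sub_zeroAtInfty, h1, h2]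
  choose Ψ hΨ using hex
  have hcont : Continuous Ψ := by
    rw [(isInducing_toFunctional hd hm).continuous_iff, continuous_pi_iff]
    intro v
    have h1 : (fun q => ((toFunctional hd hm) ∘ Ψ) q v) =
        fun q : (K ×ˢ K : Set _) => q.1.1 (parityPart m v) - q.1.2 (parityPart m v) :=
      funext fun q => hΨ q v
    rw [h1]
    exact ((continuous_apply _).comp (continuous_fst.comp continuous_subtype_val)).sub
      ((continuous_apply _).comp (continuous_snd.comp continuous_subtype_val))
  refine (isCompact_range hcont).of_isClosed_subset (isClosed_tv_le hd hm C) fun f hf => ?_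
  set j := f.measure.toJordanDecomposition with hj
  have htv : j.posPart.real univ + j.negPart.real univ = f.tv := by
    rw [tv, ← SignedMeasure.totalVariation_eq_variation, SignedMeasure.totalVariation,
      measureReal_add_apply]
  have hfC : f.tv ≤ C := hf
  have hpos := integral_mem_positiveFunctionals j.posPart (C := C)
    (by linarith [measureReal_nonneg (μ := j.negPart) (s := univ)])
  have hneg := integral_mem_positiveFunctionals j.negPart (C := C)
    (by linarith [measureReal_nonneg (μ := j.posPart) (s := univ)])
  refine ⟨⟨(_, _), hpos, hneg⟩, ?_⟩
  have hinj : ∀ g : RadonSpace d m, (∀ v : C₀(Dom d, ℝ), pairing g.measure v = pairing f.measure v) →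
      g = f := fun g hg => by
    ext φ
    rw [f.isRepresentedBy_measure.apply_eq, g.isRepresentedBy_measure.apply_eq]
    exact hg (intRadonC0 hm φ)
  refine hinj _ fun v => ?_
  rw [hΨ, ← f.isRepresentedBy_measure.hasParity.pairing_parityPart v]
  dsimp only
  rw [← pairing_sub_zeroAtInfty]
  have h3 : j.posPart.toSignedMeasure - j.negPart.toSignedMeasure = f.measure :=
    f.measure.toSignedMeasure_toJordanDecomposition
  rw [h3]

end Balls

/-! ### Existence of minimisers -/

section Minimisers

variable {d m M : ℕ}

open scoped ZeroAtInfty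

/-- The functional of the variational problem as a real number. -/
def realObjective (E : ℝ → ℝ → ℝ) (x : Fin M → Euc d) (y : Fin M → ℝ) (lam : ℝ)
    (f : RadonSpace d m) : ℝ :=
  ∑ i, E (y i) (f.rep (x i)) + lam * f.tv

lemma objective_eq_coe (hd : 1 ≤ d) (hm : 2 ≤ m) (E : ℝ → ℝ → ℝ) (x : Fin M → Euc d)
    (y : Fin M → ℝ) (lam : ℝ) (f : RadonSpace d m) :
    objective E x y lam f = (realObjective E x y lam f : EReal) := by
  rw [objective, realObjective, f.radonNorm_eq hd hm, EReal.coe_ennreal_ofReal,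
    max_eq_left f.tv_nonneg, EReal.coe_add, EReal.coe_mul]

lemma mem_solutionSet_iff (hd : 1 ≤ d) (hm : 2 ≤ m) {E : ℝ → ℝ → ℝ} {x : Fin M → Euc d}
    {y : Fin M → ℝ} {lam : ℝ} {f : RadonSpace d m} :
    f ∈ solutionSet m E x y lam ↔
      ∀ g : RadonSpace d m, realObjective E x y lam f ≤ realObjective E x y lam g := by
  simp only [solutionSet, mem_ofPred_eq, objective_eq_coe hd hm, EReal.coe_le_coe_iff]

lemma RadonSpace.rep_add (hd : 1 ≤ d) (hm : 2 ≤ m) (f g : RadonSpace d m) (x : Euc d) :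
    (f + g).rep x = f.rep x + g.rep x := by
  simp only [rep_eq_toFunctional hd hm, map_add, Pi.add_apply]

lemma RadonSpace.rep_smul (hd : 1 ≤ d) (hm : 2 ≤ m) (c : ℝ) (f : RadonSpace d m) (x : Euc d) :
    (c • f).rep x = c * f.rep x := by
  simp only [rep_eq_toFunctional hd hm, map_smul, Pi.smul_apply, smul_eq_mul]

lemma RadonSpace.rep_sum (hd : 1 ≤ d) (hm : 2 ≤ m) {ι : Type*} (s : Finset ι) (c : ι → ℝ)
    (f : ι → RadonSpace d m) (x : Euc d) :
    (∑ i ∈ s, c i • f i).rep x = ∑ i ∈ s, c i * (f i).rep x := by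
  simp only [rep_eq_toFunctional hd hm, map_sum, map_smul, Finset.sum_apply, Pi.smul_apply,
    smul_eq_mul]

lemma lowerSemicontinuous_realObjective (hd : 1 ≤ d) (hm : 2 ≤ m) {E : ℝ → ℝ → ℝ}
    (hE : ∀ y, ConvexOn ℝ univ (E y)) (x : Fin M → Euc d) (y : Fin M → ℝ) {lam : ℝ}
    (hlam : 0 ≤ lam) : LowerSemicontinuous (realObjective (m := m) E x y lam) := by
  have h1 : Continuous fun f : RadonSpace d m => ∑ i, E (y i) (f.rep (x i)) :=
    continuous_finsetSum _ fun i _ =>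
      ((hE (y i)).locallyLipschitz.continuous).comp (RadonSpace.continuous_rep hd hm (x i))
  have h2 : LowerSemicontinuous fun f : RadonSpace d m => lam * f.tv :=
    (continuous_const.mul continuous_id : Continuous fun s : ℝ => lam * s).comp_lowerSemicontinuous
      (RadonSpace.lowerSemicontinuous_tv hd hm) fun a b h => mul_le_mul_of_nonneg_left h hlam
  exact h1.lowerSemicontinuous.add h2

lemma convexOn_realObjective (hd : 1 ≤ d) (hm : 2 ≤ m) {E : ℝ → ℝ → ℝ}
    (hE : ∀ y, ConvexOn ℝ univ (E y)) (x : Fin M → Euc d) (y : Fin M → ℝ) {lam : ℝ}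
    (hlam : 0 ≤ lam) : ConvexOn ℝ univ (realObjective (m := m) E x y lam) := by
  refine ⟨convex_univ, fun f _ g _ a b ha hb hab => ?_⟩
  have h1 : (a • f + b • g).tv ≤ a * f.tv + b * g.tv := by
    refine (RadonSpace.tv_add_le hd hm _ _).trans (le_of_eq ?_)
    rw [RadonSpace.tv_smul hd hm, RadonSpace.tv_smul hd hm, abs_of_nonneg ha, abs_of_nonneg hb]
  have h2 : ∑ i, E (y i) ((a • f + b • g).rep (x i)) ≤
      a * ∑ i, E (y i) (f.rep (x i)) + b * ∑ i, E (y i) (g.rep (x i)) := by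
    rw [Finset.mul_sum, Finset.mul_sum, ← Finset.sum_add_distrib]
    refine Finset.sum_le_sum fun i _ => ?_
    rw [RadonSpace.rep_add hd hm, RadonSpace.rep_smul hd hm, RadonSpace.rep_smul hd hm]
    exact (hE (y i)).2 (mem_univ _) (mem_univ _) ha hb hab
  simp only [realObjective, smul_eq_mul]
  have h3 := mul_le_mul_of_nonneg_left h1 hlam
  linarith

/-- The direct method: the sublevel sets of the functional are contained in balls of the total
variation norm, which are compact. -/
lemma exists_mem_solutionSet (hd : 1 ≤ d) (hm : 2 ≤ m) {E : ℝ → ℝ → ℝ}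
    (hE_nonneg : ∀ y v, 0 ≤ E y v) (hE : ∀ y, ConvexOn ℝ univ (E y)) (x : Fin M → Euc d)
    (y : Fin M → ℝ) {lam : ℝ} (hlam : 0 < lam) :
    (solutionSet m E x y lam).Nonempty ∧ IsCompact (solutionSet m E x y lam) := by
  set J : RadonSpace d m → ℝ := realObjective E x y lam with hJ
  have htv : ∀ f C, J f ≤ C → f.tv ≤ C / lam := fun f C h => by
    have h1 : 0 ≤ ∑ i, E (y i) (f.rep (x i)) := Finset.sum_nonneg fun i _ => hE_nonneg _ _
    rw [le_div_iff₀ hlam]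
    have h2 : J f = ∑ i, E (y i) (f.rep (x i)) + lam * f.tv := rfl
    linarith
  have hlsc := lowerSemicontinuous_realObjective (m := m) hd hm hE x y hlam.le
  set B := {f : RadonSpace d m | f.tv ≤ J 0 / lam} with hB
  have hBc : IsCompact B := RadonSpace.isCompact_tv_le hd hm _
  obtain ⟨f, hfB, hf⟩ := LowerSemicontinuousOn.exists_isMinOn (s := B) ⟨0, htv 0 _ le_rfl⟩ hBc
    (hlsc.lowerSemicontinuousOn B)
  rw [isMinOn_iff] at hf
  have hfS : f ∈ solutionSet m E x y lam := by
    refine (mem_solutionSet_iff hd hm).2 fun g => ?_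
    by_cases hg : J g ≤ J 0
    · exact hf g (htv g _ hg)
    · exact (hf 0 (htv 0 _ le_rfl)).trans (not_le.1 hg).le
  have hS : solutionSet m E x y lam = {g | J g ≤ J f} := by
    ext g
    rw [mem_solutionSet_iff hd hm]
    exact ⟨fun h => h f, fun h k => (show J g ≤ J f from h).trans
      ((mem_solutionSet_iff hd hm).1 hfS k)⟩
  refine ⟨⟨f, hfS⟩, ?_⟩
  rw [hS]
  refine hBc.of_isClosed_subset (lowerSemicontinuous_iff_isClosed_preimage.1 hlsc (J f))
    fun g hg => htv g _ ((show J g ≤ J f from hg).trans (hf 0 (htv 0 _ le_rfl)))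

lemma convex_solutionSet (hd : 1 ≤ d) (hm : 2 ≤ m) {E : ℝ → ℝ → ℝ}
    (hE : ∀ y, ConvexOn ℝ univ (E y)) (x : Fin M → Euc d) (y : Fin M → ℝ) {lam : ℝ}
    (hlam : 0 ≤ lam) : Convex ℝ (solutionSet m E x y lam) := by
  intro f hf g hg a b ha hb hab
  rw [mem_solutionSet_iff hd hm] at hf hg ⊢
  intro k
  refine ((convexOn_realObjective hd hm hE x y hlam).2 (mem_univ f) (mem_univ g) ha hb hab).trans ?_
  rw [smul_eq_mul, smul_eq_mul]
  calc _ ≤ a * realObjective E x y lam k + b * realObjective E x y lam k :=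
        add_le_add (mul_le_mul_of_nonneg_left (hf k) ha) (mul_le_mul_of_nonneg_left (hg k) hb)
    _ = realObjective E x y lam k := by rw [← add_mul, hab, one_mul]

lemma solutionSet_eq_closure (hd : 1 ≤ d) (hm : 2 ≤ m) {E : ℝ → ℝ → ℝ}
    (hE_nonneg : ∀ y v, 0 ≤ E y v) (hE : ∀ y, ConvexOn ℝ univ (E y)) (x : Fin M → Euc d)
    (y : Fin M → ℝ) {lam : ℝ} (hlam : 0 < lam) :
    solutionSet m E x y lam =
      closure (convexHull ℝ (extremePoints ℝ (solutionSet m E x y lam))) := by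
  have := RadonSpace.isTopologicalAddGroup (m := m) hd hm
  have := RadonSpace.continuousSMul (m := m) hd hm
  have := RadonSpace.locallyConvexSpace (m := m) hd hm
  have := RadonSpace.t2Space (m := m) hd hm
  exact (closure_convexHull_extremePoints (exists_mem_solutionSet hd hm hE_nonneg hE x y hlam).2
    (convex_solutionSet hd hm hE x y hlam.le)).symm

end Minimisers

/-! ### Extreme points -/

section Extreme

variable {d m M : ℕ}

open scoped ZeroAtInfty

namespace RadonSpace

lemma measure_sum (hd : 1 ≤ d) (hm : 2 ≤ m) {ι : Type*} (s : Finset ι) (c : ι → ℝ)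
    (f : ι → RadonSpace d m) :
    (∑ i ∈ s, c i • f i).measure = ∑ i ∈ s, c i • (f i).measure := by
  classical
  induction s using Finset.induction_on with
  | empty =>
    have h := measure_smul hd hm 0 (0 : RadonSpace d m)
    rw [zero_smul, zero_smul] at h
    simpa using h
  | insert i s hi ih =>
    rw [Finset.sum_insert hi, Finset.sum_insert hi, measure_add hd hm, measure_smul hd hm, ih]

/-- The restriction of the representing measure to a symmetric set keeps the parity. -/
lemma hasParity_restrict (f : RadonSpace d m) {A : Set (Dom d)} (hA : MeasurableSet A)
    (hsymm : Neg.neg ⁻¹' A = A) : HasParity m (f.measure.restrict A) := by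
  intro B hB
  have hB' : MeasurableSet (Neg.neg ⁻¹' B) := (Homeomorph.neg (Dom d)).toMeasurableEquiv.measurable hB
  rw [VectorMeasure.restrict_apply _ hA hB', VectorMeasure.restrict_apply _ hA hB]
  nth_rw 1 [← hsymm]
  rw [← preimage_inter]
  exact f.isRepresentedBy_measure.parity _ (hB.inter hA)

lemma exists_restrict (hd : 1 ≤ d) (hm : 2 ≤ m) (f : RadonSpace d m) {A : Set (Dom d)}
    (hA : MeasurableSet A) (hsymm : Neg.neg ⁻¹' A = A) :
    ∃ g : RadonSpace d m, g.measure = f.measure.restrict A ∧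
      g.tv = f.measure.variation.real A := by
  refine ⟨ofMeasure hm _ (f.hasParity_restrict hA hsymm), measure_ofMeasure hd hm _, ?_⟩
  rw [tv, measure_ofMeasure hd hm, VectorMeasure.variation_restrict hA,
    measureReal_restrict_apply_univ]

end RadonSpace

/-- The measure of an extreme point of the solution set does not charge `M + 1` disjoint symmetric
sets. Otherwise one could rescale the measure on these sets, up and down, without a change of the
`M` values `P f (x_i)`. The total variation is affine along this perturbation, so that both
perturbed distributions are solutions as well. -/
lemma not_exists_disjoint_of_mem_extremePoints (hd : 1 ≤ d) (hm : 2 ≤ m) {E : ℝ → ℝ → ℝ}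
    {x : Fin M → Euc d} {y : Fin M → ℝ} {lam : ℝ} (hlam : 0 < lam) {f : RadonSpace d m}
    (hf : f ∈ extremePoints ℝ (solutionSet m E x y lam)) (A : Fin (M + 1) → Set (Dom d))
    (hA : ∀ j, MeasurableSet (A j)) (hsymm : ∀ j, Neg.neg ⁻¹' (A j) = A j)
    (hdisj : Pairwise (Function.onFun Disjoint A)) :
    ¬∀ j, 0 < f.measure.variation.real (A j) := by
  intro hpos
  set μ := f.measure with hμ
  set V : Fin (M + 1) → ℝ := fun j => μ.variation.real (A j) with hV
  have hU : MeasurableSet (⋃ j, A j) := MeasurableSet.iUnion hA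
  choose g hgμ hgtv using fun j => f.exists_restrict hd hm (hA j) (hsymm j)
  obtain ⟨r, hrμ, hrtv⟩ := f.exists_restrict hd hm hU.compl (by
    rw [preimage_compl, preimage_iUnion]
    simp only [hsymm])
  -- the decomposition of `f`
  have hdecomp : f = r + ∑ j, (1 : ℝ) • g j := by
    refine RadonSpace.eq_of_measure_eq ?_
    rw [RadonSpace.measure_add hd hm, RadonSpace.measure_sum hd hm, hrμ]
    simp only [one_smul, hgμ]
    ext B hB
    have h1 : μ B = μ (B ∩ (⋃ j, A j)ᶜ) + μ (B ∩ ⋃ j, A j) := by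
      rw [← VectorMeasure.of_union (Disjoint.mono inter_subset_right inter_subset_right
        disjoint_compl_left) (hB.inter hU.compl) (hB.inter hU), ← inter_union_distrib_left,
        compl_union_self, inter_univ]
    have h2 : μ (B ∩ ⋃ j, A j) = ∑ j, μ (B ∩ A j) := by
      have h3 := μ.of_biUnion_finset (s := Finset.univ) (f := fun j => B ∩ A j)
        (fun i _ j _ hij => (hdisj hij).mono inter_subset_right inter_subset_right)
        (fun j _ => hB.inter (hA j))
      rw [← h3, inter_iUnion]
      simp
    rw [h1, h2, _root_.add_apply, VectorMeasure.restrict_apply _ hU.compl hB]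
    congr 1
    rw [FunLike.coe_sum, Finset.sum_apply]
    exact Finset.sum_congr rfl fun j _ => (VectorMeasure.restrict_apply _ (hA j) hB).symm
  have htv : f.tv = r.tv + ∑ j, V j := by
    rw [hrtv, RadonSpace.tv, ← measureReal_add_measureReal_compl hU, add_comm]
    congr 1
    exact measureReal_iUnion_fintype hdisj hA
  -- a nontrivial combination of the parts that all the measurements annihilate
  obtain ⟨s, hs, hs0⟩ : ∃ s : Fin (M + 1) → ℝ, (∀ i, ∑ j, s j * (g j).rep (x i) = 0) ∧ s ≠ 0 := by
    set T : (Fin (M + 1) → ℝ) →ₗ[ℝ] (Fin M → ℝ) :=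
      Matrix.mulVecLin (Matrix.of fun i j => (g j).rep (x i)) with hT
    obtain ⟨s, hs, hs0⟩ := Submodule.exists_mem_ne_zero_of_ne_bot
      (LinearMap.ker_ne_bot_of_finrank_lt (f := T) (by simp))
    refine ⟨s, fun i => ?_, hs0⟩
    have h1 := congrFun (LinearMap.mem_ker.1 hs) i
    simp only [hT, Matrix.mulVecLin_apply, Matrix.mulVec, dotProduct, Matrix.of_apply,
      Pi.zero_apply] at h1
    rw [← h1]
    exact Finset.sum_congr rfl fun j _ => mul_comm _ _
  set h : RadonSpace d m := ∑ j, s j • g j with hh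
  set L : ℝ := ∑ j, s j * V j with hL
  have hmin := (mem_solutionSet_iff hd hm).1 hf.1
  have hval : ∀ σ : ℝ, (∀ j, 0 ≤ 1 + σ * s j) →
      realObjective E x y lam (f + σ • h) ≤ realObjective E x y lam f + lam * (σ * L) := by
    intro σ hσ
    have h1 : f + σ • h = r + ∑ j, (1 + σ * s j) • g j := by
      conv_lhs => rw [hdecomp]
      rw [hh, Finset.smul_sum, add_assoc, ← Finset.sum_add_distrib]
      congr 1
      refine Finset.sum_congr rfl fun j _ => ?_
      rw [smul_smul, add_smul]
    have h2 : (f + σ • h).tv ≤ f.tv + σ * L := by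
      rw [h1]
      refine (RadonSpace.tv_add_le hd hm _ _).trans ?_
      have h3 := RadonSpace.tv_sum_le hd hm Finset.univ fun j => (1 + σ * s j) • g j
      have h4 : ∑ j, ((1 + σ * s j) • g j).tv = ∑ j, V j + σ * L := by
        rw [hL, Finset.mul_sum, ← Finset.sum_add_distrib]
        refine Finset.sum_congr rfl fun j _ => ?_
        rw [RadonSpace.tv_smul hd hm, abs_of_nonneg (hσ j), hgtv]
        ring
      rw [htv]
      linarith
    have h3 : ∀ i, (f + σ • h).rep (x i) = f.rep (x i) := fun i => by
      rw [RadonSpace.rep_add hd hm, RadonSpace.rep_smul hd hm, hh, RadonSpace.rep_sum hd hm, hs,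
        mul_zero, add_zero]
    simp only [realObjective, h3]
    have h4 := mul_le_mul_of_nonneg_left h2 hlam.le
    linarith
  -- a step size for which both perturbations keep the signs
  set ε : ℝ := (1 + ∑ j, |s j|)⁻¹ with hε
  have hε0 : 0 < ε := by positivity
  have hεs : ∀ j, |ε * s j| ≤ 1 := fun j => by
    rw [abs_mul, abs_of_pos hε0, hε, inv_mul_le_one₀ (by positivity)]
    have := Finset.single_le_sum (f := fun j => |s j|) (fun j _ => abs_nonneg _) (Finset.mem_univ j)
    linarith
  have hplus := hval ε fun j => by linarith [(abs_le.1 (hεs j)).1]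
  have hminus := hval (-ε) fun j => by linarith [(abs_le.1 (hεs j)).2]
  have hL0 : L = 0 := by
    have h1 := hmin (f + ε • h)
    have h2 := hmin (f + (-ε) • h)
    have h3 : 0 ≤ lam * ε * L := by linarith
    have h4 : 0 ≤ -(lam * ε * L) := by linarith
    have h5 : 0 < lam * ε := mul_pos hlam hε0
    have h6 : lam * ε * L = 0 := by linarith
    exact (mul_eq_zero.1 h6).resolve_left h5.ne'
  simp only [hL0, mul_zero, add_zero] at hplus hminus
  have hfp : f + ε • h ∈ solutionSet m E x y lam :=
    (mem_solutionSet_iff hd hm).2 fun k => hplus.trans (hmin k)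
  have hfm : f + (-ε) • h ∈ solutionSet m E x y lam :=
    (mem_solutionSet_iff hd hm).2 fun k => hminus.trans (hmin k)
  have hseg : f ∈ openSegment ℝ (f + ε • h) (f + (-ε) • h) := by
    refine ⟨2⁻¹, 2⁻¹, by norm_num, by norm_num, by norm_num, ?_⟩
    rw [neg_smul, ← smul_add, add_add_add_comm, add_neg_cancel, add_zero, ← two_smul ℝ f, smul_smul]
    norm_num
  have heq := hf.2 hfp hfm hseg
  have hh0 : h = 0 := by
    have h1 : ε • h = 0 := by simpa using heq
    exact (smul_eq_zero.1 h1).resolve_left hε0.ne'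
  -- the perturbation vanishes only if all its coefficients do
  obtain ⟨k, hk⟩ : ∃ k, s k ≠ 0 := Function.ne_iff.1 hs0
  have hmeas : h.measure = ∑ j, s j • μ.restrict (A j) := by
    rw [hh, RadonSpace.measure_sum hd hm]
    exact Finset.sum_congr rfl fun j _ => by rw [hgμ]
  have hzero : h.measure = 0 := by
    rw [hh0]
    have h1 := RadonSpace.measure_smul hd hm 0 (0 : RadonSpace d m)
    rwa [zero_smul, zero_smul] at h1
  have hvar : μ.variation (A k) = 0 := by
    rw [VectorMeasure.variation_apply_eq_zero (hA k)]
    intro B hBA hB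
    have h1 : (∑ j, s j • μ.restrict (A j)) B = 0 := by rw [← hmeas, hzero]; rfl
    rw [FunLike.coe_sum, Finset.sum_apply, Finset.sum_eq_single k] at h1
    · rw [_root_.smul_apply, VectorMeasure.restrict_eq_self _ (hA k) hB hBA, smul_eq_mul] at h1
      exact (mul_eq_zero.1 h1).resolve_left hk
    · intro j _ hjk
      rw [_root_.smul_apply, VectorMeasure.restrict_apply _ (hA j) hB,
        ((hdisj hjk.symm).mono_left hBA).inter_eq, VectorMeasure.empty, smul_zero]
    · exact fun hk' => absurd (Finset.mem_univ k) hk'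
  have := hpos k
  rw [measureReal_def, hvar, ENNReal.toReal_zero] at this
  exact lt_irrefl _ this

lemma neg_ne_self_dom (z : Dom d) : -z ≠ z := by
  intro h
  have h1 : -(z.2 : Euc d) = z.2 := congrArg (fun w : Dom d => (w.2 : Euc d)) h
  have h2 : (z.2 : Euc d) = 0 := by
    have h4 : (2 : ℝ) • (z.2 : Euc d) = 0 := by
      rw [two_smul]
      nth_rw 1 [← h1]
      exact neg_add_cancel _
    exact (smul_eq_zero.1 h4).resolve_left two_ne_zero
  have h3 := norm_sph z.2
  rw [h2, norm_zero] at h3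
  exact zero_ne_one h3

/-- Families of points of the support that are distinct up to the sign. -/
def IsOrbitFamily (f : RadonSpace d m) {n : ℕ} (z : Fin n → Dom d) : Prop :=
  (∀ j, z j ∈ f.measure.variation.support) ∧ ∀ i j, i ≠ j → z i ≠ z j ∧ z i ≠ -z j

lemma not_isOrbitFamily (hd : 1 ≤ d) (hm : 2 ≤ m) {E : ℝ → ℝ → ℝ} {x : Fin M → Euc d}
    {y : Fin M → ℝ} {lam : ℝ} (hlam : 0 < lam) {f : RadonSpace d m}
    (hf : f ∈ extremePoints ℝ (solutionSet m E x y lam)) (z : Fin (M + 1) → Dom d) :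
    ¬IsOrbitFamily f z := by
  rintro ⟨hz, hne⟩
  have hfin : (range z ∪ range fun j => -z j).Finite := (finite_range _).union (finite_range _)
  obtain ⟨U, hU, hUd⟩ := hfin.t2_separation
  -- symmetric neighbourhoods of the orbits
  set W : Fin (M + 1) → Set (Dom d) := fun j => U (z j) ∩ Neg.neg ⁻¹' U (-z j) with hW
  have hWo : ∀ j, IsOpen (W j) := fun j => (hU _).2.inter ((hU _).2.preimage continuous_neg)
  have hWo' : ∀ j, IsOpen (Neg.neg ⁻¹' W j) := fun j => (hWo j).preimage continuous_neg
  have hWz : ∀ j, z j ∈ W j := fun j => ⟨(hU _).1, (hU (-z j)).1⟩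
  have hmem : ∀ j, z j ∈ range z ∪ range fun j => -z j := fun j => Or.inl ⟨j, rfl⟩
  have hmem' : ∀ j, -z j ∈ range z ∪ range fun j => -z j := fun j => Or.inr ⟨j, rfl⟩
  refine not_exists_disjoint_of_mem_extremePoints hd hm hlam hf
    (fun j => W j ∪ Neg.neg ⁻¹' W j) (fun j => ((hWo j).union (hWo' j)).measurableSet)
    (fun j => ?_) (fun i j hij => ?_) fun j => ?_
  · rw [preimage_union, ← preimage_comp, neg_comp_neg, preimage_id, union_comm]
  · have h1 : Disjoint (U (z i)) (U (z j)) := hUd (hmem i) (hmem j) (hne i j hij).1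
    have h2 : Disjoint (U (z i)) (U (-z j)) := hUd (hmem i) (hmem' j) (hne i j hij).2
    have h3 : Disjoint (U (-z i)) (U (z j)) := hUd (hmem' i) (hmem j) fun h =>
      (hne i j hij).2 (neg_eq_iff_eq_neg.1 h)
    have h4 : Disjoint (U (-z i)) (U (-z j)) := hUd (hmem' i) (hmem' j) fun h =>
      (hne i j hij).1 (neg_injective h)
    have h5 : ∀ k, Neg.neg ⁻¹' W k ⊆ U (-z k) := fun k p hp => by
      have h6 : -(-p) ∈ U (-z k) := hp.2
      rwa [neg_neg] at h6
    have h7 : ∀ k, W k ⊆ U (z k) := fun k => inter_subset_left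
    exact disjoint_union_left.2 ⟨disjoint_union_right.2 ⟨h1.mono (h7 i) (h7 j), h2.mono (h7 i) (h5 j)⟩,
      disjoint_union_right.2 ⟨h3.mono (h5 i) (h7 j), h4.mono (h5 i) (h5 j)⟩⟩
  · have h1 := (Measure.mem_support_iff_forall _).1 (hz j) (W j ∪ Neg.neg ⁻¹' W j)
      (((hWo j).union (hWo' j)).mem_nhds (Or.inl (hWz j)))
    exact ENNReal.toReal_pos h1.ne' (measure_ne_top _ _)

/-- The support of an extreme point consists of at most `M` pairs `{z, -z}`. -/
lemma exists_maximal_orbitFamily (hd : 1 ≤ d) (hm : 2 ≤ m) {E : ℝ → ℝ → ℝ} {x : Fin M → Euc d}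
    {y : Fin M → ℝ} {lam : ℝ} (hlam : 0 < lam) {f : RadonSpace d m}
    (hf : f ∈ extremePoints ℝ (solutionSet m E x y lam)) :
    ∃ K ≤ M, ∃ z : Fin K → Dom d, IsOrbitFamily f z ∧
      ∀ p ∈ f.measure.variation.support, ∃ j, p = z j ∨ p = -z j := by
  by_contra! hcon
  have hall : ∀ n ≤ M + 1, ∃ z : Fin n → Dom d, IsOrbitFamily f z := by
    intro n
    induction n with
    | zero => exact fun _ => ⟨Fin.elim0, fun j => j.elim0, fun i => i.elim0⟩
    | succ n ih =>
      intro hn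
      obtain ⟨z, hz⟩ := ih (by omega)
      obtain ⟨p, hp, hpz⟩ := hcon n (by omega) z hz
      refine ⟨Fin.cons p z, fun j => ?_, fun i j hij => ?_⟩
      · refine Fin.cases ?_ (fun j => ?_) j
        · exact hp
        · exact hz.1 j
      · induction i using Fin.cases with
        | zero =>
          induction j using Fin.cases with
          | zero => exact absurd rfl hij
          | succ j => exact hpz j
        | succ i =>
          induction j using Fin.cases with
          | zero =>
            exact ⟨(hpz i).1.symm, fun h => (hpz i).2 (neg_eq_iff_eq_neg.1 h.symm)⟩
          | succ j => exact hz.2 i j fun h => hij (congrArg Fin.succ h)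
  obtain ⟨z, hz⟩ := hall (M + 1) le_rfl
  exact not_isOrbitFamily hd hm hlam hf z hz

/-- Integrals against a measure whose support consists of finitely many pairs `{z, -z}`. -/
lemma pairing_eq_sum {f : RadonSpace d m} {K : ℕ} {z : Fin K → Dom d} (hz : IsOrbitFamily f z)
    (hsupp : ∀ p ∈ f.measure.variation.support, ∃ j, p = z j ∨ p = -z j) (v : C₀(Dom d, ℝ)) :
    pairing f.measure v =
      ∑ j, f.measure {z j} * (v (z j) + (-1) ^ m * v (-z j)) := by
  set μ := f.measure with hμ
  have hint := integrable_of_zeroAtInfty μ v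
  have hD : ∀ j, MeasurableSet ({z j} ∪ {-z j} : Set (Dom d)) := fun j =>
    (measurableSet_singleton _).union (measurableSet_singleton _)
  have hae : ∀ᵐ p ∂μ.variation, p ∉ (⋃ j, ({z j} ∪ {-z j} : Set (Dom d))) → v p = 0 := by
    filter_upwards [Measure.support_mem_ae (μ := μ.variation)] with p hp hpn
    obtain ⟨j, hj⟩ := hsupp p hp
    exact absurd (mem_iUnion.2 ⟨j, hj⟩) hpn
  have hdisj : Pairwise (Function.onFun Disjoint fun j => ({z j} ∪ {-z j} : Set (Dom d))) := by
    intro i j hij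
    have h1 := hz.2 i j hij
    rw [Function.onFun, Set.disjoint_left]
    rintro p (rfl | rfl) (h | h)
    · exact h1.1 h
    · exact h1.2 h
    · exact h1.2 (neg_eq_iff_eq_neg.1 h)
    · exact h1.1 (neg_injective h)
  rw [pairing, ← VectorMeasure.setIntegral_eq_integral_of_ae_compl_eq_zero
    (MeasurableSet.iUnion hD) hae, VectorMeasure.setIntegral_iUnion_fintype hD hdisj
    fun j => hint.integrableOn]
  refine Finset.sum_congr rfl fun j _ => ?_
  have hd' : Disjoint ({z j} : Set (Dom d)) {-z j} :=
    disjoint_singleton.2 (neg_ne_self_dom (z j)).symm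
  rw [VectorMeasure.setIntegral_union hd' (measurableSet_singleton _) (measurableSet_singleton _)
    hint.integrableOn hint.integrableOn, VectorMeasure.integral_singleton,
    VectorMeasure.integral_singleton]
  have h2 : μ {-z j} = (-1) ^ m * μ {z j} := by
    rw [← f.isRepresentedBy_measure.parity _ (measurableSet_singleton _)]
    congr 1
    ext p
    exact neg_eq_iff_eq_neg.symm
  simp only [ContinuousLinearMap.flip_apply, ContinuousLinearMap.lsmul_apply, smul_eq_mul, h2]
  ring

lemma totalDegree_ridgePoly_le (m : ℕ) (z : Dom d) : (ridgePoly m z).totalDegree ≤ m - 1 := by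
  have h1 : (∑ i, MvPolynomial.C ((z.2 : Euc d) i) * MvPolynomial.X i -
      MvPolynomial.C z.1 : MvPolynomial (Fin d) ℝ).totalDegree ≤ 1 := by
    refine (MvPolynomial.totalDegree_sub_C_le _ _).trans ?_
    refine MvPolynomial.totalDegree_finsetSum_le fun i _ => ?_
    refine (MvPolynomial.totalDegree_mul _ _).trans ?_
    rw [MvPolynomial.totalDegree_C, MvPolynomial.totalDegree_X]
  refine (MvPolynomial.totalDegree_mul _ _).trans ?_
  rw [MvPolynomial.totalDegree_C, zero_add]
  refine (MvPolynomial.totalDegree_pow _ _).trans ?_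
  calc (m - 1) * _ ≤ (m - 1) * 1 := Nat.mul_le_mul_left _ h1
    _ = m - 1 := mul_one _

/-- The part of the kernel with the parity `(-1)^m` is the corrected ridge. -/
lemma kernel_add_kernel_neg (hm : 2 ≤ m) (x : Euc d) (z : Dom d) :
    kernel m x z + (-1) ^ m * kernel m x (-z) =
      2 * (rho m (⟪(z.2 : Euc d), x⟫ - z.1) -
        MvPolynomial.eval (fun i => x i) (ridgePoly m z)) := by
  set u := ⟪(z.2 : Euc d), x⟫ - z.1 with hu
  set q := u ^ (m - 1) / (Nat.factorial (m - 1) : ℝ) with hq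
  have h1 : kernel m x z = rho m u - max 0 (min (-z.1) 1) * q := by
    rw [kernel, kernelPoly, ← hu, hq, mul_div_assoc]
  have hpar : (-1 : ℝ) ^ m * (-1) ^ (m - 1) = -1 := by
    obtain ⟨n, rfl⟩ : ∃ n, m = n + 1 := ⟨m - 1, by omega⟩
    rw [Nat.add_sub_cancel, pow_succ, mul_right_comm, neg_one_pow_mul_self, one_mul]
  have h2 : (-1 : ℝ) ^ m * kernel m x (-z) = rho m u - q + max 0 (min z.1 1) * q := by
    rw [kernel, kernelPoly, inner_neg_dom, ← hu, rho_neg hm, Prod.fst_neg, neg_neg, neg_pow u,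
      mul_sub, ← mul_assoc, neg_one_pow_mul_self, one_mul, ← hq]
    have h3 : (-1 : ℝ) ^ m * (max 0 (min z.1 1) * ((-1) ^ (m - 1) * u ^ (m - 1)) /
        (Nat.factorial (m - 1) : ℝ)) = ((-1) ^ m * (-1) ^ (m - 1)) * (max 0 (min z.1 1) * q) := by
      rw [hq]; ring
    rw [h3, hpar]
    ring
  have h4 : MvPolynomial.eval (fun i => x i) (ridgePoly m z) =
      (1 - max (-1) (min z.1 1)) / 2 * q := by
    rw [ridgePoly, map_mul, map_pow, eval_linear_sub, MvPolynomial.eval_C, ← hu, hq]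
    ring
  have h5 : max (-1) (min z.1 1) = max 0 (min z.1 1) - max 0 (min (-z.1) 1) := by
    rcases le_total 0 z.1 with h | h
    · rw [min_eq_left (by linarith : -z.1 ≤ 1), max_eq_left (by linarith : -z.1 ≤ 0), sub_zero,
        max_eq_right (le_min h zero_le_one), max_eq_right (by
          linarith [le_min h (zero_le_one (α := ℝ))])]
    · rw [min_eq_left (by linarith : z.1 ≤ 1), max_eq_left h,
        max_eq_right (le_min (by linarith) zero_le_one), zero_sub]
      rcases le_total (-1) z.1 with h' | h'
      · rw [max_eq_right h', min_eq_left (by linarith), neg_neg]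
      · rw [max_eq_left h', min_eq_right (by linarith)]
  rw [h1, h2, h4, h5]
  ring

/-- Extreme points of the solution set are finite combinations of ridges. -/
lemma exists_ridge_expansion (hd : 1 ≤ d) (hm : 2 ≤ m) {E : ℝ → ℝ → ℝ} {x : Fin M → Euc d}
    {y : Fin M → ℝ} {lam : ℝ} (hlam : 0 < lam) {f : RadonSpace d m}
    (hf : f ∈ extremePoints ℝ (solutionSet m E x y lam)) :
    ∃ K ≤ M, ∃ (a : Fin K → ℝ) (z : Fin K → Dom d),
      (∀ φ : lizorkin d, f.toDist φ = ∑ k, a k * intRadon m φ (z k)) ∧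
      ∀ v : Euc d, f.rep v = ∑ k, a k * (rho m (⟪((z k).2 : Euc d), v⟫ - (z k).1) -
        MvPolynomial.eval (fun i => v i) (ridgePoly m (z k))) := by
  obtain ⟨K, hK, z, hz, hsupp⟩ := exists_maximal_orbitFamily hd hm hlam hf
  -- the pair `{z, -z}` contributes the even or odd part twice
  refine ⟨K, hK, fun k => 2 * f.measure {z k}, z, fun φ => ?_, fun v => ?_⟩
  · rw [f.isRepresentedBy_measure.apply_eq]
    refine (pairing_eq_sum hz hsupp (intRadonC0 hm φ)).trans (Finset.sum_congr rfl fun k _ => ?_)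
    rw [intRadonC0_apply, intRadonC0_apply, intRadon_neg hm]
    linear_combination (f.measure {z k} * intRadon m φ (z k)) * neg_one_pow_mul_self m
  · refine (pairing_eq_sum hz hsupp (kernelC0 hm v)).trans (Finset.sum_congr rfl fun k _ => ?_)
    have h1 : ∀ p, kernelC0 hm v p = kernel m v p := fun _ => rfl
    rw [h1, h1, kernel_add_kernel_neg hm]
    ring

end Extreme

end RadonSpline

end

theorem mainTheorem5 (d m M : ℕ) (hd : 1 ≤ d) (hm : 2 ≤ m)
    (E : ℝ → ℝ → ℝ) (hE_nonneg : ∀ y v, 0 ≤ E y v)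
    (hE : ∀ y, StrictConvexOn ℝ Set.univ (E y))
    (x : Fin M → EuclideanSpace ℝ (Fin d)) (y : Fin M → ℝ) (lam : ℝ) (hlam : 0 < lam) :
    (RadonSpline.solutionSet m E x y lam).Nonempty ∧
    IsCompact (RadonSpline.solutionSet m E x y lam) ∧
    RadonSpline.solutionSet m E x y lam =
      closure (convexHull ℝ (Set.extremePoints ℝ (RadonSpline.solutionSet m E x y lam))) ∧
    ∀ f ∈ Set.extremePoints ℝ (RadonSpline.solutionSet m E x y lam),
      ∃ K : ℕ, K ≤ M ∧ ∃ (a : Fin K → ℝ) (t : Fin K → ℝ)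
        (ξ : Fin K → Metric.sphere (0 : EuclideanSpace ℝ (Fin d)) 1),
        (∀ φ : RadonSpline.lizorkin d,
          f.toDist φ = ∑ k, a k * RadonSpline.intRadon m φ (t k, ξ k)) ∧
        (∀ k, (RadonSpline.ridgePoly m (t k, ξ k)).totalDegree ≤ m - 1) ∧
        ∀ v : EuclideanSpace ℝ (Fin d),
          f.rep v = ∑ k, a k *
            (RadonSpline.rho m (inner ℝ (ξ k : EuclideanSpace ℝ (Fin d)) v - t k) -
              MvPolynomial.eval (fun i => v i) (RadonSpline.ridgePoly m (t k, ξ k))) := by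
  have hE' := fun y => (hE y).convexOn
  obtain ⟨hne, hcomp⟩ := RadonSpline.exists_mem_solutionSet (m := m) hd hm hE_nonneg hE' x y hlam
  refine ⟨hne, hcomp, RadonSpline.solutionSet_eq_closure hd hm hE_nonneg hE' x y hlam,
    fun f hf => ?_⟩
  obtain ⟨K, hK, a, z, h1, h2⟩ := RadonSpline.exists_ridge_expansion hd hm hlam hf
  exact ⟨K, hK, a, fun k => (z k).1, fun k => (z k).2, h1,
    fun k => RadonSpline.totalDegree_ridgePoly_le m _, h2⟩
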